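/- **Setting.** Let $n\ge 1$, let $\Omega\subset\mathbb R^n$ be a bounded domain (open, connected, nonempty), $x_0\in\Omega$, and let $\tilde\Omega\supseteq\Omega$ satisfy $|\tilde\Omega\setminus\Omega|=0$. Put $\hat\Omega=\{x\in\tilde\Omega: d(x,\mathbb R^n\setminus\tilde\Omega)>0\}$, $\hat d(x)=d(x,\mathbb R^n\setminus\hat\Omega)$, $\hat\Omega_\varepsilon=\{x\in\hat\Omega:\hat d(x)>\varepsilon\}$, and let $d_{\hat\Omega}(x)$ be the infimum of the lengths of the curves joining $x$ to $x_0$ in $\hat\Omega$. *Path systems.* A path system is a family of curves $\gamma_y=\gamma(\cdot,y):[0,1]\to\hat\Omega$, $y\in\hat\Omega$, such that (a) $\gamma(0,y)=y$, $\gamma(1,y)=x_0$; (b) $(t,y)\mapsto\gamma(t,y)$ is measurable; (c) there is a constant $K$ with $\ell(\gamma_y\cap B(x,r))\le Kr$ for all $x,y\in\Omega$ and $0<r\le\frac12\hat d(x)$ (length counted with multiplicity, i.e. $\int_{\{t:\gamma_y(t)\in B(x,r)\}}|\dot\gamma_y|\,dt$), with $\ell(\gamma_y)\le K d_{\hat\Omega}(y)$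 for all $y\in\hat\Omega$, and with $\gamma_y$ Lipschitz on $[0,1]$ with constant $K d_{\hat\Omega}(y)$; (d) for every $\varepsilon>0$ there is $\delta>0$ such that $\gamma_y\subset\hat\Omega_\delta$ for all $y\in\hat\Omega_\varepsilon$. *Kernel.* Let $s>0$ with $\overline{B(x_0,s)}\subseteq\Omega$ and $\hat d(x_0)\ge 15 s$, and let $\chi\in C^\infty(\mathbb R^n)$ be supported in $\overline{B(x_0,s)}$ with $\int\chi=1$. Given a path system $\gamma$: if $\gamma_y$ meets $\partial B(y,\frac12\hat d(y))$, let $\tau(y)$ be the first time at which it does so and put $$\rho(t,y)=\frac{2}{\hat d(x_0)}\frac{\hat d(\gamma(\tau(y),y))}{\hat d(y)}\,|y-\gamma(t,y)|\ \ (t\le\tau(y)),\qquad \rho(t,y)=\frac{\hat d(\gamma(t,y))}{\hat d(x_0)}\ \ (t>\tau(y));$$ otherwise put $\rho(t,y)=t$. Let $$G(x,y)=\int_0^1\Big[\dot\gamma(t,y)+\dot\rho(t,y)\frac{x-\gamma(t,y)}{\rho(t,y)}\Big]\chi\Big(x_0+\frac{x-\gamma(t,y)}{\rho(t,y)}\Big)\frac{dt}{\rho(t,y)^n}.$$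 *Weight and test functions.* For a finite positive Radon measure $\mu_0\neq0$ on $\Omega$ put, for $x\in\Omega$, $$w_0(x)=\int_\Omega|x-y|^{1-n}\,d\mu_0(y)+\hat d(x)^{1-n}\,\mu_0\Big(\Big\{y\in\Omega:\exists t\in[0,1],\ |\gamma(t,y)-x|\le\tfrac12\hat d(x)\Big\}\Big).$$ Let $\mathscr E$ be the set of locally integrable functions $g$ on $\hat\Omega$ (identified with their continuous representatives) having a locally integrable weak gradient $\nabla g$ in $\hat\Omega$ such that for every $\delta>0$ there is a finite $r>n$ with $|\nabla g|\in L^r(\hat\Omega_\delta)$, and such that $g\in L^1(\mu_0)$ and $|\nabla g|\,w_0\in L^1(\Omega)$. **Theorem.** Path systems exist. For every path system $\gamma$ and all $s,\chi$ as above there is $C>0$ such that for every nontrivial finite positive Radon measure $\mu_0$ on $\Omega$ with $d_{\hat\Omega}\in L^1(\mu_0)$ the following hold. (A) $w_0\in L^1(\Omega)$ and $w_0>0$ a.e. on $\Omega$. (B) Let $\kappa>0$ and let $\mu$ be a finite signed Radon measure on $\Omega$ with $\mu(\Omega)=0$ and $|\mu|\le\kappa\mu_0$. For a.e. $x\in\Omega$,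 the integral defining $G(x,y)$ converges absolutely for $|\mu|$-a.e. $y$, and $G(x,\cdot)\in L^1(|\mu|)$. The function $$u(x)=\int_\Omega G(x,y)\,d\mu(y)$$ is measurable, satisfies $|u|\le C\kappa w_0$ a.e. on $\Omega$, and for every $g\in\mathscr E$ the function $u\cdot\nabla g$ is integrable on $\Omega$ and $$\int_\Omega u\cdot\nabla g\,dx=-\int_\Omega g\,d\mu .$$ In particular this holds for every $g$ that is locally Lipschitz on $\hat\Omega$ with bounded local Lipschitz constant and belongs to $L^1(\mu_0)$, and for every Lipschitz function $g$ on $\mathbb R^n$ ($\nabla g$ being the a.e. defined gradient). -/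

import Mathlib

open Set MeasureTheory Topology
open scoped ENNReal NNReal ContDiff Gradient

noncomputable section

/-- Euclidean space `ℝⁿ`. -/
abbrev Rn (n : ℕ) := EuclideanSpace ℝ (Fin n)

/-- The open set `Ω̂ = {x ∈ Ω̃ : d(x, ℝⁿ ∖ Ω̃) > 0}` associated with a cover `Ω̃`. -/
def hatSet {n : ℕ} (T : Set (Rn n)) : Set (Rn n) :=
  {x | x ∈ T ∧ 0 < Metric.infDist x Tᶜ}

/-- `d̂(x) = d(x, ℝⁿ ∖ U)`. -/
def bdist {n : ℕ} (U : Set (Rn n)) (x : Rn n) : ℝ :=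
  Metric.infDist x Uᶜ

/-- `U_ε = {x ∈ U : d(x, ℝⁿ ∖ U) > ε}`. -/
def innerSet {n : ℕ} (U : Set (Rn n)) (ε : ℝ) : Set (Rn n) :=
  {x | x ∈ U ∧ ε < bdist U x}

/-- Geodesic distance from `x` to `x₀` in `U`: the infimum of the lengths of the curves joining
`x` to `x₀` in `U` (curves that are not rectifiable have length `⊤`). -/
def geodesicDist {n : ℕ} (U : Set (Rn n)) (x₀ x : Rn n) : ℝ≥0∞ :=
  ⨅ (c : ℝ → Rn n) (_ : ContinuousOn c (Icc 0 1) ∧ MapsTo c (Icc 0 1) U ∧ c 0 = x ∧ c 1 = x₀),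
    eVariationOn c (Icc 0 1)

/-- Length (counted with multiplicity) of the part of the Lipschitz curve `c : [0,1] → ℝⁿ` that
lies in the set `B`. -/
def lengthIn {n : ℕ} (c : ℝ → Rn n) (B : Set (Rn n)) : ℝ≥0∞ :=
  ∫⁻ t in {t : ℝ | t ∈ Icc (0 : ℝ) 1 ∧ c t ∈ B}, ‖deriv c t‖ₑ

/-- A system of paths `γ(t, y)`, `0 ≤ t ≤ 1`, joining every `y ∈ U` to `x₀` inside `U` in an almost
geodesic fashion; here `U` is the cover `Ω̂` of `Ω`. -/
structure IsPathSystem {n : ℕ} (Ω U : Set (Rn n)) (x₀ : Rn n) (γ : ℝ → Rn n → Rn n) : Prop where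
  mapsTo : ∀ y ∈ U, ∀ t ∈ Icc (0 : ℝ) 1, γ t y ∈ U
  start : ∀ y ∈ U, γ 0 y = y
  finish : ∀ y ∈ U, γ 1 y = x₀
  measurable : Measurable fun p : Icc (0 : ℝ) 1 × U => γ p.1 p.2
  ahlfors : ∃ K : ℝ≥0, ∀ x ∈ Ω, ∀ y ∈ Ω, ∀ r : ℝ, 0 < r → r ≤ bdist U x / 2 →
    lengthIn (fun t => γ t y) (Metric.ball x r) ≤ K * ENNReal.ofReal r
  /-- The length of `γ_y` is `≲ d_U(y)`, and `γ_y` is parametrized with speed `≲ d_U(y)`. -/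
  length_le : ∃ K : ℝ≥0, ∀ y ∈ U,
    eVariationOn (fun t => γ t y) (Icc 0 1) ≤ K * geodesicDist U x₀ y ∧
    ∀ s ∈ Icc (0 : ℝ) 1, ∀ t ∈ Icc (0 : ℝ) 1,
      edist (γ s y) (γ t y) ≤ K * geodesicDist U x₀ y * edist s t
  inner : ∀ ε > 0, ∃ δ > 0, ∀ y ∈ innerSet U ε, ∀ t ∈ Icc (0 : ℝ) 1, γ t y ∈ innerSet U δ

/-- `ω(x) = μ₀({y ∈ Ω : |γ(t, y) - x| ≤ d̂(x) / 2 for some t ∈ [0,1]})`. -/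
def omegaFn {n : ℕ} (Ω U : Set (Rn n)) (γ : ℝ → Rn n → Rn n) (μ₀ : Measure (Rn n))
    (x : Rn n) : ℝ≥0∞ :=
  μ₀ {y | y ∈ Ω ∧ ∃ t ∈ Icc (0 : ℝ) 1, ‖γ t y - x‖ ≤ bdist U x / 2}

/-- The localized Riesz potential `I₁μ₀(x) = ∫_Ω |x - y|^{1-n} dμ₀(y)`. -/
def rieszPot {n : ℕ} (Ω : Set (Rn n)) (μ₀ : Measure (Rn n)) (x : Rn n) : ℝ≥0∞ :=
  ∫⁻ y in Ω, ‖x - y‖ₑ ^ (1 - (n : ℤ)) ∂μ₀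

/-- The weight `w₀(x) = I₁μ₀(x) + ω(x) d̂(x)^{1-n}`. -/
def weight {n : ℕ} (Ω U : Set (Rn n)) (γ : ℝ → Rn n → Rn n) (μ₀ : Measure (Rn n))
    (x : Rn n) : ℝ≥0∞ :=
  rieszPot Ω μ₀ x + omegaFn Ω U γ μ₀ x * ENNReal.ofReal (bdist U x) ^ (1 - (n : ℤ))

/-- The times at which `γ_y` meets the sphere `∂B(y, d̂(y) / 2)`. -/
def hitSet {n : ℕ} (U : Set (Rn n)) (γ : ℝ → Rn n → Rn n) (y : Rn n) : Set ℝ :=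
  {t | t ∈ Icc (0 : ℝ) 1 ∧ γ t y ∈ Metric.sphere y (bdist U y / 2)}

/-- The first time at which `γ_y` meets `∂B(y, d̂(y) / 2)`. -/
def hitTime {n : ℕ} (U : Set (Rn n)) (γ : ℝ → Rn n → Rn n) (y : Rn n) : ℝ :=
  sInf (hitSet U γ y)

open Classical in
/-- The radius function `ρ(t, y)`: with `τ` the hitting time,
`ρ(t, y) = α |y - γ(t, y)|` for `t ≤ τ` and `ρ(t, y) = d̂(γ(t, y)) / d̂(x₀)` for `t > τ`,
where `α = (2 / d̂(x₀)) d̂(γ(τ, y)) / d̂(y)`; and `ρ(t, y) = t` if the sphere is never met. -/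
def radiusFn {n : ℕ} (U : Set (Rn n)) (x₀ : Rn n) (γ : ℝ → Rn n → Rn n) (t : ℝ) (y : Rn n) : ℝ :=
  if (hitSet U γ y).Nonempty then
    if t ≤ hitTime U γ y then
      2 / bdist U x₀ * (bdist U (γ (hitTime U γ y) y) / bdist U y) * ‖y - γ t y‖
    else bdist U (γ t y) / bdist U x₀
  else t

/-- The integrand of the Bogovskii-type kernel,
`[γ' + ρ' (x - γ) / ρ] χ(x₀ + (x - γ) / ρ) ρ⁻ⁿ` at `(t, y)`. -/
def kernelIntegrand {n : ℕ} (U : Set (Rn n)) (x₀ : Rn n) (γ : ℝ → Rn n → Rn n) (χ : Rn n → ℝ)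
    (x y : Rn n) (t : ℝ) : Rn n :=
  (χ (x₀ + (radiusFn U x₀ γ t y)⁻¹ • (x - γ t y)) * ((radiusFn U x₀ γ t y) ^ n)⁻¹) •
    (deriv (fun s => γ s y) t +
      (deriv (fun s => radiusFn U x₀ γ s y) t * (radiusFn U x₀ γ t y)⁻¹) • (x - γ t y))

/-- The Bogovskii-type kernel `G(x, y)`. -/
def kernel {n : ℕ} (U : Set (Rn n)) (x₀ : Rn n) (γ : ℝ → Rn n → Rn n) (χ : Rn n → ℝ)
    (x y : Rn n) : Rn n :=
  ∫ t in (0 : ℝ)..1, kernelIntegrand U x₀ γ χ x y t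

/-- The constructed solution `u(x) = ∫_Ω G(x, y) dμ(y)` of `div u = μ`. -/
def bogSolution {n : ℕ} (Ω U : Set (Rn n)) (x₀ : Rn n) (γ : ℝ → Rn n → Rn n) (χ : Rn n → ℝ)
    (μ : SignedMeasure (Rn n)) (x : Rn n) : Rn n :=
  ∫ᵛ y in Ω, kernel U x₀ γ χ x y ∂<•μ

/-- `v` is a weak gradient of `g` in the open set `U`. -/
def IsWeakGradient {n : ℕ} (U : Set (Rn n)) (g : Rn n → ℝ) (v : Rn n → Rn n) : Prop :=
  LocallyIntegrableOn g U ∧ LocallyIntegrableOn v U ∧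
    ∀ φ : Rn n → ℝ, ContDiff ℝ ∞ φ → HasCompactSupport φ → tsupport φ ⊆ U →
      ∫ x in U, g x • ∇ φ x = -∫ x in U, φ x • v x

/-- The class `𝒢` on `U` (a function is given together with its weak gradient). Every member has
a representative continuous in `U`, because the gradient is locally in `Lʳ` with `r > n`;
this representative is the one that is meant. -/
def MemG {n : ℕ} (U : Set (Rn n)) (g : Rn n → ℝ) (v : Rn n → Rn n) : Prop :=
  ContinuousOn g U ∧ IsWeakGradient U g v ∧
    ∀ δ : ℝ, 0 < δ → ∃ r : ℝ, (n : ℝ) < r ∧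
      MemLp v (ENNReal.ofReal r) (volume.restrict (innerSet U δ))

/-- The class `ℰ`: the members `g` of `𝒢` with `g ∈ L¹(μ₀)` and `|∇g| w ∈ L¹(Ω)`. -/
def MemE {n : ℕ} (Ω U : Set (Rn n)) (μ₀ : Measure (Rn n)) (w : Rn n → ℝ≥0∞)
    (g : Rn n → ℝ) (v : Rn n → Rn n) : Prop :=
  MemG U g v ∧ IntegrableOn g Ω μ₀ ∧ ∫⁻ x in Ω, ‖v x‖ₑ * w x < ⊤

end

noncomputable section


/-! ### Distance to the complement, and the set between a domain and its closure -/

section Geometry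

variable {n : ℕ}

/-! Write U for `hatSet T`. Fix a label y and carry the mollifier along its path: k_t(x) = ρ⁻ⁿ χ(x₀
+ (x - γ)/ρ) is a bump of mass one near γ(t, y). It starts as the point mass at y, where ρ = 0, and
ends as χ, where ρ = 1 and γ = x₀. The bracket in the kernel is the velocity of this motion, so k_t
solves a continuity equation (`hasDerivAt_tubeKernel`, `sum_fderiv_tubeField`). Pairing with g and
integrating in time gives ∫ G(x, y)·∇g(x) dx = ∫ g χ - g(y). The first term on the right does not
depend on y, so integration against a measure μ with μ(Ω) = 0 leaves -∫ g dμ.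

The tube swept out by the bumps stays inside U because 15 s ≤ d̂(x₀) (`IsPath.mul_radiusFn_lt`).
Time integration has to cope with the zeros of ρ. If the path leaves B(y, d̂(y)/2), it may first
return to y many times, and `sub_eq_integral_of_forall_avoiding` integrates across this closed set
of times. If it never leaves, then ρ = t, and the integral is truncated at η > 0 and passed to the
limit.

The kernel is bounded by `majorant`, whose μ₀-potential is the weight. Before the hitting time ρ is
comparable with |x - y| on the support of the integrand, afterwards with d̂(x). The integrand is
then at most a constant times |γ'| |x - y|⁻ⁿ or |γ'| d̂(x)⁻ⁿ, and the bound on the length of γ_y in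
balls about x gains one power. Paths that never hit are uniformly Lipschitz, since their labels lie
close to x₀, and the integral is estimated directly. In dimension one this estimate uses
cancellation, because the integrand is a total time derivative.

Integrability of the weight follows by Fubini once the integral of `majorant` in x is bounded by a
constant plus a multiple of the geodesic distance of y. A curve that meets B(x, d̂(x)/2) either
remains near x up to its end x₀, which bounds d̂(x) below, or spends a time at least comparable with
d̂(x)/L near x, where L is its Lipschitz constant (`IsPath.indicator_le`).

Path systems are built from polygons. Among step chains of length at most twice the geodesic
distance, one with the fewest vertices has separated vertices, since otherwise a shortcut would
exist; hence a bounded number of its edges meets each ball well inside U. Measurability in y comes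
from using countably many such curves: y runs straight to the first suitable node of a dense
sequence and then follows the curve of that node. -/

theorem compl_nonempty_of_isBounded (hn : 1 ≤ n) {U : Set (Rn n)} (hU : Bornology.IsBounded U) :
    Uᶜ.Nonempty := by
  have : Nonempty (Fin n) := ⟨⟨0, hn⟩⟩
  rw [nonempty_compl]
  rintro rfl
  exact NormedSpace.unbounded_univ ℝ (Rn n) hU

theorem bdist_nonneg (U : Set (Rn n)) (x : Rn n) : 0 ≤ bdist U x := Metric.infDist_nonneg

theorem bdist_le_add (U : Set (Rn n)) (x y : Rn n) : bdist U x ≤ bdist U y + ‖x - y‖ := by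
  rw [← dist_eq_norm]; exact Metric.infDist_le_infDist_add_dist

theorem abs_bdist_sub_le (U : Set (Rn n)) (x y : Rn n) : |bdist U x - bdist U y| ≤ ‖x - y‖ := by
  rw [abs_le]
  constructor
  · have := bdist_le_add U y x
    rw [norm_sub_rev] at this
    linarith
  · linarith [bdist_le_add U x y]

theorem continuous_bdist (U : Set (Rn n)) : Continuous (bdist U) :=
  Metric.continuous_infDist_pt _

theorem bdist_pos {U : Set (Rn n)} (hU : IsOpen U) (hUc : Uᶜ.Nonempty) {x : Rn n} (hx : x ∈ U) :
    0 < bdist U x :=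
  (hU.isClosed_compl.notMem_iff_infDist_pos hUc).1 (by simpa using hx)

theorem mem_of_norm_sub_lt_bdist {U : Set (Rn n)} {x y : Rn n} (h : ‖y - x‖ < bdist U x) :
    y ∈ U := by
  by_contra hy
  have := Metric.infDist_le_dist_of_mem (x := x) (show y ∈ Uᶜ from hy)
  rw [dist_comm, dist_eq_norm] at this
  exact absurd h (not_lt.2 this)

theorem hatSet_eq_interior {T : Set (Rn n)} (hT : Tᶜ.Nonempty) : hatSet T = interior T := by
  ext x
  simp only [hatSet, mem_ofPred_eq]
  rw [← Metric.infDist_pos_iff_notMem_closure hT, closure_compl, mem_compl_iff, not_not]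
  exact ⟨fun h => h.2, fun h => ⟨interior_subset h, h⟩⟩

theorem compl_nonempty_of_null_diff (hn : 1 ≤ n) {Ω T : Set (Rn n)} (hΩb : Bornology.IsBounded Ω)
    (hT : volume (T \ Ω) = 0) : Tᶜ.Nonempty := by
  have : Nonempty (Fin n) := ⟨⟨0, hn⟩⟩
  rw [nonempty_compl]
  rintro rfl
  have h1 : volume (univ : Set (Rn n)) ≤ volume (univ \ Ω) + volume Ω := by
    refine le_trans (measure_mono ?_) (measure_union_le _ _)
    simp
  rw [hT, zero_add] at h1
  exact absurd (h1.trans_lt hΩb.measure_lt_top) (by simp)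

theorem null_hatSet_diff {Ω T : Set (Rn n)} (hT : volume (T \ Ω) = 0) :
    volume (hatSet T \ Ω) = 0 :=
  measure_mono_null (sdiff_subset_sdiff_left fun _ h => h.1) hT

/-- A nonempty open piece of U outside the closure of Ω would have positive measure. Squeezing U
between Ω and its closure makes it bounded and connected. -/
theorem subset_closure_of_null_diff {Ω U : Set (Rn n)} (hU : IsOpen U)
    (hUΩ : volume (U \ Ω) = 0) : U ⊆ closure Ω := by
  intro x hx
  by_contra h
  have ho : IsOpen (U ∩ (closure Ω)ᶜ) := hU.inter isClosed_closure.isOpen_compl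
  have h0 := ho.measure_pos volume ⟨x, hx, h⟩
  refine h0.ne' (measure_mono_null ?_ hUΩ)
  exact fun y hy => ⟨hy.1, fun hyΩ => hy.2 (subset_closure hyΩ)⟩

end Geometry

/-! ### Integration across a closed set of exceptional times -/

/-- A function whose increments are given by the integral of `f` on intervals avoiding a closed
set `Z`, and which is constant on `Z`, is given by integration of `f` everywhere. -/
theorem sub_eq_integral_of_forall_avoiding {F f : ℝ → ℝ} {a b : ℝ} (hab : a ≤ b) {Z : Set ℝ}
    (hZ : IsClosed Z) (hf : IntervalIntegrable f volume a b)
    (hF : ∀ p q, a ≤ p → p ≤ q → q ≤ b → Disjoint (Icc p q) Z → F q - F p = ∫ t in p..q, f t)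
    (hFc : ContinuousOn F (Icc a b)) {m : ℝ} (hFZ : ∀ t ∈ Z ∩ Icc a b, F t = m)
    (hfZ : ∀ t ∈ Z ∩ Icc a b, f t = 0) :
    F b - F a = ∫ t in a..b, f t := by
  have hfi : ∀ p ∈ Icc a b, ∀ q ∈ Icc a b, IntervalIntegrable f volume p q := fun p hp q hq =>
    hf.mono_set (by rw [uIcc_of_le hab]; exact uIcc_subset_Icc hp hq)
  -- The complement of `Z` may have infinitely many components, so increments cannot be added up gap
  -- by gap. Instead the defect `D` is shown to be absolutely continuous with derivative zero almost
  -- everywhere.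
  set D : ℝ → ℝ := fun t => F t - ∫ u in a..t, f u with hD
  have hPc : ContinuousOn (fun t => ∫ u in a..t, f u) (Icc a b) := by
    have := intervalIntegral.continuousOn_primitive_interval
      (μ := volume) (f := f) (a := a) (b := b) (by
        rw [uIcc_of_le hab, integrableOn_Icc_iff_integrableOn_Ioc]
        exact (intervalIntegrable_iff_integrableOn_Ioc_of_le hab).1 hf)
    rwa [uIcc_of_le hab] at this
  have hDc : ContinuousOn D (Icc a b) := hFc.sub hPc
  have hDsub : ∀ p ∈ Icc a b, ∀ q ∈ Icc a b, D q - D p = F q - F p - ∫ t in p..q, f t := by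
    intro p hp q hq
    have := intervalIntegral.integral_add_adjacent_intervals
      (hfi a ⟨le_rfl, hab⟩ p hp) (hfi p hp q hq)
    simp only [hD]; linarith
  -- increments on half-open intervals avoiding `Z`
  have h0 : ∀ p q, a ≤ p → p ≤ q → q ≤ b → Disjoint (Icc p q) Z → D q = D p := by
    intro p q hp hpq hq hd
    have := hDsub p ⟨hp, hpq.trans hq⟩ q ⟨hp.trans hpq, hq⟩
    rw [hF p q hp hpq hq hd, sub_self] at this
    linarith
  have hl : ∀ p q, a ≤ p → p ≤ q → q ≤ b → Disjoint (Ico p q) Z → D q = D p := by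
    intro p q hp hpq hq hd
    rcases hpq.eq_or_lt with rfl | hlt
    · rfl
    have hc : ContinuousWithinAt D (Ico p q) q :=
      (hDc q ⟨hp.trans hpq, hq⟩).mono (Ico_subset_Icc_self.trans (Icc_subset_Icc hp hq))
    have hne : (𝓝[Ico p q] q).NeBot := by
      rw [← mem_closure_iff_nhdsWithin_neBot, closure_Ico hlt.ne]
      exact right_mem_Icc.2 hpq
    refine tendsto_nhds_unique hc (tendsto_const_nhds.congr' ?_)
    filter_upwards [self_mem_nhdsWithin] with u hu
    exact (h0 p u hp hu.1 (hu.2.le.trans hq) (hd.mono_left (Icc_subset_Ico_right hu.2))).symm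
  have hr : ∀ p q, a ≤ p → p ≤ q → q ≤ b → Disjoint (Ioc p q) Z → D q = D p := by
    intro p q hp hpq hq hd
    rcases hpq.eq_or_lt with rfl | hlt
    · rfl
    have hc : ContinuousWithinAt D (Ioc p q) p :=
      (hDc p ⟨hp, hpq.trans hq⟩).mono (Ioc_subset_Icc_self.trans (Icc_subset_Icc hp hq))
    have hne : (𝓝[Ioc p q] p).NeBot := by
      rw [← mem_closure_iff_nhdsWithin_neBot, closure_Ioc hlt.ne]
      exact left_mem_Icc.2 hpq
    refine (tendsto_nhds_unique hc (tendsto_const_nhds.congr' ?_)).symm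
    filter_upwards [self_mem_nhdsWithin] with u hu
    exact h0 u q (hp.trans hu.1.le) hu.2 hq (hd.mono_left (Icc_subset_Ioc_left hu.1))
  -- Let l and r be the first and last points of `Z` in [p, q]. The defect is constant before l and
  -- after r, and F(l) = F(r), so only the integral of `f` over [l, r] remains.
  have hkey : ∀ p q, a ≤ p → p ≤ q → q ≤ b → |D q - D p| ≤ ∫ t in p..q, |f t| := by
    intro p q hp hpq hq
    by_cases hd : Disjoint (Icc p q) Z
    · rw [h0 p q hp hpq hq hd, sub_self, abs_zero]
      exact intervalIntegral.integral_nonneg hpq fun _ _ => abs_nonneg _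
    have hKne : (Icc p q ∩ Z).Nonempty := not_disjoint_iff_nonempty_inter.1 hd
    have hK : IsCompact (Icc p q ∩ Z) := isCompact_Icc.inter_right hZ
    obtain ⟨l, hlm, hl'⟩ := hK.exists_isLeast hKne
    obtain ⟨r, hrm, hr'⟩ := hK.exists_isGreatest hKne
    have hlr : l ≤ r := hl' hrm
    have e1 : D l = D p := hl p l hp hlm.1.1 (hlm.1.2.trans hq) <| by
      rw [disjoint_left]; intro u hu huZ
      exact absurd (hl' ⟨⟨hu.1, hu.2.le.trans hlm.1.2⟩, huZ⟩) (not_le.2 hu.2)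
    have e2 : D q = D r := hr r q (hp.trans hrm.1.1) hrm.1.2 hq <| by
      rw [disjoint_left]; intro u hu huZ
      exact absurd (hr' ⟨⟨hrm.1.1.trans hu.1.le, hu.2⟩, huZ⟩) (not_le.2 hu.1)
    have hlI : l ∈ Icc a b := ⟨hp.trans hlm.1.1, hlm.1.2.trans hq⟩
    have hrI : r ∈ Icc a b := ⟨hp.trans hrm.1.1, hrm.1.2.trans hq⟩
    rw [e2, ← e1, hDsub l hlI r hrI, hFZ l ⟨hlm.2, hlI⟩, hFZ r ⟨hrm.2, hrI⟩, sub_self, zero_sub,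
      abs_neg]
    refine (intervalIntegral.abs_integral_le_integral_abs hlr).trans ?_
    refine intervalIntegral.integral_mono_interval hlm.1.1 hlr hrm.1.2
      (Filter.Eventually.of_forall fun _ => abs_nonneg _) ?_
    exact (hfi p ⟨hp, hpq.trans hq⟩ q ⟨hp.trans hpq, hq⟩).abs
  have hG := hf.abs.absolutelyContinuousOnInterval_intervalIntegral (c := a) (by simp)
  have hGsub : ∀ p ∈ Icc a b, ∀ q ∈ Icc a b,
      (∫ t in a..q, |f t|) - ∫ t in a..p, |f t| = ∫ t in p..q, |f t| := by
    intro p hp q hq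
    have := intervalIntegral.integral_add_adjacent_intervals
      (hfi a ⟨le_rfl, hab⟩ p hp).abs (hfi p hp q hq).abs
    linarith
  have hdist : ∀ p ∈ Icc a b, ∀ q ∈ Icc a b,
      |D q - D p| ≤ |(∫ t in a..q, |f t|) - (∫ t in a..p, |f t|)| := by
    intro p hp q hq
    rw [hGsub p hp q hq]
    rcases le_total p q with h | h
    · exact (hkey p q hp.1 h hq.2).trans (le_abs_self _)
    · rw [abs_sub_comm, intervalIntegral.integral_symm, abs_neg]
      exact (hkey q p hq.1 h hp.2).trans (le_abs_self _)
  have hDac : AbsolutelyContinuousOnInterval D a b := by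
    rw [absolutelyContinuousOnInterval_iff] at hG ⊢
    intro ε hε
    obtain ⟨δ, hδ, h⟩ := hG ε hε
    refine ⟨δ, hδ, fun E hE hEδ => (Finset.sum_le_sum fun i hi => ?_).trans_lt (h E hE hEδ)⟩
    have := hE.1 i hi
    rw [uIcc_of_le hab] at this
    rw [Real.dist_eq, Real.dist_eq]
    exact hdist _ this.2 _ this.1
  -- Off `Z` the defect is locally constant. On `Z` its increments are dominated by those of the
  -- primitive of |f|, whose derivative at almost every such point is |f| = 0.
  have hD0 : ∀ᵐ x, x ∈ uIcc a b → HasDerivAt D 0 x := by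
    have hna : ∀ᵐ x : ℝ, x ≠ a := by simp [ae_iff, measure_singleton]
    have hnb : ∀ᵐ x : ℝ, x ≠ b := by simp [ae_iff, measure_singleton]
    filter_upwards [hf.abs.ae_hasDerivAt_integral, hna, hnb] with x hx hxa hxb hxm
    have hd := hx hxm a (by simp)
    rw [uIcc_of_le hab] at hxm
    have hxI : x ∈ Ioo a b := ⟨lt_of_le_of_ne hxm.1 (Ne.symm hxa), lt_of_le_of_ne hxm.2 hxb⟩
    by_cases hxZ : x ∈ Z
    · rw [hfZ x ⟨hxZ, hxm⟩, abs_zero] at hd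
      rw [hasDerivAt_iff_isLittleO] at hd ⊢
      refine Asymptotics.IsBigO.trans_isLittleO (Asymptotics.IsBigO.of_bound 1 ?_) hd
      filter_upwards [isOpen_Ioo.mem_nhds hxI] with u hu
      simpa using hdist x hxm u (Ioo_subset_Icc_self hu)
    · have hN : Ioo a b ∩ Zᶜ ∈ 𝓝 x := (isOpen_Ioo.inter hZ.isOpen_compl).mem_nhds ⟨hxI, hxZ⟩
      obtain ⟨ε, hε, hb⟩ := Metric.mem_nhds_iff.1 hN
      refine (hasDerivAt_const x (D x)).congr_of_eventuallyEq ?_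
      filter_upwards [Metric.ball_mem_nhds x hε] with u hu
      have hsub : uIcc x u ⊆ Ioo a b ∩ Zᶜ :=
        ((convex_ball x ε).ordConnected.uIcc_subset (Metric.mem_ball_self hε) hu).trans hb
      rcases le_total x u with h | h
      · rw [uIcc_of_le h] at hsub
        exact h0 x u hxm.1 h (hsub ⟨h, le_rfl⟩).1.2.le
          (disjoint_left.2 fun w hw => (hsub hw).2)
      · rw [uIcc_of_ge h] at hsub
        exact (h0 u x (hsub ⟨le_rfl, h⟩).1.1.le h hxm.2
          (disjoint_left.2 fun w hw => (hsub hw).2)).symm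
  obtain ⟨C, hC⟩ := hDac.const_of_ae_hasDerivAt_zero hD0
  have e := (hC b (by simp)).trans (hC a (by simp)).symm
  simp only [hD, intervalIntegral.integral_same] at e
  linarith


/-! ### Moving mollifiers and the continuity equation -/

section Tube

variable {n : ℕ}

/-- The mollifier `χ` rescaled to radius `r` and moved to the centre `p`. -/
def tubeKernel (χ : Rn n → ℝ) (x₀ p : Rn n) (r : ℝ) (x : Rn n) : ℝ :=
  χ (x₀ + r⁻¹ • (x - p)) * (r ^ n)⁻¹

/-- The flux field transporting `tubeKernel χ x₀ p r` when `p` and `r` move with velocities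
`p'` and `r'`. -/
def tubeField (χ : Rn n → ℝ) (x₀ p : Rn n) (r : ℝ) (p' : Rn n) (r' : ℝ) (x : Rn n) : Rn n :=
  tubeKernel χ x₀ p r x • (p' + (r' * r⁻¹) • (x - p))

/-- The divergence of `tubeField`. -/
def tubeDiv (χ : Rn n → ℝ) (x₀ p : Rn n) (r : ℝ) (p' : Rn n) (r' : ℝ) (x : Rn n) : ℝ :=
  (r ^ n)⁻¹ * (r⁻¹ * fderiv ℝ χ (x₀ + r⁻¹ • (x - p)) (p' + (r' * r⁻¹) • (x - p)))
    + n * (r' * r⁻¹) * tubeKernel χ x₀ p r x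

theorem kernelIntegrand_eq_tubeField (U : Set (Rn n)) (x₀ : Rn n) (γ : ℝ → Rn n → Rn n)
    (χ : Rn n → ℝ) (x y : Rn n) (t : ℝ) :
    kernelIntegrand U x₀ γ χ x y t = tubeField χ x₀ (γ t y) (radiusFn U x₀ γ t y)
      (deriv (fun s => γ s y) t) (deriv (fun s => radiusFn U x₀ γ s y) t) x := rfl

theorem integrableOn_smul_of_tsupport_subset {E : Type*} [NormedAddCommGroup E] [NormedSpace ℝ E]
    {U : Set (Rn n)} (hU : MeasurableSet U) {f : Rn n → E} (hf : LocallyIntegrableOn f U)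
    {φ : Rn n → ℝ} (hφ : Continuous φ) (hc : HasCompactSupport φ) (hs : tsupport φ ⊆ U) :
    IntegrableOn (fun x => φ x • f x) U := by
  have hK : IntegrableOn (fun x => φ x • f x) (tsupport φ) :=
    (hf.integrableOn_compact_subset hs hc).continuousOn_smul hφ.continuousOn hc
  refine hK.of_forall_sdiff_eq_zero hU fun x hx => ?_
  rw [image_eq_zero_of_notMem_tsupport hx.2, zero_smul]

/-- The definition tests with scalar functions and gives a vector identity. Testing with the i-th
component of Φ, keeping the i-th coordinate and summing over i yields the divergence form. -/
theorem IsWeakGradient.integral_mul_div {U : Set (Rn n)} (hU : IsOpen U) {g : Rn n → ℝ}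
    {v : Rn n → Rn n} (h : IsWeakGradient U g v) {Φ : Rn n → Rn n} (hΦ : ContDiff ℝ ∞ Φ)
    (hc : HasCompactSupport Φ) (hs : tsupport Φ ⊆ U) :
    ∫ x in U, g x * ∑ i, fderiv ℝ Φ x (EuclideanSpace.single i 1) i
      = -∫ x in U, inner ℝ (Φ x) (v x) := by
  have hφ : ∀ i, ContDiff ℝ ∞ fun x => Φ x i := fun i =>
    (EuclideanSpace.proj i : Rn n →L[ℝ] ℝ).contDiff.comp hΦ
  have hcc : ∀ i, HasCompactSupport fun x => Φ x i := fun i =>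
    hc.comp_left (g := fun z : Rn n => z i) rfl
  have hss : ∀ i, tsupport (fun x => Φ x i) ⊆ U := fun i =>
    (closure_mono fun x hx => by
      simp only [Function.mem_support] at hx ⊢
      exact fun h0 => hx (by rw [h0]; rfl)).trans hs
  have hfd : ∀ i x e, fderiv ℝ (fun x => Φ x i) x e = fderiv ℝ Φ x e i := fun i x e => by
    have h1 := (EuclideanSpace.proj i : Rn n →L[ℝ] ℝ).hasFDerivAt.comp x
      ((hΦ.differentiable (by simp)) x).hasFDerivAt
    have h2 := h1.fderiv
    exact congrArg (fun L => L e) h2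
  have hgr : ∀ i x, (∇ (fun x => Φ x i) x) i = fderiv ℝ Φ x (EuclideanSpace.single i 1) i := by
    intro i x
    rw [← hfd, ← InnerProductSpace.toDual_symm_apply (𝕜 := ℝ), gradient,
      EuclideanSpace.inner_single_right]
    simp
  have hgc : ∀ i, Continuous (∇ (fun x => Φ x i)) := fun i =>
    (InnerProductSpace.toDual ℝ (Rn n)).symm.continuous.comp
      ((hφ i).continuous_fderiv (by simp))
  have hint1 : ∀ i, IntegrableOn (fun x => fderiv ℝ Φ x (EuclideanSpace.single i 1) i • g x) U := by
    intro i
    have hfe : (fun x => fderiv ℝ Φ x (EuclideanSpace.single i 1) i)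
        = fun x => fderiv ℝ (fun x => Φ x i) x (EuclideanSpace.single i 1) := by
      ext x; rw [hfd]
    refine integrableOn_smul_of_tsupport_subset hU.measurableSet h.1
      (φ := fun x => fderiv ℝ Φ x (EuclideanSpace.single i 1) i) ?_ ?_ ?_
    · rw [hfe]
      exact ((hφ i).continuous_fderiv (by simp)).clm_apply continuous_const
    · rw [hfe]
      exact (hcc i).fderiv_apply ℝ _
    · rw [hfe]
      exact (tsupport_fderiv_apply_subset ℝ _).trans (hss i)
  have hint2 : ∀ i, IntegrableOn (fun x => Φ x i • v x) U := fun i =>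
    integrableOn_smul_of_tsupport_subset hU.measurableSet h.2.1 (hφ i).continuous (hcc i) (hss i)
  have hint3 : ∀ i, IntegrableOn (fun x => Φ x i * v x i) U := fun i =>
    (EuclideanSpace.proj i : Rn n →L[ℝ] ℝ).integrable_comp (hint2 i)
  have key : ∀ i, ∫ x in U, g x * fderiv ℝ Φ x (EuclideanSpace.single i 1) i
      = -∫ x in U, Φ x i * v x i := by
    intro i
    have h0 := h.2.2 _ (hφ i) (hcc i) (hss i)
    have h1 := congrArg (EuclideanSpace.proj i : Rn n →L[ℝ] ℝ) h0
    rw [map_neg, ← ContinuousLinearMap.integral_comp_comm _ (hint2 i),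
      ← ContinuousLinearMap.integral_comp_comm] at h1
    · simpa [hgr] using h1
    · have := integrableOn_smul_of_tsupport_subset hU.measurableSet h.1 (hφ i).continuous
        (hcc i) (hss i)
      have hK : IntegrableOn (fun x => g x • ∇ (fun x => Φ x i) x) (tsupport (fun x => Φ x i)) :=
        (h.1.integrableOn_compact_subset (hss i) (hcc i)).smul_continuousOn
          (hgc i).continuousOn (hcc i)
      refine hK.of_forall_sdiff_eq_zero hU.measurableSet fun x hx => ?_
      have : fderiv ℝ (fun x => Φ x i) x = 0 :=
        image_eq_zero_of_notMem_tsupport fun hx' => hx.2 (tsupport_fderiv_subset ℝ hx')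
      rw [gradient, this, map_zero, smul_zero]
  simp_rw [Finset.mul_sum]
  rw [integral_finsetSum _ (fun i _ => by simpa [IntegrableOn, mul_comm] using hint1 i)]
  simp_rw [key]
  rw [Finset.sum_neg_distrib, ← integral_finsetSum _ (fun i _ => hint3 i)]
  simp [PiLp.inner_apply, mul_comm]

theorem tubeKernel_eq_zero {χ : Rn n → ℝ} {x₀ : Rn n} {s : ℝ}
    (hχ : tsupport χ ⊆ Metric.closedBall x₀ s) {p : Rn n} {r : ℝ} (hr : 0 < r) {x : Rn n}
    (hx : s * r < ‖x - p‖) : tubeKernel χ x₀ p r x = 0 := by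
  refine mul_eq_zero_of_left (image_eq_zero_of_notMem_tsupport fun h => ?_) _
  have := hχ h
  rw [Metric.mem_closedBall, dist_eq_norm, add_sub_cancel_left, norm_smul, norm_inv,
    Real.norm_of_nonneg hr.le, inv_mul_le_iff₀ hr, mul_comm] at this
  linarith

/-- This is the continuity equation: together with `sum_fderiv_tubeField` it says that the time
derivative of the bump is minus the divergence of its flux. -/
theorem hasDerivAt_tubeKernel {χ : Rn n → ℝ} (hχ : ContDiff ℝ ∞ χ) (x₀ x : Rn n) {c : ℝ → Rn n}
    {ρ : ℝ → ℝ} {t : ℝ} {p' : Rn n} {r' : ℝ} (hc : HasDerivAt c p' t) (hρ : HasDerivAt ρ r' t)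
    (h0 : ρ t ≠ 0) :
    HasDerivAt (fun u => tubeKernel χ x₀ (c u) (ρ u) x) (-tubeDiv χ x₀ (c t) (ρ t) p' r' x) t := by
  have h1 : HasDerivAt (fun u => x₀ + (ρ u)⁻¹ • (x - c u))
      (-((ρ t)⁻¹ • (p' + (r' * (ρ t)⁻¹) • (x - c t)))) t := by
    have := ((hρ.fun_inv h0).fun_smul ((hasDerivAt_const t x).fun_sub hc)).const_add x₀
    convert! this using 1
    rw [zero_sub, smul_add, smul_smul, neg_add, smul_neg, neg_div, neg_smul]
    congr 3
    field_simp
  have h2 := ((hχ.differentiable (by simp)) (x₀ + (ρ t)⁻¹ • (x - c t))).hasFDerivAt.comp_hasDerivAt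
    t h1
  have h3 := (hρ.fun_pow n).fun_inv (pow_ne_zero n h0)
  have h4 := h2.fun_mul h3
  convert! h4 using 1
  rw [tubeDiv, tubeKernel, map_neg, map_smul]
  -- Differentiating ρⁿ produces the truncated exponent n - 1, hence the split.
  rcases n with _ | m
  · simp
  · simp only [Function.comp, Nat.add_sub_cancel, smul_eq_mul]
    field_simp
    ring

theorem contDiff_tubeKernel {χ : Rn n → ℝ} (hχ : ContDiff ℝ ∞ χ) (x₀ p : Rn n) (r : ℝ) :
    ContDiff ℝ ∞ (tubeKernel χ x₀ p r) := by
  unfold tubeKernel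
  fun_prop

theorem contDiff_tubeField {χ : Rn n → ℝ} (hχ : ContDiff ℝ ∞ χ) (x₀ p : Rn n) (r : ℝ) (p' : Rn n)
    (r' : ℝ) : ContDiff ℝ ∞ (tubeField χ x₀ p r p' r') := by
  have := contDiff_tubeKernel hχ x₀ p r
  unfold tubeField
  fun_prop

/-- The product rule: the gradient of χ contributes the first summand of `tubeDiv`, and the dilation
x ↦ (r'/r)(x - p), whose divergence is n r'/r, the second. -/
theorem sum_fderiv_tubeField {χ : Rn n → ℝ} (hχ : ContDiff ℝ ∞ χ) (x₀ p : Rn n) (r : ℝ)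
    (p' : Rn n) (r' : ℝ) (x : Rn n) :
    ∑ i, fderiv ℝ (tubeField χ x₀ p r p' r') x (EuclideanSpace.single i 1) i
      = tubeDiv χ x₀ p r p' r' x := by
  set z : Rn n := x₀ + r⁻¹ • (x - p)
  set V : Rn n := p' + (r' * r⁻¹) • (x - p)
  have h1 : HasFDerivAt (fun x : Rn n => x₀ + r⁻¹ • (x - p))
      (r⁻¹ • ContinuousLinearMap.id ℝ (Rn n)) x :=
    (((hasFDerivAt_id x).sub_const p).const_smul r⁻¹).const_add x₀
  have h2 := (((hχ.differentiable (by simp)) z).hasFDerivAt.comp x h1).mul_const (r ^ n)⁻¹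
  have h3 : HasFDerivAt (fun x : Rn n => p' + (r' * r⁻¹) • (x - p))
      ((r' * r⁻¹) • ContinuousLinearMap.id ℝ (Rn n)) x :=
    (((hasFDerivAt_id x).sub_const p).const_smul (r' * r⁻¹)).const_add p'
  have h4 : HasFDerivAt (tubeField χ x₀ p r p' r') _ x := h2.smul h3
  rw [h4.fderiv]
  have hV : V = ∑ i : Fin n, V i • (EuclideanSpace.single i (1 : ℝ) : Rn n) := by
    have := (EuclideanSpace.basisFun (Fin n) ℝ).sum_repr V
    simpa [EuclideanSpace.basisFun_apply] using this.symm
  have hVz : fderiv ℝ χ z V = ∑ i, V i * fderiv ℝ χ z (EuclideanSpace.single i (1 : ℝ)) := by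
    conv_lhs => rw [hV]
    simp
  rw [tubeDiv, tubeKernel]
  change _ = (r ^ n)⁻¹ * (r⁻¹ * fderiv ℝ χ z V) + n * (r' * r⁻¹) * (χ z * (r ^ n)⁻¹)
  rw [hVz, Finset.mul_sum, Finset.mul_sum]
  simp [Finset.sum_add_distrib, z, V]
  rw [add_comm, ← Finset.sum_add_distrib]
  congr 1
  · refine Finset.sum_congr rfl fun i _ => ?_
    ring
  · ring

theorem integral_mul_tubeDiv {U : Set (Rn n)} (hU : IsOpen U) {g : Rn n → ℝ}
    {v : Rn n → Rn n} (h : IsWeakGradient U g v) {χ : Rn n → ℝ} (hχ : ContDiff ℝ ∞ χ) {x₀ : Rn n}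
    {s : ℝ} (hs : tsupport χ ⊆ Metric.closedBall x₀ s) {p : Rn n} {r : ℝ} (hr : 0 < r)
    (hb : Metric.closedBall p (s * r) ⊆ U) (p' : Rn n) (r' : ℝ) :
    ∫ x in U, g x * -tubeDiv χ x₀ p r p' r' x
      = ∫ x in U, inner ℝ (tubeField χ x₀ p r p' r' x) (v x) := by
  have hsub : tsupport (tubeField χ x₀ p r p' r') ⊆ Metric.closedBall p (s * r) := by
    refine closure_minimal (fun x hx => ?_) Metric.isClosed_closedBall
    by_contra hx'
    rw [Metric.mem_closedBall, dist_eq_norm, not_le] at hx'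
    exact hx (by rw [tubeField, tubeKernel_eq_zero hs hr hx', zero_smul])
  have := h.integral_mul_div hU (contDiff_tubeField hχ x₀ p r p' r')
    ((isCompact_closedBall p (s * r)).of_isClosed_subset isClosed_closure hsub) (hsub.trans hb)
  simp_rw [sum_fderiv_tubeField hχ] at this
  simp_rw [mul_neg]
  rw [integral_neg, this, neg_neg]

end Tube

/-! ### The fundamental theorem of calculus along a tube of positive radius -/

section TubeFTC

variable {n : ℕ}

/-- The mean of `g` against the rescaled mollifier, written over the fixed ball. -/
def tubeMean (χ : Rn n → ℝ) (x₀ : Rn n) (s : ℝ) (g : Rn n → ℝ) (p : Rn n) (r : ℝ) : ℝ :=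
  ∫ w in Metric.closedBall (0 : Rn n) s, g (p + r • w) * χ (x₀ + w)

/-- Substitute x = p + r w. Unlike the left side, the mean over the fixed ball still makes sense and
is continuous at r = 0, where it equals g(p) ∫ χ. -/
theorem setIntegral_mul_tubeKernel {χ : Rn n → ℝ} {x₀ : Rn n} {s : ℝ}
    (hs : tsupport χ ⊆ Metric.closedBall x₀ s) {U : Set (Rn n)} (hU : MeasurableSet U)
    (g : Rn n → ℝ) {p : Rn n} {r : ℝ} (hr : 0 < r) (hb : Metric.closedBall p (s * r) ⊆ U) :
    ∫ x in U, g x * tubeKernel χ x₀ p r x = tubeMean χ x₀ s g p r := by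
  rw [setIntegral_eq_of_subset_of_forall_sdiff_eq_zero hU hb, tubeMean,
    ← integral_indicator Metric.isClosed_closedBall.measurableSet,
    ← integral_indicator Metric.isClosed_closedBall.measurableSet]
  · set h : Rn n → ℝ := (Metric.closedBall p (s * r)).indicator
      fun x => g x * tubeKernel χ x₀ p r x
    have h1 : ∫ w, h (p + r • w) = |(r ^ n)⁻¹| • ∫ x, h x := by
      have := Measure.integral_comp_smul volume (fun w => h (p + w)) r
      rw [finrank_euclideanSpace_fin] at this
      rw [this, integral_add_left_eq_self]
    have hrn : (0 : ℝ) < r ^ n := pow_pos hr n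
    rw [abs_of_pos (inv_pos.2 hrn), smul_eq_mul] at h1
    have h2 : ∫ x, h x = ∫ w, r ^ n * h (p + r • w) := by
      rw [integral_const_mul, h1, mul_inv_cancel_left₀ hrn.ne']
    rw [h2]
    refine integral_congr_ae (Filter.Eventually.of_forall fun w => ?_)
    have hmem : p + r • w ∈ Metric.closedBall p (s * r) ↔ w ∈ Metric.closedBall (0 : Rn n) s := by
      rw [Metric.mem_closedBall, Metric.mem_closedBall, dist_eq_norm, add_sub_cancel_left,
        norm_smul, Real.norm_of_nonneg hr.le, dist_zero_right, mul_comm s, mul_le_mul_iff_right₀ hr]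
    by_cases hw : w ∈ Metric.closedBall (0 : Rn n) s
    · simp only [h, indicator_of_mem hw, indicator_of_mem (hmem.2 hw)]
      rw [tubeKernel, add_sub_cancel_left, inv_smul_smul₀ hr.ne']
      field_simp
    · simp only [h, indicator_of_notMem hw, indicator_of_notMem (fun h => hw (hmem.1 h)), mul_zero]
  · intro x hx
    rw [tubeKernel_eq_zero hs hr, mul_zero]
    simpa [dist_eq_norm] using hx.2

theorem tubeMean_zero {χ : Rn n → ℝ} {x₀ : Rn n} {s : ℝ}
    (hs : tsupport χ ⊆ Metric.closedBall x₀ s) (g : Rn n → ℝ) (p : Rn n) :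
    tubeMean χ x₀ s g p 0 = g p * ∫ x, χ x := by
  rw [tubeMean]
  simp only [zero_smul, add_zero]
  rw [integral_const_mul, setIntegral_eq_integral_of_forall_compl_eq_zero,
    integral_add_left_eq_self (μ := volume) χ x₀]
  intro w hw
  refine image_eq_zero_of_notMem_tsupport fun h => hw ?_
  simpa using hs h

theorem continuousOn_tubeMean {χ : Rn n → ℝ} (hχ : Continuous χ) {x₀ : Rn n} {s : ℝ}
    {U : Set (Rn n)} {g : Rn n → ℝ} (hg : ContinuousOn g U) {c : ℝ → Rn n} {ρ : ℝ → ℝ} {a b : ℝ}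
    (hc : ContinuousOn c (Icc a b)) (hρ : ContinuousOn ρ (Icc a b))
    (hb : ∀ t ∈ Icc a b, ∀ w ∈ Metric.closedBall (0 : Rn n) s, c t + ρ t • w ∈ U) :
    ContinuousOn (fun t => tubeMean χ x₀ s g (c t) (ρ t)) (Icc a b) := by
  have hm : ContinuousOn (fun q : ℝ × Rn n => g (c q.1 + ρ q.1 • q.2) * χ (x₀ + q.2))
      (Icc a b ×ˢ Metric.closedBall (0 : Rn n) s) := by
    refine ContinuousOn.mul (hg.comp ?_ fun q hq => hb q.1 hq.1 q.2 hq.2) (by fun_prop)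
    exact (hc.comp continuousOn_fst fun q hq => hq.1).add
      ((hρ.comp continuousOn_fst fun q hq => hq.1).smul continuousOn_snd)
  obtain ⟨C, hC⟩ := (isCompact_Icc.prod (isCompact_closedBall (0 : Rn n) s)).exists_bound_of_continuousOn hm
  refine continuousOn_of_dominated (bound := fun _ => C) ?_ ?_ ?_ ?_
  · intro t ht
    refine ContinuousOn.aestronglyMeasurable ?_ Metric.isClosed_closedBall.measurableSet
    exact hm.comp (f := fun w => (t, w)) (by fun_prop) fun w hw => ⟨ht, hw⟩
  · intro t ht
    exact (ae_restrict_iff' Metric.isClosed_closedBall.measurableSet).2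
      (Filter.Eventually.of_forall fun w hw => hC (t, w) ⟨ht, hw⟩)
  · exact integrableOn_const (hs := (isCompact_closedBall _ _).measure_lt_top.ne)
  · refine (ae_restrict_iff' Metric.isClosed_closedBall.measurableSet).2
      (Filter.Eventually.of_forall fun w hw => ?_)
    exact hm.comp (f := fun t => (t, w)) (by fun_prop) fun t ht => ⟨ht, hw⟩

/-- On a parameter interval on which the radius is positive, the rescaled kernels along a Lipschitz
curve are uniformly Lipschitz in the parameter. -/
theorem exists_lipschitzOnWith_tubeKernel {χ : Rn n → ℝ} (hχ : ContDiff ℝ ∞ χ) (x₀ : Rn n)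
    {c : ℝ → Rn n} {ρ : ℝ → ℝ} {a b : ℝ} {Kc Kρ : ℝ≥0} (hc : LipschitzOnWith Kc c (Icc a b))
    (hρ : LipschitzOnWith Kρ ρ (Icc a b)) (h0 : ∀ t ∈ Icc a b, 0 < ρ t) {A : Set (Rn n)}
    (hA : IsCompact A) :
    ∃ M : ℝ≥0, ∀ x ∈ A, LipschitzOnWith M (fun t => tubeKernel χ x₀ (c t) (ρ t) x) (Icc a b) := by
  set H : (Rn n × ℝ) × Rn n → ℝ := fun q => tubeKernel χ x₀ q.1.1 q.1.2 q.2 with hH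
  set S : Set ((Rn n × ℝ) × Rn n) := ((fun t => (c t, ρ t)) '' Icc a b) ×ˢ A with hS
  have hSc : IsCompact S :=
    (isCompact_Icc.image_of_continuousOn (hc.continuousOn.prodMk hρ.continuousOn)).prod hA
  have hloc : LocallyLipschitzOn S H := by
    rintro q hq
    have hq : q.1.2 ≠ 0 := by
      obtain ⟨t, ht, h⟩ := hq.1
      rw [← h]
      exact (h0 t ht).ne'
    have hq' : q.1.2 ^ n ≠ 0 := pow_ne_zero _ hq
    have hcd : ContDiffAt ℝ 1 H q := by
      have hχ1 : ContDiff ℝ 1 χ := hχ.of_le (by simp)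
      rw [hH]
      unfold tubeKernel
      fun_prop (disch := assumption)
    obtain ⟨K, t, ht, hK⟩ := hcd.exists_lipschitzOnWith
    exact ⟨K, t, mem_nhdsWithin_of_mem_nhds ht, hK⟩
  obtain ⟨L, hL⟩ := hloc.exists_lipschitzOnWith_of_compact hSc
  refine ⟨L * max Kc Kρ, fun x hx => LipschitzOnWith.of_dist_le_mul fun t ht u hu => ?_⟩
  refine (hL.dist_le_mul ((c t, ρ t), x) ⟨⟨t, ht, rfl⟩, hx⟩ ((c u, ρ u), x)
    ⟨⟨u, hu, rfl⟩, hx⟩).trans ?_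
  rw [NNReal.coe_mul, mul_assoc]
  gcongr
  rw [Prod.dist_eq, Prod.dist_eq, dist_self, max_eq_left (by positivity), NNReal.coe_max,
    max_mul_of_nonneg _ _ dist_nonneg]
  exact max_le_max (hc.dist_le_mul t ht u hu) (hρ.dist_le_mul t ht u hu)

theorem isCompact_tube {c : ℝ → Rn n} {ρ : ℝ → ℝ} {a b : ℝ} (s : ℝ) (hc : ContinuousOn c (Icc a b))
    (hρ : ContinuousOn ρ (Icc a b)) :
    IsCompact ((fun q : ℝ × Rn n => c q.1 + ρ q.1 • q.2) ''
      (Icc a b ×ˢ Metric.closedBall (0 : Rn n) s)) := by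
  refine (isCompact_Icc.prod (isCompact_closedBall _ _)).image_of_continuousOn ?_
  exact (hc.comp continuousOn_fst fun q hq => hq.1).add
      ((hρ.comp continuousOn_fst fun q hq => hq.1).smul continuousOn_snd)

theorem mem_tube {c : ℝ → Rn n} {ρ : ℝ → ℝ} {a b s : ℝ} {t : ℝ} (ht : t ∈ Icc a b) (h0 : 0 < ρ t)
    {x : Rn n} (hx : ‖x - c t‖ ≤ s * ρ t) :
    x ∈ (fun q : ℝ × Rn n => c q.1 + ρ q.1 • q.2) ''
      (Icc a b ×ˢ Metric.closedBall (0 : Rn n) s) := by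
  refine ⟨(t, (ρ t)⁻¹ • (x - c t)), ⟨ht, ?_⟩, ?_⟩
  · rw [Metric.mem_closedBall, dist_zero_right, norm_smul, norm_inv, Real.norm_of_nonneg h0.le,
      inv_mul_le_iff₀ h0, mul_comm]
    exact hx
  · simp only [smul_inv_smul₀ h0.ne', add_sub_cancel]

/-- All bumps live in one compact tube in U, on which they are uniformly Lipschitz in time. The mean
is therefore Lipschitz in time; at almost every time one differentiates under the integral and moves
the divergence onto g. -/
theorem tubeMean_sub_eq_integral {U : Set (Rn n)} (hU : IsOpen U) {g : Rn n → ℝ} {v : Rn n → Rn n}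
    (hgc : ContinuousOn g U) (hw : IsWeakGradient U g v) {χ : Rn n → ℝ} (hχ : ContDiff ℝ ∞ χ)
    {x₀ : Rn n} {s : ℝ} (hs : tsupport χ ⊆ Metric.closedBall x₀ s)
    {c : ℝ → Rn n} {ρ : ℝ → ℝ} {a b : ℝ} (hab : a ≤ b) {Kc Kρ : ℝ≥0}
    (hc : LipschitzOnWith Kc c (Icc a b)) (hρ : LipschitzOnWith Kρ ρ (Icc a b))
    (h0 : ∀ t ∈ Icc a b, 0 < ρ t)
    (hb : ∀ t ∈ Icc a b, Metric.closedBall (c t) (s * ρ t) ⊆ U) :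
    tubeMean χ x₀ s g (c b) (ρ b) - tubeMean χ x₀ s g (c a) (ρ a) =
      ∫ t in a..b, ∫ x in U,
        inner ℝ (tubeField χ x₀ (c t) (ρ t) (deriv c t) (deriv ρ t) x) (v x) := by
  set A := (fun q : ℝ × Rn n => c q.1 + ρ q.1 • q.2) ''
      (Icc a b ×ˢ Metric.closedBall (0 : Rn n) s) with hA
  have hAc : IsCompact A := isCompact_tube s hc.continuousOn hρ.continuousOn
  have hAU : A ⊆ U := by
    rintro _ ⟨⟨t, w⟩, ⟨ht, hw⟩, rfl⟩
    refine hb t ht ?_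
    simp only [Metric.mem_closedBall, dist_eq_norm, add_sub_cancel_left, norm_smul] at hw ⊢
    rw [Real.norm_of_nonneg (h0 t ht).le, mul_comm s]
    have := h0 t ht
    gcongr
    simpa using hw
  obtain ⟨M, hM⟩ := exists_lipschitzOnWith_tubeKernel hχ x₀ hc hρ h0 hAc
  set F : ℝ → ℝ := fun t => ∫ x in A, g x * tubeKernel χ x₀ (c t) (ρ t) x
  have hgA : IntegrableOn g A := (hgc.mono hAU).integrableOn_compact hAc
  have hint : ∀ p r, IntegrableOn (fun x => g x * tubeKernel χ x₀ p r x) A := fun p r =>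
    hgA.mul_continuousOn (contDiff_tubeKernel hχ x₀ p r).continuous.continuousOn hAc
  have hz : ∀ t ∈ Icc a b, ∀ x ∈ U \ A,
      tubeKernel χ x₀ (c t) (ρ t) x = 0 := by
    intro t ht x hx
    refine tubeKernel_eq_zero hs (h0 t ht) (lt_of_not_ge fun h => hx.2 (mem_tube ht (h0 t ht) h))
  have hFm : ∀ t ∈ Icc a b, F t = tubeMean χ x₀ s g (c t) (ρ t) := by
    intro t ht
    rw [← setIntegral_mul_tubeKernel hs hU.measurableSet g (h0 t ht) (hb t ht)]
    refine (setIntegral_eq_of_subset_of_forall_sdiff_eq_zero hU.measurableSet hAU ?_).symm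
    intro x hx
    rw [hz t ht x hx, mul_zero]
  have hFL : LipschitzOnWith ((∫ x in A, |g x| * M).toNNReal) F (Icc a b) := by
    refine LipschitzOnWith.of_dist_le_mul fun t ht u hu => ?_
    rw [Real.coe_toNNReal _ (integral_nonneg fun x => by positivity), Real.dist_eq,
      ← integral_sub (hint _ _) (hint _ _), ← integral_mul_const,
      ← Real.norm_eq_abs]
    refine norm_integral_le_of_norm_le ((hgA.abs.mul_const _).mul_const _) ?_
    refine (ae_restrict_iff' hAc.measurableSet).2 (Filter.Eventually.of_forall fun x hx => ?_)
    rw [← mul_sub, norm_mul, mul_assoc, Real.norm_eq_abs, ← dist_eq_norm]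
    exact mul_le_mul_of_nonneg_left ((hM x hx).dist_le_mul t ht u hu) (abs_nonneg _)
  have hFTC := (LipschitzOnWith.absolutelyContinuousOnInterval
    (by rwa [uIcc_of_le hab] : LipschitzOnWith _ F (uIcc a b))).integral_deriv_eq_sub
  rw [hFm a ⟨le_rfl, hab⟩, hFm b ⟨hab, le_rfl⟩] at hFTC
  rw [← hFTC]
  refine intervalIntegral.integral_congr_ae ?_
  have hnb : ∀ᵐ x : ℝ, x ≠ b := by simp [ae_iff, measure_singleton]
  filter_upwards [hnb, hc.ae_differentiableWithinAt_of_mem, hρ.ae_differentiableWithinAt_of_mem]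
    with t htb hdc hdρ ht
  rw [uIoc_of_le hab] at ht
  have htI : t ∈ Ioo a b := ⟨ht.1, lt_of_le_of_ne ht.2 htb⟩
  have htc := Ioo_subset_Icc_self htI
  have hN : Icc a b ∈ 𝓝 t := Icc_mem_nhds htI.1 htI.2
  have hdc := ((hdc htc).differentiableAt hN).hasDerivAt
  have hdρ := ((hdρ htc).differentiableAt hN).hasDerivAt
  have hcd : Continuous (tubeDiv χ x₀ (c t) (ρ t) (deriv c t) (deriv ρ t)) := by
    have := (contDiff_tubeKernel hχ x₀ (c t) (ρ t)).continuous
    have h2 := hχ.continuous_fderiv (by simp)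
    unfold tubeDiv
    fun_prop
  have hD := (hasDerivAt_integral_of_dominated_loc_of_lip (μ := volume.restrict A) (x₀ := t)
    (F := fun u x => g x * tubeKernel χ x₀ (c u) (ρ u) x) (bound := fun x => |g x| * M)
    (F' := fun x => g x * -tubeDiv χ x₀ (c t) (ρ t) (deriv c t) (deriv ρ t) x) hN
    (Filter.Eventually.of_forall fun u => (hint _ _).aestronglyMeasurable) (hint _ _)
    (hgA.mul_continuousOn hcd.neg.continuousOn hAc).aestronglyMeasurable
    (by
      refine (ae_restrict_iff' hAc.measurableSet).2 (Filter.Eventually.of_forall fun x hx => ?_)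
      refine LipschitzOnWith.of_dist_le_mul fun u hu w hw => ?_
      rw [Real.coe_nnabs, abs_of_nonneg (by positivity), dist_eq_norm, ← mul_sub, norm_mul,
        mul_assoc, Real.norm_eq_abs, ← dist_eq_norm]
      exact mul_le_mul_of_nonneg_left ((hM x hx).dist_le_mul u hu w hw) (abs_nonneg _))
    (hgA.abs.mul_const _)
    (Filter.Eventually.of_forall fun x =>
      (hasDerivAt_tubeKernel hχ x₀ x hdc hdρ (h0 t htc).ne').const_mul (g x))).2
  have e : deriv F t = _ := hD.deriv
  rw [e, ← integral_mul_tubeDiv hU hw hχ hs (h0 t htc) (hb t htc)]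
  refine (setIntegral_eq_of_subset_of_forall_sdiff_eq_zero hU.measurableSet hAU ?_).symm
  intro x hx
  -- Off the tube the bump vanishes for all times near t, so its time derivative, minus the
  -- divergence, vanishes as well.
  have h1 := hasDerivAt_tubeKernel hχ x₀ x hdc hdρ (h0 t htc).ne'
  have h2 : HasDerivAt (fun u => tubeKernel χ x₀ (c u) (ρ u) x) 0 t := by
    refine (hasDerivAt_const t (0 : ℝ)).congr_of_eventuallyEq ?_
    filter_upwards [hN] with u hu
    exact hz u hu x hx
  rw [h1.unique h2, mul_zero]

end TubeFTC

/-! ### Geometry of a single path and of its radius function -/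

section Path

variable {n : ℕ}

/-- The path `γ_y` is a Lipschitz curve in the open set `U` joining `y` to `x₀`. -/
structure IsPath (U : Set (Rn n)) (x₀ : Rn n) (γ : ℝ → Rn n → Rn n) (y : Rn n) (L : ℝ≥0) :
    Prop where
  isOpen : IsOpen U
  compl_nonempty : Uᶜ.Nonempty
  mem : ∀ t ∈ Icc (0 : ℝ) 1, γ t y ∈ U
  start : γ 0 y = y
  finish : γ 1 y = x₀
  lipschitz : LipschitzOnWith L (fun t => γ t y) (Icc 0 1)

/-- The slope `α` of the radius function before the hitting time. -/
def slopeConst (U : Set (Rn n)) (x₀ : Rn n) (γ : ℝ → Rn n → Rn n) (y : Rn n) : ℝ :=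
  2 / bdist U x₀ * (bdist U (γ (hitTime U γ y) y) / bdist U y)

theorem radiusFn_of_le {U : Set (Rn n)} {x₀ : Rn n} {γ : ℝ → Rn n → Rn n} {y : Rn n}
    (h : (hitSet U γ y).Nonempty) {t : ℝ} (ht : t ≤ hitTime U γ y) :
    radiusFn U x₀ γ t y = slopeConst U x₀ γ y * ‖y - γ t y‖ := by
  rw [radiusFn, if_pos h, if_pos ht, slopeConst]

theorem radiusFn_of_lt {U : Set (Rn n)} {x₀ : Rn n} {γ : ℝ → Rn n → Rn n} {y : Rn n}
    (h : (hitSet U γ y).Nonempty) {t : ℝ} (ht : hitTime U γ y < t) :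
    radiusFn U x₀ γ t y = bdist U (γ t y) / bdist U x₀ := by
  rw [radiusFn, if_pos h, if_neg (not_le.2 ht)]

theorem radiusFn_of_not_hit {U : Set (Rn n)} {x₀ : Rn n} {γ : ℝ → Rn n → Rn n} {y : Rn n}
    (h : ¬(hitSet U γ y).Nonempty) (t : ℝ) : radiusFn U x₀ γ t y = t := by
  rw [radiusFn, if_neg h]

namespace IsPath

variable {U : Set (Rn n)} {x₀ : Rn n} {γ : ℝ → Rn n → Rn n} {y : Rn n} {L : ℝ≥0}

theorem mem_start (h : IsPath U x₀ γ y L) : y ∈ U := by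
  have := h.mem 0 (by simp); rwa [h.start] at this

theorem mem_finish (h : IsPath U x₀ γ y L) : x₀ ∈ U := by
  have := h.mem 1 (by simp); rwa [h.finish] at this

theorem pos_start (h : IsPath U x₀ γ y L) : 0 < bdist U y :=
  bdist_pos h.isOpen h.compl_nonempty h.mem_start

theorem pos_finish (h : IsPath U x₀ γ y L) : 0 < bdist U x₀ :=
  bdist_pos h.isOpen h.compl_nonempty h.mem_finish

theorem pos (h : IsPath U x₀ γ y L) {t : ℝ} (ht : t ∈ Icc (0 : ℝ) 1) : 0 < bdist U (γ t y) :=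
  bdist_pos h.isOpen h.compl_nonempty (h.mem t ht)

theorem continuousOn (h : IsPath U x₀ γ y L) : ContinuousOn (fun t => γ t y) (Icc 0 1) :=
  h.lipschitz.continuousOn

theorem exists_hit (h : IsPath U x₀ γ y L) {t : ℝ} (ht : t ∈ Icc (0 : ℝ) 1)
    (hlt : bdist U y / 2 ≤ ‖y - γ t y‖) : ∃ u ∈ hitSet U γ y, u ≤ t := by
  have hc : ContinuousOn (fun u => ‖y - γ u y‖) (Icc 0 t) :=
    (continuousOn_const.sub (h.continuousOn.mono (Icc_subset_Icc le_rfl ht.2))).norm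
  have := intermediate_value_Icc ht.1 hc
  obtain ⟨u, hu, hu'⟩ := this (show bdist U y / 2 ∈ Icc _ _ from
    ⟨by simpa [h.start] using (half_pos h.pos_start).le, hlt⟩)
  exact ⟨u, ⟨⟨hu.1, hu.2.trans ht.2⟩, by
    rw [Metric.mem_sphere, dist_comm, dist_eq_norm]; exact hu'⟩, hu.2⟩

theorem norm_lt_of_not_hit (h : IsPath U x₀ γ y L) (hh : ¬(hitSet U γ y).Nonempty) {t : ℝ}
    (ht : t ∈ Icc (0 : ℝ) 1) : ‖y - γ t y‖ < bdist U y / 2 := by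
  by_contra hc
  obtain ⟨u, hu, -⟩ := h.exists_hit ht (not_lt.1 hc)
  exact hh ⟨u, hu⟩

theorem hitTime_le {u : ℝ} (hu : u ∈ hitSet U γ y) : hitTime U γ y ≤ u :=
  csInf_le ⟨0, fun _ h => h.1.1⟩ hu

theorem hitTime_mem (h : IsPath U x₀ γ y L) (hh : (hitSet U γ y).Nonempty) :
    hitTime U γ y ∈ hitSet U γ y := by
  refine IsClosed.csInf_mem ?_ hh ⟨0, fun _ h => h.1.1⟩
  exact h.continuousOn.preimage_isClosed_of_isClosed isClosed_Icc Metric.isClosed_sphere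

theorem norm_hitTime (h : IsPath U x₀ γ y L) (hh : (hitSet U γ y).Nonempty) :
    ‖y - γ (hitTime U γ y) y‖ = bdist U y / 2 := by
  have := (h.hitTime_mem hh).2
  rwa [Metric.mem_sphere, dist_comm, dist_eq_norm] at this

theorem norm_le_of_le_hitTime (h : IsPath U x₀ γ y L) (hh : (hitSet U γ y).Nonempty) {t : ℝ}
    (ht0 : 0 ≤ t) (ht : t ≤ hitTime U γ y) : ‖y - γ t y‖ ≤ bdist U y / 2 := by
  by_contra hc
  have h1 := (h.hitTime_mem hh).1.2
  obtain ⟨u, hu, hut⟩ := h.exists_hit ⟨ht0, ht.trans h1⟩ (not_le.1 hc).le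
  have : t = hitTime U γ y := le_antisymm ht ((hitTime_le hu).trans hut)
  rw [this, h.norm_hitTime hh] at hc
  exact hc le_rfl

/-- At the hitting time the path is at distance d̂(y)/2 from y, so d̂ there lies between d̂(y)/2 and
3 d̂(y)/2. The slope is thus comparable with 1/d̂(x₀) from both sides, uniformly in y. -/
theorem le_slopeConst (h : IsPath U x₀ γ y L) (hh : (hitSet U γ y).Nonempty) :
    1 / bdist U x₀ ≤ slopeConst U x₀ γ y := by
  have h1 := bdist_le_add U y (γ (hitTime U γ y) y)
  rw [h.norm_hitTime hh] at h1
  have := h.pos_start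
  have := h.pos_finish
  rw [slopeConst, div_mul_div_comm, div_le_div_iff₀ (by positivity) (by positivity)]
  nlinarith

theorem slopeConst_le (h : IsPath U x₀ γ y L) (hh : (hitSet U γ y).Nonempty) :
    slopeConst U x₀ γ y ≤ 3 / bdist U x₀ := by
  have h1 := bdist_le_add U (γ (hitTime U γ y) y) y
  rw [norm_sub_rev, h.norm_hitTime hh] at h1
  have := h.pos_start
  have := h.pos_finish
  rw [slopeConst, div_mul_div_comm, div_le_div_iff₀ (by positivity) (by positivity)]
  nlinarith

theorem slopeConst_pos (h : IsPath U x₀ γ y L) (hh : (hitSet U γ y).Nonempty) :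
    0 < slopeConst U x₀ γ y :=
  (one_div_pos.2 h.pos_finish).trans_le (h.le_slopeConst hh)

/-- The slope is chosen exactly so that the two formulas for ρ agree at the hitting time; this makes
ρ continuous, and then Lipschitz, across it. -/
theorem radiusFn_hitTime (h : IsPath U x₀ γ y L) (hh : (hitSet U γ y).Nonempty) :
    radiusFn U x₀ γ (hitTime U γ y) y = bdist U (γ (hitTime U γ y) y) / bdist U x₀ := by
  rw [radiusFn_of_le hh le_rfl, h.norm_hitTime hh, slopeConst]
  have := h.pos_start.ne'
  field_simp

theorem radiusFn_of_ge (h : IsPath U x₀ γ y L) (hh : (hitSet U γ y).Nonempty) {t : ℝ}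
    (ht : hitTime U γ y ≤ t) : radiusFn U x₀ γ t y = bdist U (γ t y) / bdist U x₀ := by
  rcases ht.eq_or_lt with rfl | ht
  · exact h.radiusFn_hitTime hh
  · exact radiusFn_of_lt hh ht

theorem abs_radiusFn_sub_le_of_le (h : IsPath U x₀ γ y L) (hh : (hitSet U γ y).Nonempty) {t u : ℝ}
    (ht : t ≤ hitTime U γ y) (hu : u ≤ hitTime U γ y) :
    |radiusFn U x₀ γ t y - radiusFn U x₀ γ u y| ≤ 3 / bdist U x₀ * ‖γ t y - γ u y‖ := by
  rw [radiusFn_of_le hh ht, radiusFn_of_le hh hu, ← mul_sub, abs_mul,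
    abs_of_pos (h.slopeConst_pos hh)]
  have := h.pos_finish
  refine mul_le_mul (h.slopeConst_le hh) ?_ (abs_nonneg _) (by positivity)
  refine (abs_norm_sub_norm_le _ _).trans_eq ?_
  rw [sub_sub_sub_cancel_left, norm_sub_rev]

theorem abs_radiusFn_sub_le_of_ge (h : IsPath U x₀ γ y L) (hh : (hitSet U γ y).Nonempty) {t u : ℝ}
    (ht : hitTime U γ y ≤ t) (hu : hitTime U γ y ≤ u) :
    |radiusFn U x₀ γ t y - radiusFn U x₀ γ u y| ≤ 3 / bdist U x₀ * ‖γ t y - γ u y‖ := by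
  have := h.pos_finish
  rw [h.radiusFn_of_ge hh ht, h.radiusFn_of_ge hh hu, ← sub_div, abs_div, abs_of_pos this,
    div_mul_eq_mul_div]
  gcongr
  have := abs_bdist_sub_le U (γ t y) (γ u y)
  linarith [norm_nonneg (γ t y - γ u y)]

theorem lipschitzOnWith_radiusFn (h : IsPath U x₀ γ y L) :
    ∃ R : ℝ≥0, LipschitzOnWith R (fun t => radiusFn U x₀ γ t y) (Icc 0 1) := by
  by_cases hh : (hitSet U γ y).Nonempty
  · have hd := h.pos_finish
    have hτ := (h.hitTime_mem hh).1
    have hk : (0 : ℝ) ≤ 3 / bdist U x₀ * L := by positivity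
    have key : ∀ t ∈ Icc (0 : ℝ) 1, ∀ u ∈ Icc (0 : ℝ) 1, t ≤ u →
        |radiusFn U x₀ γ t y - radiusFn U x₀ γ u y| ≤ 3 / bdist U x₀ * L * (u - t) := by
      have hl : ∀ t ∈ Icc (0 : ℝ) 1, ∀ u ∈ Icc (0 : ℝ) 1, t ≤ u →
          3 / bdist U x₀ * ‖γ t y - γ u y‖ ≤ 3 / bdist U x₀ * L * (u - t) := by
        intro t ht u hu htu
        rw [mul_assoc]
        gcongr
        have := h.lipschitz.dist_le_mul t ht u hu
        rwa [dist_eq_norm, dist_comm, Real.dist_eq, abs_of_nonneg (sub_nonneg.2 htu)] at this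
      intro t ht u hu htu
      rcases le_total u (hitTime U γ y) with h1 | h1
      · exact (h.abs_radiusFn_sub_le_of_le hh (htu.trans h1) h1).trans (hl t ht u hu htu)
      rcases le_total (hitTime U γ y) t with h2 | h2
      · exact (h.abs_radiusFn_sub_le_of_ge hh h2 h1).trans (hl t ht u hu htu)
      have e1 := (h.abs_radiusFn_sub_le_of_le hh h2 le_rfl).trans (hl t ht _ hτ h2)
      have e2 := (h.abs_radiusFn_sub_le_of_ge hh le_rfl h1).trans (hl _ hτ u hu h1)
      refine (abs_sub_le _ _ _).trans ((add_le_add e1 e2).trans_eq (by ring))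
    refine ⟨(3 / bdist U x₀ * L).toNNReal, LipschitzOnWith.of_dist_le_mul fun t ht u hu => ?_⟩
    rw [Real.coe_toNNReal _ hk, Real.dist_eq, Real.dist_eq]
    rcases le_total t u with htu | htu
    · rw [abs_sub_comm t u, abs_of_nonneg (sub_nonneg.2 htu)]
      exact key t ht u hu htu
    · rw [abs_sub_comm, abs_of_nonneg (sub_nonneg.2 htu)]
      exact key u hu t ht htu
  · refine ⟨1, ?_⟩
    simp only [radiusFn_of_not_hit hh]
    exact LipschitzWith.id.lipschitzOnWith

theorem radiusFn_zero (h : IsPath U x₀ γ y L) : radiusFn U x₀ γ 0 y = 0 := by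
  by_cases hh : (hitSet U γ y).Nonempty
  · rw [radiusFn_of_le hh (h.hitTime_mem hh).1.1, h.start, sub_self, norm_zero, mul_zero]
  · exact radiusFn_of_not_hit hh 0

theorem radiusFn_one (h : IsPath U x₀ γ y L) : radiusFn U x₀ γ 1 y = 1 := by
  by_cases hh : (hitSet U γ y).Nonempty
  · rw [h.radiusFn_of_ge hh (h.hitTime_mem hh).1.2, h.finish, div_self h.pos_finish.ne']
  · exact radiusFn_of_not_hit hh 1

theorem radiusFn_nonneg (h : IsPath U x₀ γ y L) {t : ℝ} (ht : 0 ≤ t) :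
    0 ≤ radiusFn U x₀ γ t y := by
  by_cases hh : (hitSet U γ y).Nonempty
  · rcases le_total t (hitTime U γ y) with h1 | h1
    · rw [radiusFn_of_le hh h1]
      exact mul_nonneg (h.slopeConst_pos hh).le (norm_nonneg _)
    · rw [h.radiusFn_of_ge hh h1]
      exact div_nonneg (bdist_nonneg _ _) (bdist_nonneg _ _)
  · rwa [radiusFn_of_not_hit hh]

/-- The radius can only degenerate while the path sits at its label; there the mean of g is g(y) ∫
χ, as at time zero. -/
theorem eq_of_radiusFn_eq_zero (h : IsPath U x₀ γ y L) {t : ℝ} (ht : t ∈ Icc (0 : ℝ) 1)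
    (h0 : radiusFn U x₀ γ t y = 0) : γ t y = y := by
  by_cases hh : (hitSet U γ y).Nonempty
  · rcases le_total t (hitTime U γ y) with h1 | h1
    · rw [radiusFn_of_le hh h1, mul_eq_zero, or_iff_right (h.slopeConst_pos hh).ne',
        norm_eq_zero, sub_eq_zero] at h0
      exact h0.symm
    · rw [h.radiusFn_of_ge hh h1] at h0
      exact absurd h0 (div_pos (h.pos ht) h.pos_finish).ne'
  · rw [radiusFn_of_not_hit hh] at h0
    rw [h0, h.start]

/-- The endpoint x₀ then lies in B(y, d̂(y)/2), so y and x₀ have comparable distances to the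
complement. -/
theorem bdist_finish_le_of_not_hit (h : IsPath U x₀ γ y L) (hh : ¬(hitSet U γ y).Nonempty) :
    bdist U x₀ ≤ 3 / 2 * bdist U y ∧ bdist U y ≤ 2 * bdist U x₀ ∧ ‖y - x₀‖ ≤ bdist U x₀ := by
  have h1 := h.norm_lt_of_not_hit hh (t := 1) (by simp)
  rw [h.finish] at h1
  have h2 := bdist_le_add U x₀ y
  have h3 := bdist_le_add U y x₀
  rw [norm_sub_rev] at h2
  refine ⟨by linarith, by linarith, by linarith⟩

/-- The slope is at most 3/d̂(x₀) and 15 s ≤ d̂(x₀), whence the factor 1/5. The support of the bump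
is small compared with the distance already travelled from y. -/
theorem mul_radiusFn_le_of_le (h : IsPath U x₀ γ y L) {s : ℝ} (hs0 : 0 ≤ s)
    (hs : 15 * s ≤ bdist U x₀) (hh : (hitSet U γ y).Nonempty) {t : ℝ}
    (ht : t ≤ hitTime U γ y) : s * radiusFn U x₀ γ t y ≤ ‖y - γ t y‖ / 5 := by
  rw [radiusFn_of_le hh ht]
  have hd := h.pos_finish
  have h1 : s * slopeConst U x₀ γ y ≤ 1 / 5 := by
    calc s * slopeConst U x₀ γ y ≤ s * (3 / bdist U x₀) := by
          gcongr; exact h.slopeConst_le hh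
      _ ≤ 1 / 5 := by
          rw [mul_div_assoc', div_le_iff₀ hd]; linarith
  nlinarith [norm_nonneg (y - γ t y)]

theorem mul_radiusFn_le_of_ge (h : IsPath U x₀ γ y L) {s : ℝ}
    (hs : 15 * s ≤ bdist U x₀) (hh : (hitSet U γ y).Nonempty) {t : ℝ}
    (ht : hitTime U γ y ≤ t) : s * radiusFn U x₀ γ t y ≤ bdist U (γ t y) / 15 := by
  rw [h.radiusFn_of_ge hh ht]
  have hd := h.pos_finish
  rw [mul_div_assoc', div_le_div_iff₀ hd (by norm_num)]
  nlinarith [bdist_nonneg U (γ t y)]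

/-- The closed ball carrying the bump stays inside U. Before the hitting time, s ρ ≤ d̂(y)/10 while
d̂(γ) ≥ d̂(y)/2; afterwards s ρ ≤ d̂(γ)/15; without a hit, s ρ ≤ s ≤ d̂(y)/10. -/
theorem mul_radiusFn_lt (h : IsPath U x₀ γ y L) {s : ℝ} (hs0 : 0 ≤ s)
    (hs : 15 * s ≤ bdist U x₀) {t : ℝ} (ht : t ∈ Icc (0 : ℝ) 1) :
    s * radiusFn U x₀ γ t y < bdist U (γ t y) := by
  have h2 := bdist_le_add U y (γ t y)
  have hy := h.pos_start
  have hx := h.pos_finish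
  by_cases hh : (hitSet U γ y).Nonempty
  · rcases le_total t (hitTime U γ y) with h1 | h1
    · have h3 := h.norm_le_of_le_hitTime hh ht.1 h1
      have h4 := h.mul_radiusFn_le_of_le hs0 hs hh h1
      linarith
    · have := h.mul_radiusFn_le_of_ge hs hh h1
      have := h.pos ht
      linarith
  · rw [radiusFn_of_not_hit hh]
    have h3 := h.norm_lt_of_not_hit hh ht
    have h4 := (h.bdist_finish_le_of_not_hit hh).1
    have : s * t ≤ s := mul_le_of_le_one_right hs0 ht.2
    linarith

theorem add_smul_mem (h : IsPath U x₀ γ y L) {s : ℝ} (hs0 : 0 ≤ s)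
    (hs : 15 * s ≤ bdist U x₀) {t : ℝ} (ht : t ∈ Icc (0 : ℝ) 1) {w : Rn n}
    (hw : w ∈ Metric.closedBall (0 : Rn n) s) : γ t y + radiusFn U x₀ γ t y • w ∈ U := by
  refine mem_of_norm_sub_lt_bdist ((le_of_eq ?_).trans_lt ((mul_le_mul_of_nonneg_left
    (mem_closedBall_zero_iff.1 hw) (h.radiusFn_nonneg ht.1)).trans_lt
    ((mul_comm _ _).trans_lt (h.mul_radiusFn_lt hs0 hs ht))))
  rw [add_sub_cancel_left, norm_smul, Real.norm_of_nonneg (h.radiusFn_nonneg ht.1)]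

theorem closedBall_subset (h : IsPath U x₀ γ y L) {s : ℝ} (hs0 : 0 ≤ s)
    (hs : 15 * s ≤ bdist U x₀) {t : ℝ} (ht : t ∈ Icc (0 : ℝ) 1) :
    Metric.closedBall (γ t y) (s * radiusFn U x₀ γ t y) ⊆ U := fun x hx =>
  mem_of_norm_sub_lt_bdist (x := γ t y) (by
    rw [Metric.mem_closedBall, dist_eq_norm] at hx
    exact hx.trans_lt (h.mul_radiusFn_lt hs0 hs ht))

end IsPath

end Path

/-! ### Kernel estimates for paths that leave the ball about their label -/

section Bounds

variable {n : ℕ}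

/-- A smooth function supported in a closed ball about `x₀` and bounded by `B`. -/
structure IsMollifier (χ : Rn n → ℝ) (x₀ : Rn n) (s B : ℝ) : Prop where
  contDiff : ContDiff ℝ ∞ χ
  tsupport_subset : tsupport χ ⊆ Metric.closedBall x₀ s
  pos : 0 < s
  bound : ∀ z, |χ z| ≤ B

theorem IsMollifier.bound_nonneg {χ : Rn n → ℝ} {x₀ : Rn n} {s B : ℝ}
    (hχ : IsMollifier χ x₀ s B) : 0 ≤ B := (abs_nonneg _).trans (hχ.bound x₀)

theorem IsMollifier.tubeField_eq_zero {χ : Rn n → ℝ} {x₀ : Rn n} {s B : ℝ}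
    (hχ : IsMollifier χ x₀ s B) {p : Rn n} {r : ℝ} (hr : 0 < r) {p' : Rn n}
    {r' : ℝ} {x : Rn n} (h : s * r < ‖x - p‖) : tubeField χ x₀ p r p' r' x = 0 := by
  rw [tubeField, tubeKernel_eq_zero hχ.tsupport_subset hr h, zero_smul]

/-- Since `0⁻¹ = 0` and n ≥ 1, the field at radius zero is zero and not singular, so the times at
which the path is back at y are harmless in all integrals. -/
theorem tubeField_zero_radius (hn : 1 ≤ n) (χ : Rn n → ℝ) (x₀ p p' : Rn n) (r' : ℝ) (x : Rn n) :
    tubeField χ x₀ p 0 p' r' x = 0 := by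
  rw [tubeField, tubeKernel, zero_pow (by omega), inv_zero, mul_zero, zero_smul]

theorem IsMollifier.norm_tubeField_le {χ : Rn n → ℝ} {x₀ : Rn n} {s B : ℝ}
    (hχ : IsMollifier χ x₀ s B) {p : Rn n} {r : ℝ} (hr : 0 < r) (p' : Rn n)
    (r' : ℝ) (x : Rn n) :
    ‖tubeField χ x₀ p r p' r' x‖ ≤ B * (r ^ n)⁻¹ * (‖p'‖ + |r'| * s) := by
  have hB0 := hχ.bound_nonneg
  have hs0 := hχ.pos
  have hrn : 0 < r ^ n := pow_pos hr n
  rcases lt_or_ge (s * r) ‖x - p‖ with h | h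
  · rw [hχ.tubeField_eq_zero hr h, norm_zero]
    positivity
  · rw [tubeField, norm_smul, tubeKernel, norm_mul, norm_inv, Real.norm_of_nonneg hrn.le]
    gcongr
    · exact hχ.bound _
    · refine (norm_add_le _ _).trans ?_
      rw [norm_smul, norm_mul, norm_inv, Real.norm_of_nonneg hr.le, Real.norm_eq_abs, mul_assoc]
      gcongr
      rw [inv_mul_le_iff₀ hr, mul_comm]
      exact h

theorem abs_deriv_le_of_eventually {E : Type*} [NormedAddCommGroup E] [NormedSpace ℝ E]
    {f : ℝ → ℝ} {c : ℝ → E} {t f' : ℝ} {c' : E} {k : ℝ} (hf : HasDerivAt f f' t)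
    (hc : HasDerivAt c c' t) (h : ∀ᶠ u in 𝓝 t, |f u - f t| ≤ k * ‖c u - c t‖) :
    |f'| ≤ k * ‖c'‖ := by
  have h1 := (hasDerivAt_iff_tendsto_slope.1 hf).abs
  have h2 := (hasDerivAt_iff_tendsto_slope.1 hc).norm.const_mul k
  refine le_of_tendsto_of_tendsto h1 h2 ?_
  filter_upwards [nhdsWithin_le_nhds h] with u hu
  rw [slope_def_module, slope_def_module, norm_smul, smul_eq_mul, abs_mul, Real.norm_eq_abs,
    mul_left_comm]
  gcongr

/-- The potential kernel `|x-y|^{1-n} + 1_{γ_y ∩ B(x, d̂(x)/2) ≠ ∅} d̂(x)^{1-n}` whose integral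
against `μ₀` is the weight. -/
def majorant (U : Set (Rn n)) (γ : ℝ → Rn n → Rn n) (x y : Rn n) : ℝ≥0∞ :=
  ‖x - y‖ₑ ^ (1 - (n : ℤ)) +
    {y : Rn n | ∃ t ∈ Icc (0 : ℝ) 1, ‖γ t y - x‖ ≤ bdist U x / 2}.indicator
      (fun _ => ENNReal.ofReal (bdist U x) ^ (1 - (n : ℤ))) y

theorem ofReal_inv_pow_mul_self {D : ℝ} (hD : 0 < D) (m : ℕ) :
    ENNReal.ofReal ((D ^ m)⁻¹) * ENNReal.ofReal D = ENNReal.ofReal D ^ (1 - (m : ℤ)) := by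
  have h0 : ENNReal.ofReal D ≠ 0 := by simpa using hD
  rw [ENNReal.zpow_sub h0 ENNReal.ofReal_ne_top, zpow_one, mul_comm,
    ENNReal.ofReal_inv_of_pos (pow_pos hD m), ENNReal.ofReal_pow hD.le, zpow_natCast]

namespace IsPath

variable {U : Set (Rn n)} {x₀ : Rn n} {γ : ℝ → Rn n → Rn n} {y : Rn n} {L : ℝ≥0}

theorem ae_hasDerivAt (h : IsPath U x₀ γ y L) : ∀ᵐ t : ℝ, t ∈ Ioo (0 : ℝ) 1 →
    HasDerivAt (fun u => γ u y) (deriv (fun u => γ u y) t) t ∧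
    HasDerivAt (fun u => radiusFn U x₀ γ u y) (deriv (fun u => radiusFn U x₀ γ u y) t) t := by
  obtain ⟨R, hR⟩ := h.lipschitzOnWith_radiusFn
  filter_upwards [h.lipschitz.ae_differentiableWithinAt_of_mem,
    hR.ae_differentiableWithinAt_of_mem] with t h1 h2 ht
  have hN := Icc_mem_nhds ht.1 ht.2
  have htc := Ioo_subset_Icc_self ht
  exact ⟨((h1 htc).differentiableAt hN).hasDerivAt, ((h2 htc).differentiableAt hN).hasDerivAt⟩

theorem norm_deriv_le (h : IsPath U x₀ γ y L) {t : ℝ} (ht : t ∈ Ioo (0 : ℝ) 1) :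
    ‖deriv (fun u => γ u y) t‖ ≤ L :=
  norm_deriv_le_of_lipschitzOn (Icc_mem_nhds ht.1 ht.2) h.lipschitz

/-- On either side of the corner at the hitting time, ρ is a Lipschitz function of the position γ.
The bound is by the actual speed and not by a Lipschitz constant, so the kernel can be compared with
arc length. -/
theorem ae_abs_deriv_radiusFn_le (h : IsPath U x₀ γ y L) (hh : (hitSet U γ y).Nonempty) :
    ∀ᵐ t : ℝ, t ∈ Ioo (0 : ℝ) 1 →
      |deriv (fun u => radiusFn U x₀ γ u y) t| ≤ 3 / bdist U x₀ * ‖deriv (fun u => γ u y) t‖ := by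
  have hne : ∀ᵐ t : ℝ, t ≠ hitTime U γ y := by simp [ae_iff, measure_singleton]
  filter_upwards [h.ae_hasDerivAt, hne] with t hd hne ht
  obtain ⟨h1, h2⟩ := hd ht
  refine abs_deriv_le_of_eventually h2 h1 ?_
  rcases lt_or_gt_of_ne hne with hlt | hgt
  · filter_upwards [Iio_mem_nhds hlt] with u hu
    exact h.abs_radiusFn_sub_le_of_le hh (le_of_lt hu) hlt.le
  · filter_upwards [Ioi_mem_nhds hgt] with u hu
    exact h.abs_radiusFn_sub_le_of_ge hh (le_of_lt hu) hgt.le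

/-- On the support the dilation term is at most |ρ'| s ≤ (3 s/d̂(x₀)) |γ'| ≤ |γ'|, which gives the
factor 2. The parameter `a` will be |x - y| before the hitting time and d̂(x) after it. -/
theorem norm_kernelIntegrand_le_of_hit (h : IsPath U x₀ γ y L) {χ : Rn n → ℝ} {s B : ℝ}
    (hχ : IsMollifier χ x₀ s B) (h15 : 15 * s ≤ bdist U x₀) {t a : ℝ}
    (ha : 0 < a) (hr : a / (2 * bdist U x₀) ≤ radiusFn U x₀ γ t y)
    (hd : |deriv (fun u => radiusFn U x₀ γ u y) t|
      ≤ 3 / bdist U x₀ * ‖deriv (fun u => γ u y) t‖) (x : Rn n) :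
    ‖kernelIntegrand U x₀ γ χ x y t‖ₑ ≤ ENNReal.ofReal (2 * B * (2 * bdist U x₀) ^ n) *
      ENNReal.ofReal ((a ^ n)⁻¹) * ‖deriv (fun u => γ u y) t‖ₑ := by
  have hd0 := h.pos_finish
  have hB := hχ.bound_nonneg
  have hs0 := hχ.pos
  have hr0 : 0 < a / (2 * bdist U x₀) := by positivity
  rw [kernelIntegrand_eq_tubeField, ← ofReal_norm, ← ofReal_norm (deriv _ t),
    ← ENNReal.ofReal_mul (by positivity), ← ENNReal.ofReal_mul (by positivity)]
  refine ENNReal.ofReal_le_ofReal ((hχ.norm_tubeField_le (hr0.trans_le hr) _ _ _).trans ?_)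
  set V := ‖deriv (fun u => γ u y) t‖
  have h1 : V + |deriv (fun s => radiusFn U x₀ γ s y) t| * s ≤ 2 * V := by
    have : |deriv (fun s => radiusFn U x₀ γ s y) t| * s ≤ 3 / bdist U x₀ * V * s := by gcongr
    have h3 : 3 / bdist U x₀ * V * s = V * (3 * s / bdist U x₀) := by ring
    have h4 : 3 * s / bdist U x₀ ≤ 1 := by rw [div_le_one hd0]; linarith
    have h5 : V * (3 * s / bdist U x₀) ≤ V * 1 := by gcongr
    linarith
  have h2 : (radiusFn U x₀ γ t y ^ n)⁻¹ ≤ (2 * bdist U x₀) ^ n * (a ^ n)⁻¹ := by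
    calc (radiusFn U x₀ γ t y ^ n)⁻¹ ≤ ((a / (2 * bdist U x₀)) ^ n)⁻¹ := by gcongr
      _ = _ := by rw [div_pow, inv_div, div_eq_mul_inv]
  calc B * (radiusFn U x₀ γ t y ^ n)⁻¹ * (V + |deriv (fun s => radiusFn U x₀ γ s y) t| * s)
      ≤ B * ((2 * bdist U x₀) ^ n * (a ^ n)⁻¹) * (2 * V) := by
        have := hr0.trans_le hr
        gcongr
    _ = _ := by ring

theorem lintegral_le_lengthIn {S A : Set ℝ} (c : ℝ → Rn n) {f : ℝ → ℝ≥0∞} {k : ℝ≥0∞}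
    (hk : k ≠ ⊤) (hS : MeasurableSet S)
    (hf : ∀ᵐ t, t ∈ S → f t ≤ k * A.indicator (fun t => ‖deriv c t‖ₑ) t) :
    ∫⁻ t in S, f t ≤ k * ∫⁻ t in A, ‖deriv c t‖ₑ :=
  calc ∫⁻ t in S, f t ≤ ∫⁻ t in S, k * A.indicator (fun t => ‖deriv c t‖ₑ) t :=
        lintegral_mono_ae ((ae_restrict_iff' hS).2 hf)
    _ ≤ ∫⁻ t, k * A.indicator (fun t => ‖deriv c t‖ₑ) t := setLIntegral_le_lintegral _ _
    _ = k * ∫⁻ t, A.indicator (fun t => ‖deriv c t‖ₑ) t := lintegral_const_mul' _ _ hk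
    _ ≤ _ := mul_le_mul_right (lintegral_indicator_le _ _) _

/-- Where the integrand is nonzero, |x - γ| ≤ |y - γ|/5. Hence |y - γ| is comparable with |x - y|,
and so is ρ, and γ lies in B(x, |x - y|/3). The length of the path in that ball turns |x - y|⁻ⁿ into
|x - y|^(1-n). -/
theorem lintegral_kernelIntegrand_le_before (h : IsPath U x₀ γ y L) (hn : 1 ≤ n) {χ : Rn n → ℝ}
    {s B : ℝ} (hχ : IsMollifier χ x₀ s B) (h15 : 15 * s ≤ bdist U x₀)
    (hh : (hitSet U γ y).Nonempty) {x : Rn n} (hxy : x ≠ y) {K : ℝ≥0}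
    (hK : ∀ r : ℝ, 0 < r → r ≤ bdist U x / 2 →
      lengthIn (fun t => γ t y) (Metric.ball x r) ≤ K * ENNReal.ofReal r) :
    ∫⁻ t in Ioo 0 (hitTime U γ y), ‖kernelIntegrand U x₀ γ χ x y t‖ₑ ≤
      ENNReal.ofReal (2 * B * (2 * bdist U x₀) ^ n) * K * ‖x - y‖ₑ ^ (1 - (n : ℤ)) := by
  have hD : 0 < ‖x - y‖ := norm_pos_iff.2 (sub_ne_zero.2 hxy)
  have hd0 := h.pos_finish
  have hτ := (h.hitTime_mem hh).1
  have geo : ∀ t ∈ Ioo 0 (hitTime U γ y), kernelIntegrand U x₀ γ χ x y t ≠ 0 →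
      ‖x - y‖ / (2 * bdist U x₀) ≤ radiusFn U x₀ γ t y ∧ ‖γ t y - x‖ < ‖x - y‖ / 3 ∧
        ‖x - y‖ / 3 ≤ bdist U x / 2 := by
    intro t ht hne
    have hr : 0 < radiusFn U x₀ γ t y := by
      refine (h.radiusFn_nonneg ht.1.le).lt_of_ne fun h0 => hne ?_
      rw [kernelIntegrand_eq_tubeField, ← h0, tubeField_zero_radius hn]
    have h1 : ‖x - γ t y‖ ≤ s * radiusFn U x₀ γ t y := by
      by_contra hc
      exact hne (by rw [kernelIntegrand_eq_tubeField, hχ.tubeField_eq_zero hr (not_le.1 hc)])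
    have h2 := h1.trans (h.mul_radiusFn_le_of_le hχ.pos.le h15 hh ht.2.le)
    have h3 := h.norm_le_of_le_hitTime hh ht.1.le ht.2.le
    have h4 : ‖x - y‖ ≤ ‖x - γ t y‖ + ‖y - γ t y‖ := by
      rw [norm_sub_rev y]; exact norm_sub_le_norm_sub_add_norm_sub _ _ _
    have h5 : ‖y - γ t y‖ ≤ ‖x - y‖ + ‖x - γ t y‖ := by
      rw [norm_sub_rev x y]; exact norm_sub_le_norm_sub_add_norm_sub _ _ _
    have h6 := bdist_le_add U y x
    rw [norm_sub_rev] at h6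
    refine ⟨?_, ?_, by linarith⟩
    · rw [radiusFn_of_le hh ht.2.le]
      have h7 := h.le_slopeConst hh
      calc ‖x - y‖ / (2 * bdist U x₀) = 1 / bdist U x₀ * (‖x - y‖ / 2) := by field_simp
        _ ≤ slopeConst U x₀ γ y * ‖y - γ t y‖ := by
          have := (h.slopeConst_pos hh).le
          gcongr
          linarith
    · rw [norm_sub_rev]; linarith
  -- The length bound is only available for radii up to d̂(x)/2. By `geo` the integrand vanishes
  -- identically when |x - y|/3 exceeds this.
  by_cases hc : ‖x - y‖ / 3 ≤ bdist U x / 2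
  · set C0 := ENNReal.ofReal (2 * B * (2 * bdist U x₀) ^ n)
    calc ∫⁻ t in Ioo 0 (hitTime U γ y), ‖kernelIntegrand U x₀ γ χ x y t‖ₑ
        ≤ C0 * ENNReal.ofReal ((‖x - y‖ ^ n)⁻¹) *
          lengthIn (fun t => γ t y) (Metric.ball x (‖x - y‖ / 3)) := by
          refine lintegral_le_lengthIn (fun t => γ t y)
            (ENNReal.mul_ne_top ENNReal.ofReal_ne_top ENNReal.ofReal_ne_top) measurableSet_Ioo ?_
          filter_upwards [h.ae_abs_deriv_radiusFn_le hh] with t hd ht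
          by_cases hne : kernelIntegrand U x₀ γ χ x y t = 0
          · rw [hne]; simp
          · obtain ⟨g1, g2, g3⟩ := geo t ht hne
            rw [indicator_of_mem]
            · exact h.norm_kernelIntegrand_le_of_hit hχ h15 hD g1
                (hd ⟨ht.1, ht.2.trans_le hτ.2⟩) x
            · exact ⟨⟨ht.1.le, ht.2.le.trans hτ.2⟩, by rwa [Metric.mem_ball, dist_eq_norm]⟩
      _ ≤ C0 * ENNReal.ofReal ((‖x - y‖ ^ n)⁻¹) * (K * ENNReal.ofReal ‖x - y‖) := by
          gcongr
          refine (hK _ (by positivity) hc).trans ?_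
          gcongr
          linarith
      _ = C0 * K * (ENNReal.ofReal ((‖x - y‖ ^ n)⁻¹) * ENNReal.ofReal ‖x - y‖) := by ring
      _ = _ := by rw [ofReal_inv_pow_mul_self hD, ofReal_norm]
  · refine (le_of_eq ?_).trans zero_le
    rw [setLIntegral_congr_fun (g := fun _ => 0) measurableSet_Ioo, lintegral_zero]
    intro t ht
    by_contra hne
    exact hc (geo t ht (by simpa using hne)).2.2

/-- Here the bump has radius at most d̂(γ)/15, so a nonzero integrand forces d̂(γ) ≥ d̂(x)/2 and γ ∈
B(x, d̂(x)/2). If the path does not meet that ball, the contribution is zero, which is the role of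
the indicator. -/
theorem lintegral_kernelIntegrand_le_after (h : IsPath U x₀ γ y L) {χ : Rn n → ℝ}
    {s B : ℝ} (hχ : IsMollifier χ x₀ s B) (h15 : 15 * s ≤ bdist U x₀)
    (hh : (hitSet U γ y).Nonempty) {x : Rn n} (hx : x ∈ U) {K : ℝ≥0}
    (hK : ∀ r : ℝ, 0 < r → r ≤ bdist U x / 2 →
      lengthIn (fun t => γ t y) (Metric.ball x r) ≤ K * ENNReal.ofReal r) :
    ∫⁻ t in Ioo (hitTime U γ y) 1, ‖kernelIntegrand U x₀ γ χ x y t‖ₑ ≤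
      ENNReal.ofReal (2 * B * (2 * bdist U x₀) ^ n) * K *
        {y : Rn n | ∃ t ∈ Icc (0 : ℝ) 1, ‖γ t y - x‖ ≤ bdist U x / 2}.indicator
      (fun _ => ENNReal.ofReal (bdist U x) ^ (1 - (n : ℤ))) y := by
  have hD : 0 < bdist U x := bdist_pos h.isOpen h.compl_nonempty hx
  have hd0 := h.pos_finish
  have hτ := (h.hitTime_mem hh).1
  have geo : ∀ t ∈ Ioo (hitTime U γ y) 1, kernelIntegrand U x₀ γ χ x y t ≠ 0 →
      bdist U x / (2 * bdist U x₀) ≤ radiusFn U x₀ γ t y ∧ ‖γ t y - x‖ < bdist U x / 2 := by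
    intro t ht hne
    have htI : t ∈ Icc (0 : ℝ) 1 := ⟨hτ.1.trans ht.1.le, ht.2.le⟩
    have hp := h.pos htI
    have hr : 0 < radiusFn U x₀ γ t y := by
      rw [h.radiusFn_of_ge hh ht.1.le]; positivity
    have h1 : ‖x - γ t y‖ ≤ s * radiusFn U x₀ γ t y := by
      by_contra hc
      exact hne (by rw [kernelIntegrand_eq_tubeField, hχ.tubeField_eq_zero hr (not_le.1 hc)])
    have h2 := h1.trans (h.mul_radiusFn_le_of_ge h15 hh ht.1.le)
    have h3 := bdist_le_add U x (γ t y)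
    have h4 := bdist_le_add U (γ t y) x
    rw [norm_sub_rev] at h4
    refine ⟨?_, ?_⟩
    · rw [h.radiusFn_of_ge hh ht.1.le, div_le_div_iff₀ (by positivity) (by positivity)]
      nlinarith
    · rw [norm_sub_rev]; linarith
  by_cases hc : ∃ t ∈ Icc (0 : ℝ) 1, ‖γ t y - x‖ ≤ bdist U x / 2
  · set C0 := ENNReal.ofReal (2 * B * (2 * bdist U x₀) ^ n)
    rw [indicator_of_mem (by exact hc)]
    calc ∫⁻ t in Ioo (hitTime U γ y) 1, ‖kernelIntegrand U x₀ γ χ x y t‖ₑ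
        ≤ C0 * ENNReal.ofReal ((bdist U x ^ n)⁻¹) *
          lengthIn (fun t => γ t y) (Metric.ball x (bdist U x / 2)) := by
          refine lintegral_le_lengthIn (fun t => γ t y)
            (ENNReal.mul_ne_top ENNReal.ofReal_ne_top ENNReal.ofReal_ne_top) measurableSet_Ioo ?_
          filter_upwards [h.ae_abs_deriv_radiusFn_le hh] with t hd ht
          by_cases hne : kernelIntegrand U x₀ γ χ x y t = 0
          · rw [hne]; simp
          · obtain ⟨g1, g2⟩ := geo t ht hne
            rw [indicator_of_mem]
            · exact h.norm_kernelIntegrand_le_of_hit hχ h15 hD g1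
                (hd ⟨hτ.1.trans_lt ht.1, ht.2⟩) x
            · exact ⟨⟨hτ.1.trans ht.1.le, ht.2.le⟩, by rwa [Metric.mem_ball, dist_eq_norm]⟩
      _ ≤ C0 * ENNReal.ofReal ((bdist U x ^ n)⁻¹) * (K * ENNReal.ofReal (bdist U x)) := by
          gcongr
          refine (hK _ (by positivity) le_rfl).trans ?_
          gcongr
          linarith
      _ = C0 * K * (ENNReal.ofReal ((bdist U x ^ n)⁻¹) * ENNReal.ofReal (bdist U x)) := by ring
      _ = _ := by rw [ofReal_inv_pow_mul_self hD]
  · refine (le_of_eq ?_).trans zero_le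
    rw [setLIntegral_congr_fun (g := fun _ => 0) measurableSet_Ioo, lintegral_zero]
    intro t ht
    by_contra hne
    exact hc ⟨t, ⟨hτ.1.trans ht.1.le, ht.2.le⟩, (geo t ht (by simpa using hne)).2.le⟩

theorem lintegral_kernelIntegrand_le_of_hit (h : IsPath U x₀ γ y L) (hn : 1 ≤ n) {χ : Rn n → ℝ}
    {s B : ℝ} (hχ : IsMollifier χ x₀ s B) (h15 : 15 * s ≤ bdist U x₀)
    (hh : (hitSet U γ y).Nonempty) {x : Rn n} (hx : x ∈ U) (hxy : x ≠ y) {K : ℝ≥0}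
    (hK : ∀ r : ℝ, 0 < r → r ≤ bdist U x / 2 →
      lengthIn (fun t => γ t y) (Metric.ball x r) ≤ K * ENNReal.ofReal r) :
    ∫⁻ t in Ioc 0 1, ‖kernelIntegrand U x₀ γ χ x y t‖ₑ ≤
      ENNReal.ofReal (2 * B * (2 * bdist U x₀) ^ n) * K * majorant U γ x y := by
  have h1 := h.lintegral_kernelIntegrand_le_before hn hχ h15 hh hxy hK
  have h2 := h.lintegral_kernelIntegrand_le_after hχ h15 hh hx hK
  rw [majorant, mul_add]
  refine le_trans ?_ (add_le_add h1 h2)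
  rw [setLIntegral_congr Ioo_ae_eq_Ioc.symm]
  refine le_trans ?_ (lintegral_union_le _ _ _)
  rw [← setLIntegral_congr (show (Ioo 0 1 \ {hitTime U γ y} : Set ℝ) =ᵐ[volume] Ioo (0 : ℝ) 1 from
    sdiff_null_ae_eq_self (by simp))]
  refine lintegral_mono_set fun t ht => ?_
  rcases lt_or_gt_of_ne ht.2 with h' | h'
  · exact Or.inl ⟨ht.1.1, h'⟩
  · exact Or.inr ⟨h', ht.1.2⟩

end IsPath

end Bounds

/-! ### Kernel estimates for paths that stay near their label -/

section NoHit

variable {n : ℕ}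

theorem lintegral_Ioi_inv_pow_le {a : ℝ} (ha : 0 < a) (hn : 2 ≤ n) :
    ∫⁻ t in Ioi a, ENNReal.ofReal ((t ^ n)⁻¹) ≤ ENNReal.ofReal ((a ^ n)⁻¹ * a) := by
  have hn' : (2 : ℝ) ≤ n := by exact_mod_cast hn
  have e : ∀ t ∈ Ioi a, (t ^ n)⁻¹ = t ^ (-(n : ℝ)) := fun t ht => by
    rw [Real.rpow_neg (ha.trans ht).le, Real.rpow_natCast]
  have hint : IntegrableOn (fun t : ℝ => t ^ (-(n : ℝ))) (Ioi a) :=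
    integrableOn_Ioi_rpow_of_lt (by linarith) ha
  rw [setLIntegral_congr_fun measurableSet_Ioi (fun t ht => by rw [e t ht]),
    ← ofReal_integral_eq_lintegral_ofReal hint]
  · refine ENNReal.ofReal_le_ofReal ?_
    rw [integral_Ioi_rpow_of_lt (by linarith) ha, Real.rpow_add_one ha.ne', Real.rpow_neg ha.le,
      Real.rpow_natCast, neg_div, ← div_neg]
    exact div_le_self (by positivity) (by linarith)
  · exact (ae_restrict_iff' measurableSet_Ioi).2
      (Filter.Eventually.of_forall fun t ht => Real.rpow_nonneg (ha.trans ht).le _)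

theorem measurable_tubeField {α : Type*} [MeasurableSpace α] {χ : Rn n → ℝ} (hχ : Measurable χ)
    (x₀ : Rn n) {p p' x : α → Rn n} {r r' : α → ℝ} (hp : Measurable p) (hr : Measurable r)
    (hp' : Measurable p') (hr' : Measurable r') (hx : Measurable x) :
    Measurable fun a => tubeField χ x₀ (p a) (r a) (p' a) (r' a) (x a) := by
  unfold tubeField tubeKernel
  fun_prop

namespace IsPath

variable {U : Set (Rn n)} {x₀ : Rn n} {γ : ℝ → Rn n → Rn n} {y : Rn n} {L : ℝ≥0}

theorem exists_measurable_kernelIntegrand (h : IsPath U x₀ γ y L) {χ : Rn n → ℝ} {s B : ℝ}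
    (hχ : IsMollifier χ x₀ s B) : ∃ H : ℝ × Rn n → Rn n, Measurable H ∧
      ∀ t ∈ Icc (0 : ℝ) 1, ∀ x, H (t, x) = kernelIntegrand U x₀ γ χ x y t := by
  obtain ⟨R, hR⟩ := h.lipschitzOnWith_radiusFn
  have hp : Continuous fun t : ℝ => (projIcc 0 1 zero_le_one t : ℝ) :=
    continuous_subtype_val.comp continuous_projIcc
  have hc : Continuous fun t : ℝ => γ (projIcc 0 1 zero_le_one t) y :=
    h.continuousOn.comp_continuous hp fun t => (projIcc 0 1 zero_le_one t).2
  have hr : Continuous fun t : ℝ => radiusFn U x₀ γ (projIcc 0 1 zero_le_one t) y :=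
    hR.continuousOn.comp_continuous hp fun t => (projIcc 0 1 zero_le_one t).2
  refine ⟨fun q => tubeField χ x₀ (γ (projIcc 0 1 zero_le_one q.1) y)
    (radiusFn U x₀ γ (projIcc 0 1 zero_le_one q.1) y) (deriv (fun u => γ u y) q.1)
    (deriv (fun u => radiusFn U x₀ γ u y) q.1) q.2, ?_, fun t ht x => ?_⟩
  · exact measurable_tubeField hχ.contDiff.continuous.measurable x₀ (hc.measurable.comp measurable_fst)
      (hr.measurable.comp measurable_fst) ((measurable_deriv _).comp measurable_fst)
      ((measurable_deriv _).comp measurable_fst) measurable_snd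
  · simp only [projIcc_of_mem zero_le_one ht]
    rfl

theorem aestronglyMeasurable_kernelIntegrand (h : IsPath U x₀ γ y L) {χ : Rn n → ℝ} {s B : ℝ}
    (hχ : IsMollifier χ x₀ s B) (x : Rn n) :
    AEStronglyMeasurable (kernelIntegrand U x₀ γ χ x y) (volume.restrict (Ioc 0 1)) := by
  obtain ⟨H, hH, he⟩ := h.exists_measurable_kernelIntegrand hχ
  refine (hH.comp (measurable_id.prodMk measurable_const)).aestronglyMeasurable.congr
    (f := fun t => H (t, x)) ?_
  refine (ae_restrict_iff' measurableSet_Ioc).2 (Filter.Eventually.of_forall fun t ht => ?_)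
  exact he t (Ioc_subset_Icc_self ht) x

theorem deriv_radiusFn_of_not_hit (hh : ¬(hitSet U γ y).Nonempty) (t : ℝ) :
    deriv (fun u => radiusFn U x₀ γ u y) t = 1 := by
  simp only [radiusFn_of_not_hit hh]
  exact deriv_id t

theorem norm_kernelIntegrand_le_of_not_hit (h : IsPath U x₀ γ y L) {χ : Rn n → ℝ} {s B : ℝ}
    (hχ : IsMollifier χ x₀ s B) (hh : ¬(hitSet U γ y).Nonempty) {t : ℝ} (ht : t ∈ Ioo (0 : ℝ) 1)
    (x : Rn n) : ‖kernelIntegrand U x₀ γ χ x y t‖ ≤ B * (t ^ n)⁻¹ * (s + L) := by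
  have hB := hχ.bound_nonneg
  have ht0 := ht.1
  rw [kernelIntegrand_eq_tubeField, deriv_radiusFn_of_not_hit hh, radiusFn_of_not_hit hh]
  refine (hχ.norm_tubeField_le ht.1 _ _ _).trans ?_
  have := h.norm_deriv_le ht
  rw [abs_one, one_mul, add_comm s]
  gcongr

/-- With ρ = t the bump lies in B(γ(t), s t), and γ(t) is within L t of y, so a point x is reached
only after time |x - y|/(s + L). -/
theorem kernelIntegrand_eq_zero_of_not_hit (h : IsPath U x₀ γ y L) {χ : Rn n → ℝ} {s B : ℝ}
    (hχ : IsMollifier χ x₀ s B) (hh : ¬(hitSet U γ y).Nonempty) {t : ℝ} (ht : t ∈ Ioc (0 : ℝ) 1)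
    {x : Rn n} (hx : t * (s + L) < ‖x - y‖) : kernelIntegrand U x₀ γ χ x y t = 0 := by
  rw [kernelIntegrand_eq_tubeField, radiusFn_of_not_hit hh]
  refine hχ.tubeField_eq_zero ht.1 ?_
  have h1 := h.lipschitz.dist_le_mul t (Ioc_subset_Icc_self ht) 0 (by simp)
  rw [dist_eq_norm, dist_zero_right, Real.norm_of_nonneg ht.1.le, h.start] at h1
  have h2 : ‖x - y‖ ≤ ‖x - γ t y‖ + ‖γ t y - y‖ := norm_sub_le_norm_sub_add_norm_sub _ _ _
  nlinarith

theorem enorm_kernelIntegrand_le_indicator (h : IsPath U x₀ γ y L) {χ : Rn n → ℝ} {s B : ℝ}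
    (hχ : IsMollifier χ x₀ s B) (hh : ¬(hitSet U γ y).Nonempty) {t : ℝ} (ht : t ∈ Ioo (0 : ℝ) 1)
    (x : Rn n) : ‖kernelIntegrand U x₀ γ χ x y t‖ₑ ≤ (Ici (‖x - y‖ / (s + L))).indicator
      (fun t => ENNReal.ofReal (B * (s + L)) * ENNReal.ofReal ((t ^ n)⁻¹)) t := by
  have hB := hχ.bound_nonneg
  have hs := hχ.pos
  by_cases hm : t ∈ Ici (‖x - y‖ / (s + L))
  · rw [indicator_of_mem hm, ← ENNReal.ofReal_mul (by positivity), ← ofReal_norm]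
    refine ENNReal.ofReal_le_ofReal ((h.norm_kernelIntegrand_le_of_not_hit hχ hh ht x).trans_eq ?_)
    ring
  · rw [h.kernelIntegrand_eq_zero_of_not_hit hχ hh ⟨ht.1, ht.2.le⟩, enorm_zero]
    · exact zero_le
    · rw [mem_Ici, not_le, lt_div_iff₀ (by positivity)] at hm
      exact hm

theorem integrableOn_kernelIntegrand_of_not_hit (h : IsPath U x₀ γ y L) {χ : Rn n → ℝ} {s B : ℝ}
    (hχ : IsMollifier χ x₀ s B) (hh : ¬(hitSet U γ y).Nonempty) {x : Rn n} (hxy : x ≠ y) :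
    IntegrableOn (kernelIntegrand U x₀ γ χ x y) (Ioc 0 1) := by
  have hB := hχ.bound_nonneg
  have hs := hχ.pos
  have hD : 0 < ‖x - y‖ := norm_pos_iff.2 (sub_ne_zero.2 hxy)
  set a := ‖x - y‖ / (s + L)
  have ha : 0 < a := by positivity
  refine Integrable.of_bound (h.aestronglyMeasurable_kernelIntegrand hχ x)
    (B * (s + L) * (a ^ n)⁻¹) ?_
  have h1 : ∀ᵐ t : ℝ, t ≠ 1 := by simp [ae_iff, measure_singleton]
  refine (ae_restrict_iff' measurableSet_Ioc).2 ?_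
  filter_upwards [h1] with t ht1 ht
  by_cases hta : a ≤ t
  · refine (h.norm_kernelIntegrand_le_of_not_hit hχ hh ⟨ht.1, lt_of_le_of_ne ht.2 ht1⟩ x).trans ?_
    rw [mul_right_comm]
    gcongr
  · rw [h.kernelIntegrand_eq_zero_of_not_hit hχ hh ht, norm_zero]
    · positivity
    · rwa [not_le, lt_div_iff₀ (by positivity)] at hta

/-- The integrand is at most a constant times t⁻ⁿ and starts at time a = |x - y|/(s + L). For n ≥ 2
the tail integral is at most a^(1-n), whatever the truncation η. -/
theorem enorm_integral_le_of_two_le (h : IsPath U x₀ γ y L) (hn : 2 ≤ n) {χ : Rn n → ℝ}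
    {s B : ℝ} (hχ : IsMollifier χ x₀ s B) (hh : ¬(hitSet U γ y).Nonempty) {x : Rn n} (hxy : x ≠ y)
    {M : ℝ≥0} (hM : L ≤ M) {η : ℝ} (hη : η ∈ Icc (0 : ℝ) 1) :
    ‖∫ t in η..1, kernelIntegrand U x₀ γ χ x y t‖ₑ ≤
      ENNReal.ofReal (B * (s + M) ^ n) * ‖x - y‖ₑ ^ (1 - (n : ℤ)) := by
  have hB := hχ.bound_nonneg
  have hs := hχ.pos
  have hD : 0 < ‖x - y‖ := norm_pos_iff.2 (sub_ne_zero.2 hxy)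
  set a := ‖x - y‖ / (s + L) with ha'
  have ha : 0 < a := by positivity
  rw [intervalIntegral.integral_of_le hη.2]
  calc ‖∫ t in Ioc η 1, kernelIntegrand U x₀ γ χ x y t‖ₑ
      ≤ ∫⁻ t in Ioc η 1, ‖kernelIntegrand U x₀ γ χ x y t‖ₑ := enorm_integral_le_lintegral_enorm _
    _ ≤ ∫⁻ t in Ioc 0 1, ‖kernelIntegrand U x₀ γ χ x y t‖ₑ :=
      lintegral_mono_set (Ioc_subset_Ioc_left hη.1)
    _ = ∫⁻ t in Ioo 0 1, ‖kernelIntegrand U x₀ γ χ x y t‖ₑ :=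
      setLIntegral_congr Ioo_ae_eq_Ioc.symm
    _ ≤ ∫⁻ t in Ioo 0 1, (Ici a).indicator
          (fun t => ENNReal.ofReal (B * (s + L)) * ENNReal.ofReal ((t ^ n)⁻¹)) t :=
      setLIntegral_mono' measurableSet_Ioo fun t ht =>
        h.enorm_kernelIntegrand_le_indicator hχ hh ht x
    _ ≤ ∫⁻ t, (Ici a).indicator
          (fun t => ENNReal.ofReal (B * (s + L)) * ENNReal.ofReal ((t ^ n)⁻¹)) t :=
      setLIntegral_le_lintegral _ _
    _ = ENNReal.ofReal (B * (s + L)) * ∫⁻ t in Ioi a, ENNReal.ofReal ((t ^ n)⁻¹) := by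
      rw [lintegral_indicator measurableSet_Ici, lintegral_const_mul' _ _ ENNReal.ofReal_ne_top,
        setLIntegral_congr Ioi_ae_eq_Ici.symm]
    _ ≤ ENNReal.ofReal (B * (s + L)) * ENNReal.ofReal ((a ^ n)⁻¹ * a) := by
      gcongr
      exact lintegral_Ioi_inv_pow_le ha hn
    _ = ENNReal.ofReal (B * (s + L) ^ n) *
          (ENNReal.ofReal ((‖x - y‖ ^ n)⁻¹) * ENNReal.ofReal ‖x - y‖) := by
      rw [← ENNReal.ofReal_mul (by positivity), ← ENNReal.ofReal_mul (by positivity),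
        ← ENNReal.ofReal_mul (by positivity), ha']
      congr 1
      have : s + L ≠ 0 := by positivity
      rw [div_pow]
      field_simp
    _ ≤ ENNReal.ofReal (B * (s + M) ^ n) *
          (ENNReal.ofReal ((‖x - y‖ ^ n)⁻¹) * ENNReal.ofReal ‖x - y‖) := by
      gcongr
    _ = _ := by rw [ofReal_inv_pow_mul_self hD, ofReal_norm]

end IsPath

end NoHit

/-! ### Cancellation in dimension one -/

section OneDim

/-- A primitive of a mollifier on the line. -/
def primitiveOne (χ : Rn 1 → ℝ) (w : Rn 1) : ℝ :=
  ∫ u in (0 : ℝ)..(w 0), χ (EuclideanSpace.single 0 u)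

theorem single_coord (w : Rn 1) : (EuclideanSpace.single 0 (w 0) : Rn 1) = w := by
  ext i
  fin_cases i
  simp

theorem continuous_single_zero :
    Continuous fun u : ℝ => (EuclideanSpace.single 0 u : Rn 1) := by
  have h : Continuous fun u : ℝ => u • (EuclideanSpace.single 0 1 : Rn 1) := by fun_prop
  refine h.congr fun u => ?_
  ext i
  fin_cases i
  simp

theorem hasFDerivAt_primitiveOne {χ : Rn 1 → ℝ} (hχ : Continuous χ) (w : Rn 1) :
    HasFDerivAt (primitiveOne χ) (χ w • (EuclideanSpace.proj 0 : Rn 1 →L[ℝ] ℝ)) w := by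
  have hc : Continuous fun u : ℝ => χ (EuclideanSpace.single 0 u) :=
    hχ.comp continuous_single_zero
  have h1 := (hc.integral_hasStrictDerivAt 0 (w 0)).hasDerivAt
  rw [single_coord] at h1
  exact h1.comp_hasFDerivAt w (EuclideanSpace.proj 0 : Rn 1 →L[ℝ] ℝ).hasFDerivAt

theorem contDiff_primitiveOne {χ : Rn 1 → ℝ} (hχ : ContDiff ℝ ∞ χ) :
    ContDiff ℝ ∞ (primitiveOne χ) := by
  rw [contDiff_infty_iff_fderiv]
  refine ⟨fun w => (hasFDerivAt_primitiveOne hχ.continuous w).differentiableAt, ?_⟩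
  rw [funext fun w => (hasFDerivAt_primitiveOne hχ.continuous w).fderiv]
  fun_prop

theorem exists_abs_primitiveOne_le {χ : Rn 1 → ℝ} {x₀ : Rn 1} {s B : ℝ}
    (hχ : IsMollifier χ x₀ s B) : ∃ M : ℝ, ∀ w, |primitiveOne χ w| ≤ M := by
  have hc : Continuous fun u : ℝ => χ (EuclideanSpace.single 0 u) :=
    hχ.contDiff.continuous.comp continuous_single_zero
  have hcs : HasCompactSupport fun u : ℝ => χ (EuclideanSpace.single 0 u) := by
    refine HasCompactSupport.of_support_subset_isCompact
      (isCompact_Icc (a := x₀ 0 - s) (b := x₀ 0 + s)) fun u hu => ?_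
    have := hχ.tsupport_subset (subset_tsupport _ hu)
    rw [Metric.mem_closedBall, dist_eq_norm, EuclideanSpace.norm_eq] at this
    simp only [Fin.sum_univ_one, PiLp.sub_apply, Fin.isValue,
      Real.norm_eq_abs, sq_abs, Real.sqrt_sq_eq_abs] at this
    simp at this
    rw [abs_le] at this
    constructor <;> linarith [this.1, this.2]
  have hi := hc.integrable_of_hasCompactSupport hcs (μ := volume)
  refine ⟨∫ u, ‖χ (EuclideanSpace.single 0 u)‖, fun w => ?_⟩
  rw [primitiveOne, ← Real.norm_eq_abs]
  refine (intervalIntegral.norm_integral_le_integral_norm_uIoc).trans ?_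
  exact setIntegral_le_integral hi.norm (Filter.Eventually.of_forall fun _ => norm_nonneg _)

/-- Estimating the absolute value by 1/t would leave a logarithm. But if P is a primitive of χ, the
field is minus the time derivative of P(x₀ + (x - c)/t), so the integral is a difference of two
bounded values. -/
theorem norm_integral_tubeField_one_le {χ : Rn 1 → ℝ} {x₀ : Rn 1} {s B : ℝ}
    (hχ : IsMollifier χ x₀ s B) {M : ℝ} (hM : ∀ w, |primitiveOne χ w| ≤ M) {c : ℝ → Rn 1} {p : ℝ}
    (hp : 0 < p) (hp1 : p ≤ 1) {L : ℝ≥0} (hc : LipschitzOnWith L c (Icc p 1)) (x : Rn 1)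
    (hint : IntervalIntegrable (fun t => tubeField χ x₀ (c t) t (deriv c t) 1 x) volume p 1) :
    ‖∫ t in p..1, tubeField χ x₀ (c t) t (deriv c t) 1 x‖ ≤ 2 * M := by
  -- Multiplying by t cancels the normalization t⁻¹ of `tubeKernel`. The earlier Lipschitz and
  -- derivative lemmas ask only for smoothness, so they apply to the primitive although its support
  -- need not be compact.
  set Φ : ℝ → ℝ := fun t => tubeKernel (primitiveOne χ) x₀ (c t) t x * t
  have hΦ : ∀ t ∈ Icc p 1, Φ t = primitiveOne χ (x₀ + t⁻¹ • (x - c t)) := fun t ht => by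
    have : t ≠ 0 := (hp.trans_le ht.1).ne'
    simp only [Φ, tubeKernel, pow_one]
    rw [inv_mul_cancel_right₀ this]
  obtain ⟨K, hK⟩ := exists_lipschitzOnWith_tubeKernel (contDiff_primitiveOne hχ.contDiff) x₀ hc
    (LipschitzWith.id.lipschitzOnWith (s := Icc p 1)) (fun t ht => hp.trans_le ht.1)
    (isCompact_singleton (x := x))
  have hac : AbsolutelyContinuousOnInterval Φ p 1 := by
    refine AbsolutelyContinuousOnInterval.fun_mul ?_ ?_
    · exact LipschitzOnWith.absolutelyContinuousOnInterval (K := K)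
        (by rw [uIcc_of_le hp1]; exact hK x rfl)
    · exact LipschitzOnWith.absolutelyContinuousOnInterval (K := 1)
        LipschitzWith.id.lipschitzOnWith
  have hcoord : (∫ t in p..1, tubeField χ x₀ (c t) t (deriv c t) 1 x) 0
      = ∫ t in p..1, tubeField χ x₀ (c t) t (deriv c t) 1 x 0 :=
    ((EuclideanSpace.proj 0 : Rn 1 →L[ℝ] ℝ).intervalIntegral_comp_comm hint).symm
  have hder : ∫ t in p..1, tubeField χ x₀ (c t) t (deriv c t) 1 x 0
      = ∫ t in p..1, -deriv Φ t := by
    refine intervalIntegral.integral_congr_ae ?_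
    have hnb : ∀ᵐ x : ℝ, x ≠ 1 := by simp [ae_iff, measure_singleton]
    filter_upwards [hnb, hc.ae_differentiableWithinAt_of_mem] with t ht1 hd ht
    rw [uIoc_of_le hp1] at ht
    have htI : t ∈ Ioo p 1 := ⟨ht.1, lt_of_le_of_ne ht.2 ht1⟩
    have hd := ((hd (Ioo_subset_Icc_self htI)).differentiableAt
      (Icc_mem_nhds htI.1 htI.2)).hasDerivAt
    have ht0 : t ≠ 0 := (hp.trans htI.1).ne'
    have h1 := (hasDerivAt_tubeKernel (contDiff_primitiveOne hχ.contDiff) x₀ x hd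
      (hasDerivAt_id t) ht0).fun_mul (hasDerivAt_id t)
    have h2 : deriv Φ t = _ := h1.deriv
    rw [h2, tubeDiv, (hasFDerivAt_primitiveOne hχ.contDiff.continuous _).fderiv, tubeField,
      tubeKernel, tubeKernel]
    simp
    field_simp
    ring
  have hnorm : ∀ z : Rn 1, ‖z‖ = |z 0| := fun z => by
    rw [EuclideanSpace.norm_eq]; simp [Real.sqrt_sq_eq_abs]
  rw [hnorm, hcoord, hder, intervalIntegral.integral_neg, hac.integral_deriv_eq_sub, abs_neg,
    hΦ 1 ⟨hp1, le_rfl⟩, hΦ p ⟨le_rfl, hp1⟩]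
  refine (abs_sub _ _).trans ?_
  linarith [hM (x₀ + (1 : ℝ)⁻¹ • (x - c 1)), hM (x₀ + p⁻¹ • (x - c p))]

end OneDim

/-! ### A uniform bound on truncated kernels -/

section KernelBound

variable {n : ℕ}

/-- The constant depends only on the mollifier and on a bound `M` for the Lipschitz constants, and
not on the truncation. This gives both the bound on the kernel and a dominating function for the
limit η → 0. -/
theorem exists_enorm_integral_le_of_not_hit (hn : 1 ≤ n) {χ : Rn n → ℝ} {x₀ : Rn n} {s B : ℝ}
    (hχ : IsMollifier χ x₀ s B) (M : ℝ≥0) :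
    ∃ C : ℝ≥0, ∀ {U : Set (Rn n)} {γ : ℝ → Rn n → Rn n} {y : Rn n} {L : ℝ≥0},
      IsPath U x₀ γ y L → ¬(hitSet U γ y).Nonempty → L ≤ M → ∀ x, x ≠ y →
      ∀ η ∈ Ioc (0 : ℝ) 1, ‖∫ t in η..1, kernelIntegrand U x₀ γ χ x y t‖ₑ ≤
        C * ‖x - y‖ₑ ^ (1 - (n : ℤ)) := by
  rcases hn.eq_or_lt with rfl | hn
  · obtain ⟨A, hA⟩ := exists_abs_primitiveOne_le hχ
    refine ⟨(2 * A).toNNReal, fun {U γ y L} h hh hL x hxy η hη => ?_⟩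
    have hint : IntervalIntegrable (kernelIntegrand U x₀ γ χ x y) volume η 1 :=
      (intervalIntegrable_iff_integrableOn_Ioc_of_le hη.2).2
        ((h.integrableOn_kernelIntegrand_of_not_hit hχ hh hxy).mono_set
          (Ioc_subset_Ioc_left hη.1.le))
    have e : kernelIntegrand U x₀ γ χ x y
        = fun t => tubeField χ x₀ (γ t y) t (deriv (fun u => γ u y) t) 1 x := by
      ext1 t
      rw [kernelIntegrand_eq_tubeField, IsPath.deriv_radiusFn_of_not_hit hh,
        radiusFn_of_not_hit hh]
    have h1 := norm_integral_tubeField_one_le hχ hA hη.1 hη.2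
      (h.lipschitz.mono (Icc_subset_Icc_left hη.1.le)) x (e ▸ hint)
    have h2 := ENNReal.ofReal_le_ofReal h1
    rw [ofReal_norm] at h2
    rw [e]
    refine h2.trans_eq ?_
    simp [ENNReal.ofReal]
  · exact ⟨(B * (s + M) ^ n).toNNReal, fun h hh hL x hxy η hη =>
      h.enorm_integral_le_of_two_le hn hχ hh hxy hL ⟨hη.1.le, hη.2⟩⟩

end KernelBound

/-! ### The reproducing identity for a single label -/

section Identity

variable {n : ℕ}

namespace IsPath

variable {U : Set (Rn n)} {x₀ : Rn n} {γ : ℝ → Rn n → Rn n} {y : Rn n} {L : ℝ≥0}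

/-- Fubini in (t, x). It is used on all of (0, 1] when the path hits the sphere and on (η, 1] when
it does not. -/
theorem integral_inner_integral_kernelIntegrand (h : IsPath U x₀ γ y L) {χ : Rn n → ℝ} {s B : ℝ}
    (hχ : IsMollifier χ x₀ s B) {v : Rn n → Rn n}
    (hv : AEStronglyMeasurable v (volume.restrict U)) {η : ℝ} (hη : η ∈ Icc (0 : ℝ) 1)
    (hfin : ∫⁻ x in U, (∫⁻ t in Ioc η 1, ‖kernelIntegrand U x₀ γ χ x y t‖ₑ) * ‖v x‖ₑ < ⊤) :
    IntervalIntegrable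
        (fun t => ∫ x in U, inner ℝ (kernelIntegrand U x₀ γ χ x y t) (v x)) volume η 1 ∧
      ∫ x in U, inner ℝ (∫ t in η..1, kernelIntegrand U x₀ γ χ x y t) (v x)
        = ∫ t in η..1, ∫ x in U, inner ℝ (kernelIntegrand U x₀ γ χ x y t) (v x) := by
  obtain ⟨H, hH, he⟩ := h.exists_measurable_kernelIntegrand hχ
  have hsub : Ioc η 1 ⊆ Icc (0 : ℝ) 1 := Ioc_subset_Icc_self.trans (Icc_subset_Icc_left hη.1)
  have e1 : ∀ x, ∫⁻ t in Ioc η 1, ‖kernelIntegrand U x₀ γ χ x y t‖ₑ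
      = ∫⁻ t in Ioc η 1, ‖H (t, x)‖ₑ := fun x =>
    setLIntegral_congr_fun measurableSet_Ioc fun t ht => by rw [he t (hsub ht) x]
  simp_rw [e1] at hfin
  have hHm : Measurable fun x => ∫⁻ t in Ioc η 1, ‖H (t, x)‖ₑ :=
    Measurable.lintegral_prod_left' hH.enorm
  have hJm : AEStronglyMeasurable (fun q : ℝ × Rn n => inner ℝ (H q) (v q.2))
      ((volume.restrict (Ioc η 1)).prod (volume.restrict U)) :=
    hH.aestronglyMeasurable.inner hv.comp_snd
  have hJ : Integrable (fun q : ℝ × Rn n => inner ℝ (H q) (v q.2))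
      ((volume.restrict (Ioc η 1)).prod (volume.restrict U)) := by
    refine ⟨hJm, ?_⟩
    rw [hasFiniteIntegral_iff_enorm, lintegral_prod_symm _ hJm.enorm]
    refine lt_of_le_of_lt (lintegral_mono fun x => ?_) hfin
    have hm : Measurable fun t => ‖H (t, x)‖ₑ :=
      (hH.comp (measurable_id.prodMk measurable_const)).enorm
    rw [← lintegral_mul_const _ hm]
    refine lintegral_mono fun t => ?_
    rw [← ofReal_norm, ← ofReal_norm, ← ofReal_norm, ← ENNReal.ofReal_mul (norm_nonneg _)]
    exact ENNReal.ofReal_le_ofReal (norm_inner_le_norm _ _)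
  have e2 : ∀ t ∈ Ioc η 1, ∫ x in U, inner ℝ (kernelIntegrand U x₀ γ χ x y t) (v x)
      = ∫ x in U, inner ℝ (H (t, x)) (v x) := fun t ht => by simp_rw [he t (hsub ht)]
  constructor
  · rw [intervalIntegrable_iff_integrableOn_Ioc_of_le hη.2]
    refine hJ.integral_prod_left.congr ?_
    exact (ae_restrict_iff' measurableSet_Ioc).2
      (Filter.Eventually.of_forall fun t ht => (e2 t ht).symm)
  · rw [intervalIntegral.integral_of_le hη.2, setIntegral_congr_fun measurableSet_Ioc e2,
      integral_integral_swap hJ]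
    refine integral_congr_ae ?_
    have hae := ae_lt_top' (hHm.aemeasurable.mul hv.enorm) hfin.ne
    filter_upwards [hae] with x hx
    -- Finiteness of the product gives time integrability of the kernel only where v does not
    -- vanish; elsewhere both sides are zero.
    by_cases hvx : v x = 0
    · simp [hvx]
    have hi : Integrable (fun t => H (t, x)) (volume.restrict (Ioc η 1)) := by
      refine ⟨(hH.comp (measurable_id.prodMk measurable_const)).aestronglyMeasurable, ?_⟩
      rw [hasFiniteIntegral_iff_enorm]
      exact ENNReal.lt_top_of_mul_ne_top_left hx.ne (by simpa using hvx)
    simp_rw [real_inner_comm (v x)]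
    rw [integral_inner hi, intervalIntegral.integral_of_le hη.2,
      setIntegral_congr_fun measurableSet_Ioc fun t ht => (he t (hsub ht) x).symm]

theorem tubeMean_sub_eq (h : IsPath U x₀ γ y L) {χ : Rn n → ℝ} {s B : ℝ}
    (hχ : IsMollifier χ x₀ s B) (h15 : 15 * s ≤ bdist U x₀) {g : Rn n → ℝ} {v : Rn n → Rn n}
    (hgc : ContinuousOn g U) (hw : IsWeakGradient U g v) {p q : ℝ} (hp : 0 ≤ p) (hpq : p ≤ q)
    (hq : q ≤ 1) (h0 : ∀ t ∈ Icc p q, 0 < radiusFn U x₀ γ t y) :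
    tubeMean χ x₀ s g (γ q y) (radiusFn U x₀ γ q y) -
        tubeMean χ x₀ s g (γ p y) (radiusFn U x₀ γ p y) =
      ∫ t in p..q, ∫ x in U, inner ℝ (kernelIntegrand U x₀ γ χ x y t) (v x) := by
  obtain ⟨R, hR⟩ := h.lipschitzOnWith_radiusFn
  have hsub : Icc p q ⊆ Icc (0 : ℝ) 1 := Icc_subset_Icc hp hq
  exact tubeMean_sub_eq_integral h.isOpen hgc hw hχ.contDiff hχ.tsupport_subset hpq
    (h.lipschitz.mono hsub) (hR.mono hsub) h0
    fun t ht => h.closedBall_subset hχ.pos.le h15 (hsub ht)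

theorem continuousOn_tubeMean (h : IsPath U x₀ γ y L) {χ : Rn n → ℝ} {s B : ℝ}
    (hχ : IsMollifier χ x₀ s B) (h15 : 15 * s ≤ bdist U x₀) {g : Rn n → ℝ}
    (hgc : ContinuousOn g U) :
    ContinuousOn (fun t => tubeMean χ x₀ s g (γ t y) (radiusFn U x₀ γ t y)) (Icc 0 1) := by
  obtain ⟨R, hR⟩ := h.lipschitzOnWith_radiusFn
  exact _root_.continuousOn_tubeMean hχ.contDiff.continuous hgc h.continuousOn hR.continuousOn
    fun t ht w hw => h.add_smul_mem hχ.pos.le h15 ht hw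

/-- The exceptional set is the zero set of ρ. There the mean of g has the constant value g(y) ∫ χ
and the integrand is zero, as `sub_eq_integral_of_forall_avoiding` requires. -/
theorem integral_inner_kernel_of_hit (h : IsPath U x₀ γ y L) (hn : 1 ≤ n) {χ : Rn n → ℝ}
    {s B : ℝ} (hχ : IsMollifier χ x₀ s B) (h15 : 15 * s ≤ bdist U x₀) {g : Rn n → ℝ}
    {v : Rn n → Rn n} (hgc : ContinuousOn g U) (hw : IsWeakGradient U g v)
    (hfin : ∫⁻ x in U, (∫⁻ t in Ioc 0 1, ‖kernelIntegrand U x₀ γ χ x y t‖ₑ) * ‖v x‖ₑ < ⊤) :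
    ∫ x in U, inner ℝ (kernel U x₀ γ χ x y) (v x)
      = tubeMean χ x₀ s g x₀ 1 - g y * ∫ x, χ x := by
  obtain ⟨R, hR⟩ := h.lipschitzOnWith_radiusFn
  obtain ⟨hi, he⟩ := h.integral_inner_integral_kernelIntegrand hχ
    (hw.2.1.aestronglyMeasurable) (by simp : (0 : ℝ) ∈ Icc (0 : ℝ) 1) hfin
  set F : ℝ → ℝ := fun t => tubeMean χ x₀ s g (γ t y) (radiusFn U x₀ γ t y) with hF
  have hF1 : F 1 = tubeMean χ x₀ s g x₀ 1 := by rw [hF]; simp only [h.finish, h.radiusFn_one]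
  have hF0 : ∀ t ∈ Icc (0 : ℝ) 1, radiusFn U x₀ γ t y = 0 → F t = g y * ∫ x, χ x :=
    fun t ht h0 => by
      simp only [hF]
      rw [h0, h.eq_of_radiusFn_eq_zero ht h0, tubeMean_zero hχ.tsupport_subset]
  have key := sub_eq_integral_of_forall_avoiding (F := F) zero_le_one
    (Z := Icc 0 1 ∩ (fun t => radiusFn U x₀ γ t y) ⁻¹' {0})
    (hR.continuousOn.preimage_isClosed_of_isClosed isClosed_Icc isClosed_singleton) hi
    (fun p q hp hpq hq hd => h.tubeMean_sub_eq hχ h15 hgc hw hp hpq hq fun t ht => by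
      have htI : t ∈ Icc (0 : ℝ) 1 := ⟨hp.trans ht.1, ht.2.trans hq⟩
      refine (h.radiusFn_nonneg htI.1).lt_of_ne fun h0 => ?_
      exact disjoint_left.1 hd ht ⟨htI, h0.symm⟩)
    (h.continuousOn_tubeMean hχ h15 hgc) (fun t ht => hF0 t ht.2 ht.1.2)
    (fun t ht => by
      have h0 : radiusFn U x₀ γ t y = 0 := ht.1.2
      simp [kernelIntegrand_eq_tubeField, h0, tubeField_zero_radius hn])
  rw [hF1, hF0 0 (by simp) h.radiusFn_zero] at key
  rw [key, ← he]
  rfl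

/-- On [η, 1] the radius is at least η, so the integrand is bounded and supported in a compact tube
in U, where v is integrable. -/
theorem lintegral_truncated_lt_top (h : IsPath U x₀ γ y L) {χ : Rn n → ℝ}
    {s B : ℝ} (hχ : IsMollifier χ x₀ s B) (h15 : 15 * s ≤ bdist U x₀)
    {v : Rn n → Rn n} (hv : LocallyIntegrableOn v U)
    (hh : ¬(hitSet U γ y).Nonempty) {η : ℝ} (hη : η ∈ Ioc (0 : ℝ) 1) :
    ∫⁻ x in U, (∫⁻ t in Ioc η 1, ‖kernelIntegrand U x₀ γ χ x y t‖ₑ) * ‖v x‖ₑ < ⊤ := by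
  have hB := hχ.bound_nonneg
  have hs := hχ.pos
  have hη0 := hη.1
  have hpos : ∀ t ∈ Icc η 1, 0 < radiusFn U x₀ γ t y := fun t ht => by
    rw [radiusFn_of_not_hit hh]; exact hη.1.trans_le ht.1
  obtain ⟨R, hR⟩ := h.lipschitzOnWith_radiusFn
  have hsub : Icc η 1 ⊆ Icc (0 : ℝ) 1 := Icc_subset_Icc_left hη.1.le
  obtain ⟨A, hAc, hAU, hA⟩ : ∃ A : Set (Rn n), IsCompact A ∧ A ⊆ U ∧ ∀ t ∈ Icc η 1, ∀ x,
      ‖x - γ t y‖ ≤ s * radiusFn U x₀ γ t y → x ∈ A := by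
    refine ⟨_, isCompact_tube s (h.continuousOn.mono hsub) (hR.continuousOn.mono hsub), ?_,
      fun t ht x hx => ?_⟩
    · rintro _ ⟨⟨t, w⟩, ⟨ht, hw⟩, rfl⟩
      exact h.add_smul_mem hs.le h15 (hsub ht) hw
    · exact mem_tube (c := fun u => γ u y) (ρ := fun u => radiusFn U x₀ γ u y)
          ht (hpos t ht) hx
  obtain ⟨k, hk, hz⟩ : ∃ k : ℝ≥0∞, k ≠ ⊤ ∧ ∀ t ∈ Ioo η 1, ∀ x,
      ‖kernelIntegrand U x₀ γ χ x y t‖ₑ ≤ A.indicator (fun _ => k) x := by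
    refine ⟨ENNReal.ofReal (B * (η ^ n)⁻¹ * (s + L)), ENNReal.ofReal_ne_top, fun t ht x => ?_⟩
    by_cases hx : x ∈ A
    · rw [indicator_of_mem hx, ← ofReal_norm]
      refine ENNReal.ofReal_le_ofReal ((h.norm_kernelIntegrand_le_of_not_hit hχ hh
        ⟨hη.1.trans ht.1, ht.2⟩ x).trans ?_)
      have := ht.1.le
      gcongr
    · rw [kernelIntegrand_eq_tubeField, hχ.tubeField_eq_zero (hpos t (Ioo_subset_Icc_self ht)),
        enorm_zero]
      · exact zero_le
      · exact lt_of_not_ge fun hle => hx (hA t (Ioo_subset_Icc_self ht) x hle)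
  have h1 : ∀ x, ∫⁻ t in Ioc η 1, ‖kernelIntegrand U x₀ γ χ x y t‖ₑ
      ≤ A.indicator (fun _ => k) x := fun x => by
    rw [setLIntegral_congr Ioo_ae_eq_Ioc.symm]
    refine (setLIntegral_mono' measurableSet_Ioo fun t ht => hz t ht x).trans ?_
    rw [setLIntegral_const, Real.volume_Ioo]
    refine mul_le_of_le_one_right zero_le ?_
    rw [ENNReal.ofReal_le_one]; linarith
  calc ∫⁻ x in U, (∫⁻ t in Ioc η 1, ‖kernelIntegrand U x₀ γ χ x y t‖ₑ) * ‖v x‖ₑ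
      ≤ ∫⁻ x in U, A.indicator (fun x => k * ‖v x‖ₑ) x := by
        refine lintegral_mono fun x => ?_
        refine (mul_le_mul_left (h1 x) _).trans (le_of_eq ?_)
        by_cases hx : x ∈ A <;> simp [hx]
    _ ≤ ∫⁻ x in A, k * ‖v x‖ₑ := by
        rw [← lintegral_indicator hAc.measurableSet]
        exact setLIntegral_le_lintegral _ _
    _ = k * ∫⁻ x in A, ‖v x‖ₑ := lintegral_const_mul' _ _ hk
    _ < ⊤ := ENNReal.mul_lt_top hk.lt_top
        (hv.integrableOn_compact_subset hAU hAc).2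

theorem integral_inner_truncated (h : IsPath U x₀ γ y L) {χ : Rn n → ℝ}
    {s B : ℝ} (hχ : IsMollifier χ x₀ s B) (h15 : 15 * s ≤ bdist U x₀) {g : Rn n → ℝ}
    {v : Rn n → Rn n} (hgc : ContinuousOn g U) (hw : IsWeakGradient U g v)
    (hh : ¬(hitSet U γ y).Nonempty) {η : ℝ} (hη : η ∈ Ioc (0 : ℝ) 1) :
    ∫ x in U, inner ℝ (∫ t in η..1, kernelIntegrand U x₀ γ χ x y t) (v x) =
      tubeMean χ x₀ s g x₀ 1 - tubeMean χ x₀ s g (γ η y) (radiusFn U x₀ γ η y) := by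
  have hpos : ∀ t ∈ Icc η 1, 0 < radiusFn U x₀ γ t y := fun t ht => by
    rw [radiusFn_of_not_hit hh]; exact hη.1.trans_le ht.1
  have key := h.tubeMean_sub_eq hχ h15 hgc hw hη.1.le hη.2 le_rfl hpos
  rw [h.finish, h.radiusFn_one] at key
  rw [key]
  exact (h.integral_inner_integral_kernelIntegrand hχ hw.2.1.aestronglyMeasurable
    ⟨hη.1.le, hη.2⟩ (h.lintegral_truncated_lt_top hχ h15 hw.2.1 hh hη)).2

/-- The hypothesis `hC` controls the time integral and not the integral of the absolute value, so
Fubini is not applied on all of (0, 1]. The identity is taken for truncations and passed to the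
limit with C |x - y|^(1-n) |v| as dominating function. -/
theorem integral_inner_kernel_of_not_hit (h : IsPath U x₀ γ y L) {χ : Rn n → ℝ}
    {s B : ℝ} (hχ : IsMollifier χ x₀ s B) (h15 : 15 * s ≤ bdist U x₀) {g : Rn n → ℝ}
    {v : Rn n → Rn n} (hgc : ContinuousOn g U) (hw : IsWeakGradient U g v)
    (hh : ¬(hitSet U γ y).Nonempty) (hn : 1 ≤ n) {C : ℝ≥0} (hC : ∀ x, x ≠ y → ∀ η ∈ Ioc (0 : ℝ) 1,
      ‖∫ t in η..1, kernelIntegrand U x₀ γ χ x y t‖ₑ ≤ C * ‖x - y‖ₑ ^ (1 - (n : ℤ)))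
    (hfin : ∫⁻ x in U, ‖x - y‖ₑ ^ (1 - (n : ℤ)) * ‖v x‖ₑ < ⊤) :
    ∫ x in U, inner ℝ (kernel U x₀ γ χ x y) (v x)
      = tubeMean χ x₀ s g x₀ 1 - g y * ∫ x, χ x := by
  have : Nonempty (Fin n) := ⟨⟨0, hn⟩⟩
  have hv := hw.2.1.aestronglyMeasurable
  set η : ℕ → ℝ := fun k => 1 / ((k : ℝ) + 1)
  have hη : ∀ k, η k ∈ Ioc (0 : ℝ) 1 := fun k => by
    have : (0 : ℝ) ≤ k := Nat.cast_nonneg k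
    refine ⟨by positivity, ?_⟩
    rw [div_le_one (by positivity)]; linarith
  have hη0 : Filter.Tendsto η Filter.atTop (𝓝[Icc 0 1] 0) := by
    rw [tendsto_nhdsWithin_iff]
    exact ⟨tendsto_one_div_add_atTop_nhds_zero_nat,
      Filter.Eventually.of_forall fun k => Ioc_subset_Icc_self (hη k)⟩
  have hF := (h.continuousOn_tubeMean hχ h15 hgc) 0 (by simp)
  have hlim1 : Filter.Tendsto (fun k => tubeMean χ x₀ s g x₀ 1 -
      tubeMean χ x₀ s g (γ (η k) y) (radiusFn U x₀ γ (η k) y)) Filter.atTop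
      (𝓝 (tubeMean χ x₀ s g x₀ 1 - g y * ∫ x, χ x)) := by
    refine tendsto_const_nhds.sub ?_
    have := hF.tendsto.comp hη0
    rwa [h.radiusFn_zero, h.start, tubeMean_zero hχ.tsupport_subset] at this
  obtain ⟨H, hH, he⟩ := h.exists_measurable_kernelIntegrand hχ
  have hne : ∀ᵐ x ∂volume.restrict U, x ≠ y :=
    ae_restrict_of_ae (by simp [ae_iff, measure_singleton])
  have hlim2 : Filter.Tendsto
      (fun k => ∫ x in U, inner ℝ (∫ t in (η k)..1, kernelIntegrand U x₀ γ χ x y t) (v x))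
      Filter.atTop (𝓝 (∫ x in U, inner ℝ (kernel U x₀ γ χ x y) (v x))) := by
    refine tendsto_integral_of_dominated_convergence
      (fun x => (C * (‖x - y‖ₑ ^ (1 - (n : ℤ)) * ‖v x‖ₑ)).toReal) (fun k => ?_) ?_ (fun k => ?_) ?_
    · refine AEStronglyMeasurable.inner ?_ hv
      have e1 : ∀ x, ∫ t in (η k)..1, kernelIntegrand U x₀ γ χ x y t
          = ∫ t in Ioc (η k) 1, H (t, x) := fun x => by
        rw [intervalIntegral.integral_of_le (hη k).2]
        exact setIntegral_congr_fun measurableSet_Ioc fun t ht =>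
          (he t ⟨(hη k).1.le.trans ht.1.le, ht.2⟩ x).symm
      simp_rw [e1]
      exact (hH.stronglyMeasurable.integral_prod_left'
        (μ := volume.restrict (Ioc (η k) 1))).aestronglyMeasurable
    · refine integrable_toReal_of_lintegral_ne_top ?_ ?_
      · refine AEMeasurable.const_mul (AEMeasurable.mul ?_ hv.enorm) _
        exact ((measurable_id.sub_const y).enorm.pow_const _).aemeasurable
      · rw [lintegral_const_mul' _ _ ENNReal.coe_ne_top]
        exact (ENNReal.mul_lt_top ENNReal.coe_lt_top hfin).ne
    · filter_upwards [hne] with x hx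
      have h1 := hC x hx (η k) (hη k)
      have h2 : C * (‖x - y‖ₑ ^ (1 - (n : ℤ)) * ‖v x‖ₑ) ≠ ⊤ := by
        refine ENNReal.mul_ne_top ENNReal.coe_ne_top (ENNReal.mul_ne_top ?_ enorm_ne_top)
        exact (ENNReal.zpow_lt_top (by simpa [sub_eq_zero] using hx) enorm_ne_top _).ne
      rw [← ENNReal.ofReal_le_iff_le_toReal h2, ofReal_norm]
      calc ‖inner ℝ (∫ t in (η k)..1, kernelIntegrand U x₀ γ χ x y t) (v x)‖ₑ
          ≤ ‖∫ t in (η k)..1, kernelIntegrand U x₀ γ χ x y t‖ₑ * ‖v x‖ₑ := by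
            rw [← ofReal_norm, ← ofReal_norm, ← ofReal_norm, ← ENNReal.ofReal_mul (norm_nonneg _)]
            exact ENNReal.ofReal_le_ofReal (norm_inner_le_norm _ _)
        _ ≤ C * ‖x - y‖ₑ ^ (1 - (n : ℤ)) * ‖v x‖ₑ := mul_le_mul_left h1 _
        _ = _ := mul_assoc _ _ _
    · filter_upwards [hne] with x hx
      have hi := h.integrableOn_kernelIntegrand_of_not_hit hχ hh hx
      refine Filter.Tendsto.inner ?_ tendsto_const_nhds
      have hii : IntervalIntegrable (kernelIntegrand U x₀ γ χ x y) volume 0 1 :=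
        (intervalIntegrable_iff_integrableOn_Ioc_of_le zero_le_one).2 hi
      have hc := intervalIntegral.continuousOn_primitive_interval
        (μ := volume) (f := kernelIntegrand U x₀ γ χ x y) (a := 0) (b := 1) (by
          rw [uIcc_of_le zero_le_one, integrableOn_Icc_iff_integrableOn_Ioc]
          exact hi)
      rw [uIcc_of_le zero_le_one] at hc
      have h0 := (hc 0 (by simp)).tendsto.comp hη0
      rw [intervalIntegral.integral_same] at h0
      have h1 := (tendsto_const_nhds (x := kernel U x₀ γ χ x y)).sub h0
      rw [sub_zero] at h1
      refine h1.congr fun k => ?_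
      have hk := Ioc_subset_Icc_self (hη k)
      have := intervalIntegral.integral_add_adjacent_intervals
        (hii.mono_set (c := 0) (d := η k) (by
          rw [uIcc_of_le zero_le_one, uIcc_of_le hk.1]; exact Icc_subset_Icc_right hk.2))
        (hii.mono_set (c := η k) (d := 1) (by
          rw [uIcc_of_le zero_le_one, uIcc_of_le hk.2]; exact Icc_subset_Icc_left hk.1))
      rw [kernel, ← this]
      simp
  refine tendsto_nhds_unique hlim2 (hlim1.congr fun k => ?_)
  exact (h.integral_inner_truncated hχ h15 hgc hw hh (hη k)).symm

end IsPath

end Identity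

/-! ### Uniform constants for a path system -/

section System

variable {n : ℕ}

theorem eVariationOn_Icc_le_of_lipschitzOnWith {c : ℝ → Rn n} {L : ℝ≥0}
    (hL : LipschitzOnWith L c (Icc 0 1)) : eVariationOn c (Icc 0 1) ≤ L := by
  refine (hL.comp_eVariationOn_le (g := (id : ℝ → ℝ)) (s := Icc 0 1) fun _ h => h).trans ?_
  have h2 := (monotone_id (α := ℝ)).monotoneOn (Icc 0 1) |>.eVariationOn_eq
    (left_mem_Icc.2 zero_le_one) (right_mem_Icc.2 zero_le_one)
  rw [inter_self] at h2
  simp [h2]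

theorem eVariationOn_lineMap_le (a b : Rn n) :
    eVariationOn (fun t : ℝ => AffineMap.lineMap a b t) (Icc 0 1) ≤ ‖b - a‖ₑ := by
  refine eVariationOn_Icc_le_of_lipschitzOnWith (L := ‖b - a‖₊)
    (LipschitzOnWith.of_dist_le_mul fun s _ t _ => ?_)
  rw [dist_lineMap_lineMap, dist_comm a b, dist_eq_norm b a, mul_comm]
  rfl

theorem geodesicDist_le_of_segment_subset {U : Set (Rn n)} {x₀ y : Rn n}
    (h : segment ℝ y x₀ ⊆ U) : geodesicDist U x₀ y ≤ ‖x₀ - y‖ₑ := by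
  refine (iInf₂_le (fun t : ℝ => AffineMap.lineMap y x₀ t) ⟨?_, fun t ht => h ?_, ?_, ?_⟩).trans
    (eVariationOn_lineMap_le y x₀)
  · exact AffineMap.lineMap_continuous.continuousOn
  · rw [segment_eq_image_lineMap]; exact ⟨t, ht, rfl⟩
  · simp
  · simp

theorem geodesicDist_le_of_norm_le {U : Set (Rn n)} {x₀ y : Rn n} (hy : y ∈ U) (hx₀ : 0 < bdist U x₀)
    (h : ‖y - x₀‖ ≤ bdist U x₀) : geodesicDist U x₀ y ≤ ENNReal.ofReal (bdist U x₀) := by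
  have h1 : segment ℝ y x₀ ⊆ U := by
    rw [segment_eq_image_lineMap]
    rintro _ ⟨t, ht, rfl⟩
    rcases ht.1.eq_or_lt with rfl | h0
    · simpa using hy
    refine mem_of_norm_sub_lt_bdist (x := x₀) ?_
    rw [← dist_eq_norm, dist_lineMap_right, dist_eq_norm, Real.norm_of_nonneg (by linarith [ht.2])]
    have := norm_nonneg (y - x₀)
    nlinarith [ht.2]
  refine (geodesicDist_le_of_segment_subset h1).trans ?_
  rw [← ofReal_norm, norm_sub_rev]
  exact ENNReal.ofReal_le_ofReal h

/-- A path system in an open set all of whose points have finite geodesic distance from `x₀`. -/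
structure IsRegularPathSystem (Ω U : Set (Rn n)) (x₀ : Rn n) (γ : ℝ → Rn n → Rn n) : Prop where
  system : IsPathSystem Ω U x₀ γ
  isOpen : IsOpen U
  compl_nonempty : Uᶜ.Nonempty
  isOpen_left : IsOpen Ω
  subset : Ω ⊆ U
  null : volume (U \ Ω) = 0
  rectifiable : ∀ y ∈ U, geodesicDist U x₀ y < ⊤

/-- The kernel is bounded by `C` times the majorant and reproduces `g` from its weak gradient, up to
an additive constant. -/
def IsKernelConstant (Ω U : Set (Rn n)) (x₀ : Rn n) (γ : ℝ → Rn n → Rn n) (χ : Rn n → ℝ) (s : ℝ)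
    (C : ℝ≥0) : Prop :=
  ∀ y ∈ Ω, (∀ x ∈ Ω, x ≠ y → IntervalIntegrable (kernelIntegrand U x₀ γ χ x y) volume 0 1 ∧
      ‖kernel U x₀ γ χ x y‖ₑ ≤ C * majorant U γ x y) ∧
    ∀ (g : Rn n → ℝ) (v : Rn n → Rn n), ContinuousOn g U → IsWeakGradient U g v →
      ∫⁻ x in Ω, majorant U γ x y * ‖v x‖ₑ < ⊤ →
      ∫ x in Ω, inner ℝ (kernel U x₀ γ χ x y) (v x)
        = tubeMean χ x₀ s g x₀ 1 - g y * ∫ x, χ x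

namespace IsRegularPathSystem

variable {Ω U : Set (Rn n)} {x₀ : Rn n} {γ : ℝ → Rn n → Rn n}

theorem restrict_eq (h : IsRegularPathSystem Ω U x₀ γ) :
    (volume.restrict U : Measure (Rn n)) = volume.restrict Ω := by
  refine (Measure.restrict_congr_set ?_).symm
  rw [ae_eq_set, sdiff_eq_empty.2 h.subset]
  exact ⟨measure_empty, h.null⟩

theorem exists_isPath (h : IsRegularPathSystem Ω U x₀ γ) : ∃ K : ℝ≥0, ∀ y ∈ U,
    IsPath U x₀ γ y (K * (geodesicDist U x₀ y).toNNReal) := by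
  obtain ⟨K, hK⟩ := h.system.length_le
  refine ⟨K, fun y hy => ⟨h.isOpen, h.compl_nonempty, h.system.mapsTo y hy, h.system.start y hy,
    h.system.finish y hy, fun s hs t ht => ?_⟩⟩
  have := (hK y hy).2 s hs t ht
  rwa [ENNReal.coe_mul, ENNReal.coe_toNNReal (h.rectifiable y hy).ne]

/-- The constant must not depend on y. For hitting paths it comes from the length bound in balls;
for the others, y lies within d̂(x₀) of x₀, so its geodesic distance and hence its Lipschitz
constant are bounded. -/
theorem exists_isKernelConstant (h : IsRegularPathSystem Ω U x₀ γ) (hn : 1 ≤ n) {χ : Rn n → ℝ}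
    {s B : ℝ} (hχ : IsMollifier χ x₀ s B) (h15 : 15 * s ≤ bdist U x₀) :
    ∃ C : ℝ≥0, IsKernelConstant Ω U x₀ γ χ s C := by
  have : Nonempty (Fin n) := ⟨⟨0, hn⟩⟩
  obtain ⟨K, hK⟩ := h.exists_isPath
  obtain ⟨A, hA⟩ := h.system.ahlfors
  obtain ⟨N, hN⟩ := exists_enorm_integral_le_of_not_hit hn hχ (K * (bdist U x₀).toNNReal)
  set H : ℝ≥0 := (2 * B * (2 * bdist U x₀) ^ n).toNNReal * A
  refine ⟨max H N, fun y hy => ?_⟩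
  have hp := hK y (h.subset hy)
  have hmaj : ∀ x, ‖x - y‖ₑ ^ (1 - (n : ℤ)) ≤ majorant U γ x y := fun x => le_self_add
  by_cases hh : (hitSet U γ y).Nonempty
  · have h1 : ∀ x ∈ Ω, x ≠ y → ∫⁻ t in Ioc 0 1, ‖kernelIntegrand U x₀ γ χ x y t‖ₑ ≤
        H * majorant U γ x y := fun x hx hxy => by
      have := hp.lintegral_kernelIntegrand_le_of_hit hn hχ h15 hh (h.subset hx) hxy
        (hA x hx y hy)
      simpa [H, ENNReal.ofReal] using this
    have hmt : ∀ x ∈ Ω, x ≠ y → majorant U γ x y < ⊤ := fun x hx hxy => by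
      refine ENNReal.add_lt_top.2 ⟨ENNReal.zpow_lt_top (by simpa [sub_eq_zero] using hxy)
        enorm_ne_top _, ?_⟩
      refine lt_of_le_of_lt (indicator_le_self' (by simp) _) (ENNReal.zpow_lt_top ?_
        ENNReal.ofReal_ne_top _)
      simpa using bdist_pos h.isOpen h.compl_nonempty (h.subset hx)
    refine ⟨fun x hx hxy => ⟨?_, ?_⟩, fun g v hgc hw hfin => ?_⟩
    · rw [intervalIntegrable_iff_integrableOn_Ioc_of_le zero_le_one]
      exact ⟨hp.aestronglyMeasurable_kernelIntegrand hχ x,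
        (h1 x hx hxy).trans_lt (ENNReal.mul_lt_top ENNReal.coe_lt_top (hmt x hx hxy))⟩
    · rw [kernel, intervalIntegral.integral_of_le zero_le_one]
      refine (enorm_integral_le_lintegral_enorm _).trans ((h1 x hx hxy).trans ?_)
      gcongr
      exact le_max_left _ _
    · rw [← h.restrict_eq]
      refine hp.integral_inner_kernel_of_hit hn hχ h15 hgc hw ?_
      rw [h.restrict_eq]
      have hne : ∀ᵐ x ∂volume.restrict Ω, x ≠ y :=
        ae_restrict_of_ae (by simp [ae_iff, measure_singleton])
      calc ∫⁻ x in Ω, (∫⁻ t in Ioc 0 1, ‖kernelIntegrand U x₀ γ χ x y t‖ₑ) * ‖v x‖ₑ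
          ≤ ∫⁻ x in Ω, H * (majorant U γ x y * ‖v x‖ₑ) := by
            refine lintegral_mono_ae ?_
            filter_upwards [hne, ae_restrict_mem h.isOpen_left.measurableSet] with x hx hxΩ
            rw [← mul_assoc]
            exact mul_le_mul_left (h1 x hxΩ hx) _
        _ = H * ∫⁻ x in Ω, majorant U γ x y * ‖v x‖ₑ :=
            lintegral_const_mul' _ _ ENNReal.coe_ne_top
        _ < ⊤ := ENNReal.mul_lt_top ENNReal.coe_lt_top hfin
  · have hL : K * (geodesicDist U x₀ y).toNNReal ≤ K * (bdist U x₀).toNNReal := by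
      refine mul_le_mul_right ?_ _
      exact ENNReal.toNNReal_mono ENNReal.coe_ne_top (geodesicDist_le_of_norm_le (h.subset hy)
        hp.pos_finish (hp.bdist_finish_le_of_not_hit hh).2.2)
    have hN' := hN hp hh hL
    refine ⟨fun x hx hxy => ?_, fun g v hgc hw hfin => ?_⟩
    · have hi : IntervalIntegrable (kernelIntegrand U x₀ γ χ x y) volume 0 1 := by
        rw [intervalIntegrable_iff_integrableOn_Ioc_of_le zero_le_one]
        exact hp.integrableOn_kernelIntegrand_of_not_hit hχ hh hxy
      refine ⟨hi, ?_⟩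
      have h2 : ‖kernel U x₀ γ χ x y‖ₑ ≤ N * ‖x - y‖ₑ ^ (1 - (n : ℤ)) := by
        have hc : ContinuousOn (fun η => ∫ t in η..1, kernelIntegrand U x₀ γ χ x y t)
            (Icc 0 1) := by
          have := intervalIntegral.continuousOn_primitive_interval_left
            (μ := volume) (f := kernelIntegrand U x₀ γ χ x y) (a := 0) (b := 1)
            (by rw [uIcc_of_le zero_le_one]
                exact (integrableOn_Icc_iff_integrableOn_Ioc).2 hi.1)
          rwa [uIcc_of_le zero_le_one] at this
        have ht : Filter.Tendsto (fun η => ∫ t in η..1, kernelIntegrand U x₀ γ χ x y t)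
            (𝓝[Ioc 0 1] 0) (𝓝 (kernel U x₀ γ χ x y)) :=
          (hc 0 (by simp)).mono Ioc_subset_Icc_self
        have : (𝓝[Ioc (0 : ℝ) 1] 0).NeBot := by
          rw [← mem_closure_iff_nhdsWithin_neBot, closure_Ioc zero_ne_one]; simp
        exact le_of_tendsto ht.enorm (eventually_nhdsWithin_of_forall fun η hη => hN' x hxy η hη)
      exact h2.trans (mul_le_mul' (by exact_mod_cast le_max_right _ _) (hmaj x))
    · rw [← h.restrict_eq] at hfin ⊢
      exact hp.integral_inner_kernel_of_not_hit hχ h15 hgc hw hh hn hN'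
        ((lintegral_mono fun x => mul_le_mul_left (hmaj x) _).trans_lt hfin)

end IsRegularPathSystem

end System

/-! ### Measurability of hitting times, radius function and kernel -/

section Measurability

variable {n : ℕ}

/-- Compactness and density replace an uncountable union over times by countable operations. -/
theorem exists_le_zero_iff_forall_exists_denseSeq {X : Type*} [TopologicalSpace X] [CompactSpace X]
    [TopologicalSpace.SeparableSpace X] [Nonempty X] {f : X → ℝ} (hf : Continuous f) :
    (∃ t, f t ≤ 0) ↔ ∀ k : ℕ, ∃ i : ℕ, f (TopologicalSpace.denseSeq X i) < 1 / ((k : ℝ) + 1) := by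
  constructor
  · rintro ⟨t, ht⟩ k
    have hk : (0 : ℝ) < 1 / ((k : ℝ) + 1) := by positivity
    exact (TopologicalSpace.denseRange_denseSeq X).exists_mem_open
      (isOpen_lt hf continuous_const) ⟨t, ht.trans_lt hk⟩
  · intro h
    obtain ⟨t, -, ht⟩ := isCompact_univ.exists_isMinOn univ_nonempty hf.continuousOn
    refine ⟨t, le_of_forall_pos_le_add fun ε hε => ?_⟩
    obtain ⟨k, hk⟩ := exists_nat_one_div_lt hε
    obtain ⟨i, hi⟩ := h k
    have := ht (mem_univ (TopologicalSpace.denseSeq X i))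
    simp only [mem_ofPred_eq] at this
    linarith

theorem measurableSet_exists_mem_Icc_le_zero {α : Type*} [MeasurableSpace α] {f : ℝ → α → ℝ} {a b : ℝ}
    (hab : a ≤ b) (hm : ∀ t ∈ Icc a b, Measurable (f t))
    (hc : ∀ x, ContinuousOn (fun t => f t x) (Icc a b)) :
    MeasurableSet {x | ∃ t ∈ Icc a b, f t x ≤ 0} := by
  have : Nonempty (Icc a b) := ⟨⟨a, left_mem_Icc.2 hab⟩⟩
  have e : {x | ∃ t ∈ Icc a b, f t x ≤ 0} = ⋂ k : ℕ, ⋃ i : ℕ,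
      {x | f (TopologicalSpace.denseSeq (Icc a b) i : ℝ) x < 1 / ((k : ℝ) + 1)} := by
    ext x
    have := exists_le_zero_iff_forall_exists_denseSeq
      (f := fun t : Icc a b => f t x) ((hc x).domRestrict)
    simp only [mem_iInter, mem_iUnion, mem_ofPred_eq]
    rw [← this]
    simp
  rw [e]
  exact MeasurableSet.iInter fun k => MeasurableSet.iUnion fun i =>
    measurableSet_lt (hm _ (Subtype.coe_prop _)) measurable_const

/-- A jointly measurable family of curves, every one of them starting at its label. -/
structure IsMeasurableFamily (γ : ℝ → Rn n → Rn n) : Prop where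
  measurable : Measurable (Function.uncurry γ)
  continuousOn : ∀ y, ContinuousOn (fun t => γ t y) (Icc 0 1)
  start : ∀ y, γ 0 y = y

open Classical in
/-- A path system, extended by constant curves outside `U` and constantly in time. -/
def extendFamily (U : Set (Rn n)) (γ : ℝ → Rn n → Rn n) (t : ℝ) (y : Rn n) : Rn n :=
  if y ∈ U then γ (projIcc (0 : ℝ) 1 zero_le_one t) y else y

theorem extendFamily_of_mem {U : Set (Rn n)} (γ : ℝ → Rn n → Rn n) {t : ℝ} {y : Rn n}
    (ht : t ∈ Icc (0 : ℝ) 1) (hy : y ∈ U) : extendFamily U γ t y = γ t y := by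
  rw [extendFamily, if_pos hy, projIcc_of_mem zero_le_one ht]

variable {Ω U : Set (Rn n)} {x₀ : Rn n} {γ : ℝ → Rn n → Rn n}

theorem IsRegularPathSystem.isMeasurableFamily (h : IsRegularPathSystem Ω U x₀ γ) :
    IsMeasurableFamily (extendFamily U γ) := by
  obtain ⟨K, hK⟩ := h.exists_isPath
  refine ⟨?_, fun y => ?_, fun y => ?_⟩
  · classical
    refine measurable_of_restrict_of_restrict_compl (s := Prod.snd ⁻¹' U)
      (measurable_snd h.isOpen.measurableSet) ?_ ?_
    · have : Measurable fun p : (Prod.snd ⁻¹' U : Set (ℝ × Rn n)) =>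
          ((projIcc (0 : ℝ) 1 zero_le_one p.1.1, ⟨p.1.2, p.2⟩) : Icc (0 : ℝ) 1 × U) :=
        (continuous_projIcc.measurable.comp (measurable_fst.comp measurable_subtype_coe)).prodMk
          ((measurable_snd.comp measurable_subtype_coe).subtype_mk)
      convert h.system.measurable.comp this using 1
      exact funext fun p => if_pos p.2
    · convert measurable_snd.comp measurable_subtype_coe using 1
      exact funext fun p => if_neg p.2
  · by_cases hy : y ∈ U
    · exact (hK y hy).continuousOn.congr fun t ht => extendFamily_of_mem γ ht hy
    · simp only [extendFamily, if_neg hy]; exact continuousOn_const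
  · by_cases hy : y ∈ U
    · rw [extendFamily_of_mem γ (by simp) hy, h.system.start y hy]
    · rw [extendFamily, if_neg hy]

theorem measurable_bdist (U : Set (Rn n)) : Measurable (bdist U) := (continuous_bdist U).measurable

theorem measurableSet_exists_norm_sub_le (hγ : IsMeasurableFamily γ) (U : Set (Rn n)) :
    MeasurableSet {p : Rn n × Rn n | ∃ t ∈ Icc (0 : ℝ) 1, ‖γ t p.2 - p.1‖ ≤ bdist U p.1 / 2} := by
  have := measurableSet_exists_mem_Icc_le_zero (f := fun t (p : Rn n × Rn n) =>
    ‖γ t p.2 - p.1‖ - bdist U p.1 / 2) zero_le_one (fun t _ => ?_) fun p => ?_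
  · simpa only [sub_nonpos] using this
  · refine ((Measurable.sub ?_ measurable_fst).norm).sub
      (((measurable_bdist U).comp measurable_fst).div_const 2)
    exact hγ.measurable.comp (measurable_const.prodMk measurable_snd)
  · exact (((hγ.continuousOn p.2).sub continuousOn_const).norm).sub continuousOn_const

namespace IsMeasurableFamily

/-- By the intermediate value theorem, meeting the sphere by time t is the same as having reached at
least its radius. The inequality is the form needed for `measurableSet_exists_mem_Icc_le_zero`. -/
theorem mem_hitSet_iff (hγ : IsMeasurableFamily γ) (U : Set (Rn n)) (y : Rn n) {t : ℝ}
    (ht : t ∈ Icc (0 : ℝ) 1) : (∃ u ∈ hitSet U γ y, u ≤ t) ↔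
      ∃ u ∈ Icc 0 t, bdist U y / 2 - ‖γ u y - y‖ ≤ 0 := by
  constructor
  · rintro ⟨u, ⟨hu, h⟩, hut⟩
    rw [mem_sphere_iff_norm] at h
    exact ⟨u, ⟨hu.1, hut⟩, by rw [h, sub_self]⟩
  · rintro ⟨u, hu, h⟩
    have hc : ContinuousOn (fun t => ‖γ t y - y‖) (Icc 0 u) :=
      (((hγ.continuousOn y).sub continuousOn_const).norm).mono
        (Icc_subset_Icc_right (hu.2.trans ht.2))
    have h0 : bdist U y / 2 ∈ Icc (‖γ 0 y - y‖) ‖γ u y - y‖ := by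
      rw [hγ.start, sub_self, norm_zero]
      exact ⟨div_nonneg (bdist_nonneg U y) two_pos.le, by linarith⟩
    obtain ⟨w, hw, he⟩ := intermediate_value_Icc hu.1 hc h0
    exact ⟨w, ⟨⟨hw.1, hw.2.trans (hu.2.trans ht.2)⟩, mem_sphere_iff_norm.2 he⟩, hw.2.trans hu.2⟩

theorem measurableSet_hit_le (hγ : IsMeasurableFamily γ) (U : Set (Rn n)) {t : ℝ}
    (ht : t ∈ Icc (0 : ℝ) 1) : MeasurableSet {y | ∃ u ∈ hitSet U γ y, u ≤ t} := by
  simp_rw [hγ.mem_hitSet_iff U _ ht]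
  refine measurableSet_exists_mem_Icc_le_zero ht.1 (fun u hu => ?_) fun y => ?_
  · refine ((measurable_bdist U).div_const 2).sub (Measurable.norm (Measurable.sub ?_ measurable_id))
    exact hγ.measurable.comp (measurable_const.prodMk measurable_id)
  · exact continuousOn_const.sub ((((hγ.continuousOn y).mono
      (Icc_subset_Icc_right ht.2)).sub continuousOn_const).norm)

theorem measurableSet_hit (hγ : IsMeasurableFamily γ) (U : Set (Rn n)) :
    MeasurableSet {y | (hitSet U γ y).Nonempty} := by
  convert hγ.measurableSet_hit_le U (right_mem_Icc.2 zero_le_one) using 4 with y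
  exact ⟨fun ⟨u, hu⟩ => ⟨u, hu, hu.1.2⟩, fun ⟨u, hu, _⟩ => ⟨u, hu⟩⟩

theorem hitTime_mem (hγ : IsMeasurableFamily γ) {U : Set (Rn n)} {y : Rn n}
    (h : (hitSet U γ y).Nonempty) : hitTime U γ y ∈ hitSet U γ y := by
  refine IsClosed.csInf_mem ?_ h ⟨0, fun t ht => ht.1.1⟩
  exact (hγ.continuousOn y).preimage_isClosed_of_isClosed isClosed_Icc Metric.isClosed_sphere

theorem measurable_hitTime (hγ : IsMeasurableFamily γ) (U : Set (Rn n)) :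
    Measurable (hitTime U γ) := by
  -- Labels without a hit have hitting time 0, the infimum of the empty set of reals, so they belong
  -- to every sublevel set with t ≥ 0.
  have h0 : ∀ y, ¬(hitSet U γ y).Nonempty → hitTime U γ y = 0 := fun y hy => by
    rw [hitTime, not_nonempty_iff_eq_empty.1 hy, Real.sInf_empty]
  refine measurable_of_Iic fun t => ?_
  rcases lt_or_ge t 0 with ht | ht
  · convert MeasurableSet.empty
    refine eq_empty_of_forall_notMem fun y hy => ?_
    have hy : hitTime U γ y ≤ t := hy
    by_cases h : (hitSet U γ y).Nonempty
    · have := (hγ.hitTime_mem h).1.1; linarith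
    · rw [h0 y h] at hy; linarith
  · have ht' : min t 1 ∈ Icc (0 : ℝ) 1 := ⟨le_min ht zero_le_one, min_le_right _ _⟩
    convert (hγ.measurableSet_hit_le U ht').union (hγ.measurableSet_hit U).compl using 1
    ext y
    simp only [mem_preimage, mem_Iic, mem_union, mem_ofPred_eq, mem_compl_iff]
    by_cases h : (hitSet U γ y).Nonempty
    · simp only [h, not_true, or_false]
      constructor
      · exact fun hy => ⟨_, hγ.hitTime_mem h, le_min hy (hγ.hitTime_mem h).1.2⟩
      · rintro ⟨u, hu, hut⟩
        exact (csInf_le ⟨0, fun t ht => ht.1.1⟩ hu).trans (hut.trans (min_le_left _ _))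
    · simp [h, h0 y h, ht]

theorem measurable_radiusFn (hγ : IsMeasurableFamily γ) (U : Set (Rn n)) (x₀ : Rn n) :
    Measurable fun p : ℝ × Rn n => radiusFn U x₀ γ p.1 p.2 := by
  have hτ : Measurable fun p : ℝ × Rn n => hitTime U γ p.2 :=
    (hγ.measurable_hitTime U).comp measurable_snd
  have hg : Measurable fun p : ℝ × Rn n => γ p.1 p.2 := hγ.measurable
  have hgτ : Measurable fun p : ℝ × Rn n => γ (hitTime U γ p.2) p.2 :=
    hγ.measurable.comp (hτ.prodMk measurable_snd)
  unfold radiusFn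
  refine Measurable.ite (measurable_snd (hγ.measurableSet_hit U))
    (Measurable.ite (measurableSet_le measurable_fst hτ) ?_ ?_) measurable_fst
  · exact (measurable_const.mul (((measurable_bdist U).comp hgτ).div
      ((measurable_bdist U).comp measurable_snd))).mul (measurable_snd.sub hg).norm
  · exact ((measurable_bdist U).comp hg).div_const _

end IsMeasurableFamily

/-- The derivative, where it exists, is the limit of the difference quotients with steps 1/(k + 1),
and these are jointly measurable in time and label. -/
theorem exists_measurable_deriv {E : Type*} [NormedAddCommGroup E] [NormedSpace ℝ E]
    [CompleteSpace E] [SecondCountableTopology E] [MeasurableSpace E] [BorelSpace E]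
    {f : ℝ × Rn n → E} (hf : Measurable f) : ∃ D : ℝ × Rn n → E, Measurable D ∧
      ∀ t y f', HasDerivAt (fun u => f (u, y)) f' t → D (t, y) = f' := by
  classical
  have hm : ∀ k : ℕ, Measurable fun p : ℝ × Rn n =>
      ((k : ℝ) + 1) • (f (p.1 + 1 / ((k : ℝ) + 1), p.2) - f p) := fun k =>
    ((hf.comp ((measurable_fst.add_const _).prodMk measurable_snd)).sub hf).const_smul _
  refine ⟨fun p => Filter.limUnder Filter.atTop fun k : ℕ =>
    ((k : ℝ) + 1) • (f (p.1 + 1 / ((k : ℝ) + 1), p.2) - f p),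
    (StronglyMeasurable.limUnder fun k => (hm k).stronglyMeasurable).measurable, ?_⟩
  intro t y f' h
  refine Filter.Tendsto.limUnder_eq ?_
  have h1 := h.tendsto_slope_zero
  have h2 : Filter.Tendsto (fun k : ℕ => 1 / ((k : ℝ) + 1)) Filter.atTop (𝓝[≠] 0) := by
    rw [tendsto_nhdsWithin_iff]
    refine ⟨tendsto_one_div_add_atTop_nhds_zero_nat, Filter.Eventually.of_forall fun k => ?_⟩
    have : (0 : ℝ) < 1 / ((k : ℝ) + 1) := by positivity
    exact this.ne'
  refine (h1.comp h2).congr fun k => ?_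
  simp

theorem radiusFn_extendFamily (h : IsRegularPathSystem Ω U x₀ γ) {t : ℝ} (ht : t ∈ Icc (0 : ℝ) 1)
    {y : Rn n} (hy : y ∈ U) :
    radiusFn U x₀ (extendFamily U γ) t y = radiusFn U x₀ γ t y := by
  obtain ⟨K, hK⟩ := h.exists_isPath
  have hge : ∀ t ∈ Icc (0 : ℝ) 1, extendFamily U γ t y = γ t y :=
    fun t ht => extendFamily_of_mem γ ht hy
  have hhs : hitSet U (extendFamily U γ) y = hitSet U γ y := by
    ext t
    exact and_congr_right fun ht => by rw [hge t ht]
  have hht : hitTime U (extendFamily U γ) y = hitTime U γ y := by rw [hitTime, hhs, hitTime]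
  by_cases hh : (hitSet U γ y).Nonempty
  · have hh' : (hitSet U (extendFamily U γ) y).Nonempty := hhs ▸ hh
    rw [radiusFn, radiusFn, if_pos hh, if_pos hh', hht, hge t ht,
      hge _ ((hK y hy).hitTime_mem hh).1]
  · rw [radiusFn_of_not_hit hh, radiusFn_of_not_hit (hhs ▸ hh)]

theorem measurable_integral_tubeField {χ : Rn n → ℝ} (hχ : Measurable χ) (x₀ : Rn n)
    {c D : ℝ × Rn n → Rn n} {ρ E : ℝ × Rn n → ℝ} (hc : Measurable c) (hD : Measurable D)
    (hρ : Measurable ρ) (hE : Measurable E) :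
    Measurable fun p : Rn n × Rn n => ∫ t in Ioo (0 : ℝ) 1,
      tubeField χ x₀ (c (t, p.2)) (ρ (t, p.2)) (D (t, p.2)) (E (t, p.2)) p.1 := by
  have hq : Measurable fun q : ℝ × (Rn n × Rn n) => (q.1, q.2.2) :=
    measurable_fst.prodMk (measurable_snd.comp measurable_snd)
  have hJ : Measurable fun q : ℝ × (Rn n × Rn n) => tubeField χ x₀ (c (q.1, q.2.2))
      (ρ (q.1, q.2.2)) (D (q.1, q.2.2)) (E (q.1, q.2.2)) q.2.1 :=
    measurable_tubeField hχ x₀ (hc.comp hq) (hρ.comp hq) (hD.comp hq)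
      (hE.comp hq) (measurable_fst.comp measurable_snd)
  exact (hJ.stronglyMeasurable.integral_prod_left'
    (μ := volume.restrict (Ioo (0 : ℝ) 1))).measurable

theorem IsRegularPathSystem.exists_measurable_kernel (h : IsRegularPathSystem Ω U x₀ γ)
    {χ : Rn n → ℝ} (hχ : Measurable χ) : ∃ H : Rn n × Rn n → Rn n, Measurable H ∧
      ∀ y ∈ U, ∀ x, kernel U x₀ γ χ x y = H (x, y) := by
  obtain ⟨K, hK⟩ := h.exists_isPath
  have hγ := h.isMeasurableFamily
  have hρ := hγ.measurable_radiusFn U x₀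
  obtain ⟨D, hD, hDe⟩ := exists_measurable_deriv hγ.measurable
  obtain ⟨E, hE, hEe⟩ := exists_measurable_deriv hρ
  refine ⟨_, measurable_integral_tubeField hχ x₀ hγ.measurable hD hρ hE, fun y hy x => ?_⟩
  rw [kernel, intervalIntegral.integral_of_le zero_le_one,
    setIntegral_congr_set Ioo_ae_eq_Ioc.symm]
  refine setIntegral_congr_ae measurableSet_Ioo ?_
  filter_upwards [(hK y hy).ae_hasDerivAt] with t hd ht
  have hev : ∀ᶠ u in 𝓝 t, u ∈ Icc (0 : ℝ) 1 := Icc_mem_nhds ht.1 ht.2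
  have ht' := Ioo_subset_Icc_self ht
  have h1 := hDe t y _ ((hd ht).1.congr_of_eventuallyEq
    (hev.mono fun u hu => extendFamily_of_mem γ hu hy))
  have h2 := hEe t y _ ((hd ht).2.congr_of_eventuallyEq
    (hev.mono fun u hu => radiusFn_extendFamily h hu hy))
  rw [kernelIntegrand_eq_tubeField, h1, h2, Function.uncurry, extendFamily_of_mem γ ht' hy,
    radiusFn_extendFamily h ht' hy]

end Measurability

/-! ### The weight as a potential; its integrability and positivity -/

section Weight

variable {n : ℕ}

/-- In polar coordinates the factor r^(n-1) cancels r^(1-n). -/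
theorem lintegral_ball_enorm_zpow_lt_top (hn : 1 ≤ n) (R : ℝ) :
    ∫⁻ z in Metric.ball (0 : Rn n) R, ‖z‖ₑ ^ (1 - (n : ℤ)) < ⊤ := by
  have : Nonempty (Fin n) := ⟨⟨0, hn⟩⟩
  have h1 : IntegrableOn (fun z : Rn n => (‖z‖ ^ n)⁻¹ * ‖z‖) (Metric.ball 0 R) := by
    rw [integrableOn_fun_norm_addHaar volume (f := fun r : ℝ => (r ^ n)⁻¹ * r)]
    refine (integrableOn_const (C := (1 : ℝ)) (measure_Ioo_lt_top).ne).congr_fun (fun r hr => ?_)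
      measurableSet_Ioo
    have hr0 : r ≠ 0 := hr.1.ne'
    obtain ⟨k, rfl⟩ := Nat.exists_eq_add_of_le' hn
    simp only [finrank_euclideanSpace, Fintype.card_fin, smul_eq_mul, Nat.add_sub_cancel]
    field_simp
    ring
  refine lt_of_le_of_lt (lintegral_mono_ae ?_) h1.2
  have hne : ∀ᵐ z ∂volume.restrict (Metric.ball (0 : Rn n) R), z ≠ 0 :=
    ae_restrict_of_ae (by simp [ae_iff, measure_singleton])
  filter_upwards [hne] with z hz
  have hz' : 0 < ‖z‖ := norm_pos_iff.2 hz
  rw [← ofReal_norm z, ← ofReal_inv_pow_mul_self hz', ← ENNReal.ofReal_mul (by positivity),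
    ← ofReal_norm, Real.norm_of_nonneg (by positivity)]

theorem exists_lintegral_enorm_sub_zpow_le (hn : 1 ≤ n) {Ω : Set (Rn n)}
    (hΩ : Bornology.IsBounded Ω) : ∃ C : ℝ≥0, ∀ y ∈ Ω,
    ∫⁻ x in Ω, ‖x - y‖ₑ ^ (1 - (n : ℤ)) ≤ C := by
  obtain ⟨R, hR⟩ := hΩ.exists_pos_norm_lt
  refine ⟨(∫⁻ z in Metric.ball (0 : Rn n) (R + R), ‖z‖ₑ ^ (1 - (n : ℤ))).toNNReal,
    fun y hy => ?_⟩
  rw [ENNReal.coe_toNNReal (lintegral_ball_enorm_zpow_lt_top hn _).ne]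
  have h1 : ∀ x ∈ Ω, x ∈ Metric.ball y (R + R) := fun x hx => by
    rw [Metric.mem_ball, dist_eq_norm]
    exact (norm_sub_le _ _).trans_lt (add_lt_add (hR.2 x hx) (hR.2 y hy))
  refine (lintegral_mono_set h1).trans (le_of_eq ?_)
  rw [← lintegral_indicator Metric.isOpen_ball.measurableSet,
    ← lintegral_indicator Metric.isOpen_ball.measurableSet,
    ← lintegral_sub_right_eq_self (μ := volume) (f := (Metric.ball (0 : Rn n) (R + R)).indicator
      fun z => ‖z‖ₑ ^ (1 - (n : ℤ))) y]
  refine lintegral_congr fun x => ?_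
  by_cases hx : x ∈ Metric.ball y (R + R)
  · rw [indicator_of_mem hx, indicator_of_mem (by simpa [dist_eq_norm] using hx)]
  · rw [indicator_of_notMem hx, indicator_of_notMem (by simpa [dist_eq_norm] using hx)]

variable {Ω U : Set (Rn n)} {x₀ : Rn n} {γ : ℝ → Rn n → Rn n}

theorem IsMeasurableFamily.measurable_majorant (hγ : IsMeasurableFamily γ) (U : Set (Rn n)) :
    Measurable fun p : Rn n × Rn n => majorant U γ p.1 p.2 := by
  have hS := measurableSet_exists_norm_sub_le hγ U
  refine ((measurable_fst.sub measurable_snd).enorm.pow_const _).add ?_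
  have h1 : Measurable fun p : Rn n × Rn n => ENNReal.ofReal (bdist U p.1) ^ (1 - (n : ℤ)) :=
    (((measurable_bdist U).comp measurable_fst).ennreal_ofReal).pow_const _
  exact h1.indicator hS

theorem majorant_extendFamily {x y : Rn n} (hy : y ∈ U) :
    majorant U (extendFamily U γ) x y = majorant U γ x y := by
  have : y ∈ {y | ∃ t ∈ Icc (0 : ℝ) 1, ‖extendFamily U γ t y - x‖ ≤ bdist U x / 2} ↔
      y ∈ {y | ∃ t ∈ Icc (0 : ℝ) 1, ‖γ t y - x‖ ≤ bdist U x / 2} := by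
    simp only [mem_ofPred_eq]
    refine exists_congr fun t => and_congr_right fun ht => ?_
    rw [extendFamily_of_mem γ ht hy]
  unfold majorant
  congr 1
  by_cases hS : y ∈ {y | ∃ t ∈ Icc (0 : ℝ) 1, ‖γ t y - x‖ ≤ bdist U x / 2}
  · rw [indicator_of_mem hS, indicator_of_mem (this.2 hS)]
  · rw [indicator_of_notMem hS, indicator_of_notMem (mt this.1 hS)]

namespace IsRegularPathSystem

/-- In this form the weight is accessible to Fubini, with the extended family supplying joint
measurability. -/
theorem weight_eq_lintegral (h : IsRegularPathSystem Ω U x₀ γ) (μ₀ : Measure (Rn n)) (x : Rn n) :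
    weight Ω U γ μ₀ x = ∫⁻ y in Ω, majorant U (extendFamily U γ) x y ∂μ₀ := by
  have hS := measurableSet_exists_norm_sub_le h.isMeasurableFamily U
  have hSx : MeasurableSet
      {y | ∃ t ∈ Icc (0 : ℝ) 1, ‖extendFamily U γ t y - x‖ ≤ bdist U x / 2} :=
    measurable_prodMk_left (x := x) hS
  unfold majorant
  rw [lintegral_add_right _ (measurable_const.indicator hSx), lintegral_indicator hSx,
    setLIntegral_const, Measure.restrict_apply hSx, weight, rieszPot, omegaFn, mul_comm]
  congr 3
  ext y
  simp only [mem_ofPred_eq, mem_inter_iff]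
  rw [and_comm]
  refine and_congr_left fun hy => exists_congr fun t => and_congr_right fun ht => ?_
  rw [extendFamily_of_mem γ ht (h.subset hy)]

theorem measurable_weight (h : IsRegularPathSystem Ω U x₀ γ) (μ₀ : Measure (Rn n))
    [IsFiniteMeasure μ₀] : Measurable (weight Ω U γ μ₀) := by
  simp_rw [funext (h.weight_eq_lintegral μ₀)]
  exact (h.isMeasurableFamily.measurable_majorant U).lintegral_prod_right'

theorem _root_.weight_pos (hn : 1 ≤ n) (μ₀ : Measure (Rn n)) (h0 : μ₀ Ωᶜ = 0) (hne : μ₀ ≠ 0) (x : Rn n) :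
    0 < weight Ω U γ μ₀ x := by
  refine lt_of_lt_of_le ?_ (le_self_add : rieszPot Ω μ₀ x ≤ _)
  have hm : Measurable fun y : Rn n => ‖x - y‖ₑ ^ (1 - (n : ℤ)) :=
    (measurable_id.const_sub x).enorm.pow_const _
  have hpos : ∀ y : Rn n, 0 < ‖x - y‖ₑ ^ (1 - (n : ℤ)) := fun y => by
    obtain ⟨k, rfl⟩ := Nat.exists_eq_add_of_le' hn
    have : (1 : ℤ) - ((k + 1 : ℕ) : ℤ) = -(k : ℤ) := by push_cast; ring
    rw [this, ENNReal.zpow_neg, zpow_natCast, ENNReal.inv_pos]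
    exact ENNReal.pow_ne_top enorm_ne_top
  rw [rieszPot, setLIntegral_pos_iff hm]
  have : Function.support (fun y : Rn n => ‖x - y‖ₑ ^ (1 - (n : ℤ))) = univ :=
    eq_univ_of_forall fun y => (hpos y).ne'
  rw [this, univ_inter, pos_iff_ne_zero]
  intro h1
  refine hne (Measure.measure_univ_eq_zero.1 ?_)
  rw [← union_compl_self Ω]
  exact measure_union_null h1 h0

end IsRegularPathSystem

theorem ofReal_zpow_le_of_le (hn : 1 ≤ n) {a b : ℝ} (h : a ≤ b) :
    ENNReal.ofReal b ^ (1 - (n : ℤ)) ≤ ENNReal.ofReal a ^ (1 - (n : ℤ)) := by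
  obtain ⟨k, rfl⟩ := Nat.exists_eq_add_of_le' hn
  have : (1 : ℤ) - ((k + 1 : ℕ) : ℤ) = -(k : ℤ) := by push_cast; ring
  rw [this, ENNReal.zpow_neg, ENNReal.zpow_neg, zpow_natCast, zpow_natCast, ENNReal.inv_le_inv]
  gcongr

/-- Let d = d̂(x). If the path stays within 3d/4 of x, then so does x₀, and d̂(x₀) ≤ 7d/4. Otherwise
it travels a distance of at least d/4 starting from B(x, d/2), so it spends a time d/(4L) within
3d/4 of x. During this time d/4 ≤ d̂(γ) ≤ 7d/4, and d⁻ⁿ is replaced by a quantity that depends on γ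
alone. -/
theorem IsPath.indicator_le {y : Rn n} {L : ℝ≥0} (h : IsPath U x₀ γ y L) (hn : 1 ≤ n) {x : Rn n}
    (hx : x ∈ U) :
    {y : Rn n | ∃ t ∈ Icc (0 : ℝ) 1, ‖γ t y - x‖ ≤ bdist U x / 2}.indicator
      (fun _ => ENNReal.ofReal (bdist U x) ^ (1 - (n : ℤ))) y ≤
    ENNReal.ofReal (4 / 7 * bdist U x₀) ^ (1 - (n : ℤ)) +
      4 * L * ∫⁻ t in Icc (0 : ℝ) 1, (Metric.closedBall (γ t y) (3 * bdist U (γ t y))).indicator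
        (fun _ => ENNReal.ofReal (((4 / 7 * bdist U (γ t y)) ^ n)⁻¹)) x := by
  by_cases hS : y ∈ {y | ∃ t ∈ Icc (0 : ℝ) 1, ‖γ t y - x‖ ≤ bdist U x / 2}
  swap
  · rw [indicator_of_notMem hS]; exact zero_le
  rw [indicator_of_mem hS]
  obtain ⟨t, ht, htx⟩ := hS
  set d := bdist U x with hd
  have hdpos : 0 < d := bdist_pos h.isOpen h.compl_nonempty hx
  by_cases hfar : ∃ u ∈ Icc (0 : ℝ) 1, 3 / 4 * d ≤ ‖γ u y - x‖
  swap
  · push Not at hfar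
    have h1 := hfar 1 (by simp)
    have h2 := bdist_le_add U (γ 1 y) x
    rw [h.finish] at h1 h2
    exact (ofReal_zpow_le_of_le hn (by linarith)).trans le_self_add
  obtain ⟨u, hu, hux⟩ := hfar
  refine le_trans ?_ le_add_self
  have hLip : ∀ a ∈ Icc (0 : ℝ) 1, ∀ b ∈ Icc (0 : ℝ) 1, ‖γ a y - γ b y‖ ≤ L * |a - b| :=
    fun a ha b hb => by
      have := h.lipschitz.dist_le_mul a ha b hb
      rwa [dist_eq_norm, Real.dist_eq] at this
  have hut : d / 4 ≤ L * |u - t| := by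
    have h1 := hLip u hu t ht
    have h2 := norm_sub_le_norm_sub_add_norm_sub (γ u y) (γ t y) x
    linarith
  have hL : 0 < (L : ℝ) := by
    refine L.2.lt_of_ne fun h0 => ?_
    change 0 = (L : ℝ) at h0
    rw [← h0, zero_mul] at hut
    linarith
  set e := d / (4 * L) with he
  have hLe : L * e = d / 4 := by rw [he]; field_simp
  have hepos : 0 < e := by positivity
  have heut : e ≤ |u - t| := by
    rw [← hLe] at hut
    exact le_of_mul_le_mul_left hut hL
  -- The interval of length e is taken on the side of t on which u lies, so that it remains in [0,
  -- 1].
  obtain ⟨p, hp0, hp1, hpt⟩ : ∃ p, 0 ≤ p ∧ p + e ≤ 1 ∧ ∀ w ∈ Icc p (p + e), |w - t| ≤ e := by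
    rcases le_total t u with htu | htu
    · rw [abs_of_nonneg (by linarith)] at heut
      refine ⟨t, ht.1, by linarith [hu.2], fun w hw => ?_⟩
      rw [abs_le]; constructor <;> linarith [hw.1, hw.2]
    · rw [abs_of_nonpos (by linarith)] at heut
      refine ⟨t - e, by linarith [hu.1], by linarith [ht.2], fun w hw => ?_⟩
      rw [abs_le]; constructor <;> linarith [hw.1, hw.2]
  have hsub : Icc p (p + e) ⊆ Icc (0 : ℝ) 1 := Icc_subset_Icc hp0 hp1
  have hlow : ∀ w ∈ Icc p (p + e), ENNReal.ofReal ((d ^ n)⁻¹) ≤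
      (Metric.closedBall (γ w y) (3 * bdist U (γ w y))).indicator
        (fun _ => ENNReal.ofReal (((4 / 7 * bdist U (γ w y)) ^ n)⁻¹)) x := fun w hw => by
    have hwx : ‖γ w y - x‖ ≤ 3 / 4 * d := by
      have h1 := hLip w (hsub hw) t ht
      have h2 := norm_sub_le_norm_sub_add_norm_sub (γ w y) (γ t y) x
      have h3 := mul_le_mul_of_nonneg_left (hpt w hw) hL.le
      linarith
    have h1 := bdist_le_add U (γ w y) x
    have h2 := bdist_le_add U x (γ w y)
    rw [norm_sub_rev] at h2
    have hw0 := h.pos (hsub hw)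
    rw [indicator_of_mem]
    · refine ENNReal.ofReal_le_ofReal (inv_anti₀ (by positivity) ?_)
      exact pow_le_pow_left₀ (by positivity) (by linarith) n
    · rw [mem_closedBall_iff_norm']
      linarith
  calc ENNReal.ofReal d ^ (1 - (n : ℤ))
      = 4 * L * (ENNReal.ofReal ((d ^ n)⁻¹) * ENNReal.ofReal e) := by
        rw [← ofReal_inv_pow_mul_self hdpos, ← ENNReal.ofReal_mul (by positivity),
          ← ENNReal.ofReal_mul (by positivity), ← ENNReal.ofReal_coe_nnreal,
          ← ENNReal.ofReal_ofNat 4, ← ENNReal.ofReal_mul (by norm_num),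
          ← ENNReal.ofReal_mul (by positivity), he]
        congr 1
        field_simp
    _ = 4 * L * ∫⁻ t in Icc p (p + e), ENNReal.ofReal ((d ^ n)⁻¹) := by
        rw [setLIntegral_const, Real.volume_Icc, add_sub_cancel_left]
    _ ≤ _ := by
        refine mul_le_mul_right ?_ _
        exact (setLIntegral_mono' measurableSet_Icc hlow).trans (lintegral_mono_set hsub)

/-- For each t the integral in x is the volume of a ball of radius 3 d̂(γ) over (4 d̂(γ)/7)ⁿ; the
boundary distance cancels and only a dimensional constant is left. -/
theorem IsPath.lintegral_indicator_closedBall {y : Rn n} {L : ℝ≥0} (h : IsPath U x₀ γ y L) :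
    ∫⁻ x, ∫⁻ t in Icc (0 : ℝ) 1, (Metric.closedBall (γ t y) (3 * bdist U (γ t y))).indicator
        (fun _ => ENNReal.ofReal (((4 / 7 * bdist U (γ t y)) ^ n)⁻¹)) x =
      ENNReal.ofReal ((21 / 4) ^ n) * volume (Metric.ball (0 : Rn n) 1) := by
  set c : ℝ → Rn n := IccExtend zero_le_one ((Icc (0 : ℝ) 1).domRestrict fun t => γ t y)
  have hc : Continuous c := h.continuousOn.domRestrict.Icc_extend'
  have hce : ∀ t ∈ Icc (0 : ℝ) 1, c t = γ t y := fun t ht => IccExtend_of_mem _ _ ht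
  have hb : Continuous fun t => bdist U (c t) := (continuous_bdist U).comp hc
  have hm : Measurable fun q : Rn n × ℝ =>
      (Metric.closedBall (c q.2) (3 * bdist U (c q.2))).indicator
        (fun _ => ENNReal.ofReal (((4 / 7 * bdist U (c q.2)) ^ n)⁻¹)) q.1 := by
    have h1 : Measurable fun q : Rn n × ℝ =>
        ENNReal.ofReal (((4 / 7 * bdist U (c q.2)) ^ n)⁻¹) :=
      ((((hb.measurable.comp measurable_snd).const_mul _).pow_const n).inv).ennreal_ofReal
    have h2 : MeasurableSet {q : Rn n × ℝ | dist q.1 (c q.2) ≤ 3 * bdist U (c q.2)} :=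
      (isClosed_le (continuous_fst.dist (hc.comp continuous_snd))
        ((hb.comp continuous_snd).const_mul 3)).measurableSet
    exact h1.indicator h2
  have e1 : ∀ x, ∫⁻ t in Icc (0 : ℝ) 1,
      (Metric.closedBall (γ t y) (3 * bdist U (γ t y))).indicator
        (fun _ => ENNReal.ofReal (((4 / 7 * bdist U (γ t y)) ^ n)⁻¹)) x =
      ∫⁻ t in Icc (0 : ℝ) 1, (Metric.closedBall (c t) (3 * bdist U (c t))).indicator
        (fun _ => ENNReal.ofReal (((4 / 7 * bdist U (c t)) ^ n)⁻¹)) x := fun x =>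
    setLIntegral_congr_fun measurableSet_Icc fun t ht => by simp only [hce t ht]
  simp_rw [e1]
  rw [lintegral_lintegral_swap hm.aemeasurable]
  have e2 : ∀ t ∈ Icc (0 : ℝ) 1, ∫⁻ x, (Metric.closedBall (c t) (3 * bdist U (c t))).indicator
        (fun _ => ENNReal.ofReal (((4 / 7 * bdist U (c t)) ^ n)⁻¹)) x =
      ENNReal.ofReal ((21 / 4) ^ n) * volume (Metric.ball (0 : Rn n) 1) := fun t ht => by
    have hpos : 0 < bdist U (c t) := by rw [hce t ht]; exact h.pos ht
    rw [lintegral_indicator Metric.isClosed_closedBall.measurableSet, setLIntegral_const,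
      Measure.addHaar_closedBall _ _ (by positivity), ← mul_assoc,
      ← ENNReal.ofReal_mul (by positivity)]
    congr 2
    simp only [finrank_euclideanSpace, Fintype.card_fin]
    rw [← inv_pow, ← mul_pow]
    congr 1
    field_simp
    norm_num
  rw [setLIntegral_congr_fun measurableSet_Icc e2, setLIntegral_const]
  simp

theorem IsRegularPathSystem.lintegral_weight_lt_top (h : IsRegularPathSystem Ω U x₀ γ)
    (hn : 1 ≤ n) (hΩ : Bornology.IsBounded Ω) (hx₀ : x₀ ∈ U) (μ₀ : Measure (Rn n))
    [IsFiniteMeasure μ₀] (hd : ∫⁻ x in Ω, geodesicDist U x₀ x ∂μ₀ < ⊤) :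
    ∫⁻ x in Ω, weight Ω U γ μ₀ x < ⊤ := by
  obtain ⟨K, hK⟩ := h.exists_isPath
  obtain ⟨C, hC⟩ := exists_lintegral_enorm_sub_zpow_le hn hΩ
  have hm := h.isMeasurableFamily.measurable_majorant U
  have hΩm := h.isOpen_left.measurableSet
  set A : ℝ≥0∞ := ENNReal.ofReal (4 / 7 * bdist U x₀) ^ (1 - (n : ℤ)) with hA
  set D : ℝ≥0∞ := ENNReal.ofReal ((21 / 4) ^ n) * volume (Metric.ball (0 : Rn n) 1) with hD
  have hAt : A < ⊤ := by
    refine ENNReal.zpow_lt_top ?_ ENNReal.ofReal_ne_top _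
    have := bdist_pos h.isOpen h.compl_nonempty hx₀
    simpa using this
  have hDt : D < ⊤ := ENNReal.mul_lt_top ENNReal.ofReal_lt_top Metric.isBounded_ball.measure_lt_top
  have key : ∀ y ∈ Ω, ∫⁻ x in Ω, majorant U (extendFamily U γ) x y ≤
      (C + A * volume Ω) + 4 * K * D * geodesicDist U x₀ y := fun y hy => by
    have hyU := h.subset hy
    have hp := hK y hyU
    simp_rw [majorant_extendFamily hyU]
    unfold majorant
    have hm1 : Measurable fun x : Rn n => ‖x - y‖ₑ ^ (1 - (n : ℤ)) :=
      (measurable_id.sub_const y).enorm.pow_const _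
    rw [lintegral_add_left hm1, add_assoc]
    refine add_le_add (hC y hy) ?_
    refine (setLIntegral_mono' hΩm fun x hx => hp.indicator_le hn (h.subset hx)).trans ?_
    rw [lintegral_add_left measurable_const, setLIntegral_const]
    refine add_le_add le_rfl ?_
    rw [lintegral_const_mul' _ _ (by finiteness)]
    refine (mul_le_mul_right (setLIntegral_le_lintegral _ _) _).trans ?_
    rw [hp.lintegral_indicator_closedBall, ENNReal.coe_mul,
      ENNReal.coe_toNNReal (h.rectifiable y hyU).ne]
    exact le_of_eq (by ring)
  simp_rw [h.weight_eq_lintegral μ₀]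
  rw [lintegral_lintegral_swap hm.aemeasurable]
  refine (setLIntegral_mono' hΩm key).trans_lt ?_
  rw [lintegral_add_left measurable_const, setLIntegral_const,
    lintegral_const_mul' _ _ (by finiteness)]
  have := hΩ.measure_lt_top (μ := (volume : Measure (Rn n)))
  finiteness

end Weight

/-! ### Integration of the kernel against the measure -/

section Solution

variable {n : ℕ} {Ω U : Set (Rn n)} {x₀ : Rn n} {γ : ℝ → Rn n → Rn n}

theorem ae_ae_ne (hn : 1 ≤ n) (ν : Measure (Rn n)) [IsFiniteMeasure ν] :
    ∀ᵐ x ∂(volume : Measure (Rn n)), ∀ᵐ y ∂ν, x ≠ y := by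
  have : Nonempty (Fin n) := ⟨⟨0, hn⟩⟩
  refine (Measure.ae_ae_comm ?_).2 (Filter.Eventually.of_forall fun y => ?_)
  · exact (measurableSet_eq_fun measurable_fst measurable_snd).compl
  · simp [ae_iff, measure_singleton]

namespace IsKernelConstant

variable {χ : Rn n → ℝ} {s : ℝ} {C : ℝ≥0}

theorem ae_lintegral_le (hC : IsKernelConstant Ω U x₀ γ χ s C) (h : IsRegularPathSystem Ω U x₀ γ)
    (hn : 1 ≤ n) {μ₀ ν : Measure (Rn n)} [IsFiniteMeasure ν] {k : ℝ≥0∞} (hν : ν ≤ k • μ₀) :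
    ∀ᵐ x ∂volume.restrict Ω,
      ∫⁻ y in Ω, ‖kernel U x₀ γ χ x y‖ₑ ∂ν ≤ C * k * weight Ω U γ μ₀ x := by
  have hΩ := h.isOpen_left.measurableSet
  filter_upwards [ae_restrict_mem hΩ, ae_restrict_of_ae (ae_ae_ne hn ν)] with x hx hxy
  rw [h.weight_eq_lintegral μ₀ x]
  calc ∫⁻ y in Ω, ‖kernel U x₀ γ χ x y‖ₑ ∂ν
      ≤ ∫⁻ y in Ω, C * majorant U (extendFamily U γ) x y ∂ν := by
        refine lintegral_mono_ae ?_
        filter_upwards [ae_restrict_mem hΩ, ae_restrict_of_ae hxy] with y hy hne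
        rw [majorant_extendFamily (h.subset hy)]
        exact ((hC y hy).1 x hx hne).2
    _ = C * ∫⁻ y in Ω, majorant U (extendFamily U γ) x y ∂ν :=
        lintegral_const_mul' _ _ ENNReal.coe_ne_top
    _ ≤ C * (k * ∫⁻ y in Ω, majorant U (extendFamily U γ) x y ∂μ₀) := by
        refine mul_le_mul_right ?_ _
        rw [← smul_eq_mul, ← lintegral_smul_measure, ← Measure.restrict_smul]
        exact lintegral_mono' (Measure.restrict_mono le_rfl hν) le_rfl
    _ = _ := (mul_assoc _ _ _).symm

theorem ae_integrableOn (hC : IsKernelConstant Ω U x₀ γ χ s C) (h : IsRegularPathSystem Ω U x₀ γ)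
    (hn : 1 ≤ n) (hχ : Measurable χ) {μ₀ ν : Measure (Rn n)} [IsFiniteMeasure μ₀]
    [IsFiniteMeasure ν] {k : ℝ≥0∞} (hk : k ≠ ⊤) (hν : ν ≤ k • μ₀)
    (hw : ∫⁻ x in Ω, weight Ω U γ μ₀ x < ⊤) :
    ∀ᵐ x ∂volume.restrict Ω, IntegrableOn (kernel U x₀ γ χ x) Ω ν := by
  obtain ⟨H, hH, he⟩ := h.exists_measurable_kernel hχ
  filter_upwards [hC.ae_lintegral_le h hn hν, ae_lt_top (h.measurable_weight μ₀) hw.ne] with x hx hwx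
  refine ⟨?_, hx.trans_lt (by finiteness)⟩
  refine AEStronglyMeasurable.congr
    (f := fun y => H (x, y)) (hH.comp measurable_prodMk_left).aestronglyMeasurable ?_
  filter_upwards [ae_restrict_mem h.isOpen_left.measurableSet] with y hy
  exact (he y (h.subset hy) x).symm

theorem setIntegral_kernel_eq (h : IsRegularPathSystem Ω U x₀ γ) {H : Rn n × Rn n → Rn n}
    (he : ∀ y ∈ U, ∀ x, kernel U x₀ γ χ x y = H (x, y)) (ν : Measure (Rn n)) (x : Rn n) :
    ∫ y in Ω, kernel U x₀ γ χ x y ∂ν = ∫ y in Ω, H (x, y) ∂ν :=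
  setIntegral_congr_fun h.isOpen_left.measurableSet fun y hy => he y (h.subset hy) x

/-- Fubini in (x, y), with |v| times the weight as the dominating quantity. The same quantity makes
`majorant` times |v| integrable for almost every y, which is the hypothesis of the reproducing
identity for that label. -/
theorem integral_inner_setIntegral (hC : IsKernelConstant Ω U x₀ γ χ s C)
    (h : IsRegularPathSystem Ω U x₀ γ) (hn : 1 ≤ n) (hχ : Measurable χ) (hχ1 : ∫ x, χ x = 1)
    {μ₀ ν : Measure (Rn n)} [IsFiniteMeasure μ₀]
    [IsFiniteMeasure ν] {k : ℝ≥0∞} (hk : k ≠ ⊤) (hν : ν ≤ k • μ₀)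
    (hw : ∫⁻ x in Ω, weight Ω U γ μ₀ x < ⊤)
    {g : Rn n → ℝ} {v : Rn n → Rn n} (hgc : ContinuousOn g U) (hgv : IsWeakGradient U g v)
    (hg : IntegrableOn g Ω μ₀) (hv : ∫⁻ x in Ω, ‖v x‖ₑ * weight Ω U γ μ₀ x < ⊤) :
    IntegrableOn (fun x => inner ℝ (∫ y in Ω, kernel U x₀ γ χ x y ∂ν) (v x)) Ω ∧
      ∫ x in Ω, inner ℝ (∫ y in Ω, kernel U x₀ γ χ x y ∂ν) (v x) =
        ν.real Ω * tubeMean χ x₀ s g x₀ 1 - ∫ y in Ω, g y ∂ν := by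
  obtain ⟨H, hH, he⟩ := h.exists_measurable_kernel hχ
  have hΩ := h.isOpen_left.measurableSet
  have hvm : AEStronglyMeasurable v (volume.restrict Ω) := by
    rw [← h.restrict_eq]; exact hgv.2.1.aestronglyMeasurable
  have hJm : AEStronglyMeasurable (fun q : Rn n × Rn n => inner ℝ (H q) (v q.1))
      ((volume.restrict Ω).prod (ν.restrict Ω)) :=
    hH.aestronglyMeasurable.inner hvm.comp_fst
  have hbound := hC.ae_lintegral_le h hn hν
  have hJ : Integrable (fun q : Rn n × Rn n => inner ℝ (H q) (v q.1))
      ((volume.restrict Ω).prod (ν.restrict Ω)) := by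
    refine ⟨hJm, ?_⟩
    rw [hasFiniteIntegral_iff_enorm, lintegral_prod _ hJm.enorm]
    calc ∫⁻ x in Ω, ∫⁻ y in Ω, ‖inner ℝ (H (x, y)) (v x)‖ₑ ∂ν
        ≤ ∫⁻ x in Ω, C * k * (‖v x‖ₑ * weight Ω U γ μ₀ x) := by
          refine lintegral_mono_ae ?_
          filter_upwards [hbound] with x hx
          calc ∫⁻ y in Ω, ‖inner ℝ (H (x, y)) (v x)‖ₑ ∂ν
              ≤ ∫⁻ y in Ω, ‖kernel U x₀ γ χ x y‖ₑ * ‖v x‖ₑ ∂ν := by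
                refine setLIntegral_mono' hΩ fun y hy => ?_
                rw [he y (h.subset hy), ← ofReal_norm, ← ofReal_norm, ← ofReal_norm,
                  ← ENNReal.ofReal_mul (norm_nonneg _)]
                exact ENNReal.ofReal_le_ofReal (norm_inner_le_norm _ _)
            _ = (∫⁻ y in Ω, ‖kernel U x₀ γ χ x y‖ₑ ∂ν) * ‖v x‖ₑ :=
                lintegral_mul_const' _ _ enorm_ne_top
            _ ≤ C * k * weight Ω U γ μ₀ x * ‖v x‖ₑ := mul_le_mul_left hx _
            _ = _ := by ring
      _ = C * k * ∫⁻ x in Ω, ‖v x‖ₑ * weight Ω U γ μ₀ x :=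
          lintegral_const_mul' _ _ (by finiteness)
      _ < ⊤ := by finiteness
  have e1 : ∀ᵐ x ∂volume.restrict Ω, inner ℝ (∫ y in Ω, kernel U x₀ γ χ x y ∂ν) (v x) =
      ∫ y in Ω, inner ℝ (H (x, y)) (v x) ∂ν := by
    filter_upwards [hC.ae_integrableOn h hn hχ hk hν hw] with x hx
    have hx' : IntegrableOn (fun y => H (x, y)) Ω ν :=
      hx.congr_fun (fun y hy => he y (h.subset hy) x) hΩ
    simp_rw [setIntegral_kernel_eq h he, real_inner_comm (v x)]
    exact (integral_inner hx' (v x)).symm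
  refine ⟨(hJ.integral_prod_left).congr (e1.mono fun x hx => hx.symm), ?_⟩
  rw [integral_congr_ae e1, integral_integral_swap hJ]
  have hfin : ∫⁻ y in Ω, (∫⁻ x in Ω, majorant U (extendFamily U γ) x y * ‖v x‖ₑ) ∂ν < ⊤ := by
    have hMm := h.isMeasurableFamily.measurable_majorant U
    have hm : AEMeasurable (fun q : Rn n × Rn n =>
        majorant U (extendFamily U γ) q.2 q.1 * ‖v q.2‖ₑ)
        ((ν.restrict Ω).prod (volume.restrict Ω)) :=
      (hMm.comp measurable_swap).aemeasurable.mul hvm.enorm.comp_snd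
    rw [lintegral_lintegral_swap hm]
    calc ∫⁻ x in Ω, ∫⁻ y in Ω, majorant U (extendFamily U γ) x y * ‖v x‖ₑ ∂ν
        ≤ ∫⁻ x in Ω, k * (‖v x‖ₑ * weight Ω U γ μ₀ x) := by
          refine lintegral_mono fun x => ?_
          rw [lintegral_mul_const' _ _ enorm_ne_top, h.weight_eq_lintegral μ₀ x,
            mul_comm ‖v x‖ₑ, ← mul_assoc]
          refine mul_le_mul_left ?_ _
          rw [← smul_eq_mul, ← lintegral_smul_measure, ← Measure.restrict_smul]
          exact lintegral_mono' (Measure.restrict_mono le_rfl hν) le_rfl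
      _ = k * ∫⁻ x in Ω, ‖v x‖ₑ * weight Ω U γ μ₀ x := lintegral_const_mul' _ _ hk
      _ < ⊤ := by finiteness
  have e2 : ∀ᵐ y ∂ν.restrict Ω, ∫ x in Ω, inner ℝ (H (x, y)) (v x) =
      tubeMean χ x₀ s g x₀ 1 - g y := by
    have hMm := h.isMeasurableFamily.measurable_majorant U
    have hm : AEMeasurable (fun y => ∫⁻ x in Ω, majorant U (extendFamily U γ) x y * ‖v x‖ₑ)
        (ν.restrict Ω) := by
      have hm : AEMeasurable (fun q : Rn n × Rn n =>
          majorant U (extendFamily U γ) q.2 q.1 * ‖v q.2‖ₑ)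
          ((ν.restrict Ω).prod (volume.restrict Ω)) :=
        (hMm.comp measurable_swap).aemeasurable.mul hvm.enorm.comp_snd
      exact hm.lintegral_prod_right'
    filter_upwards [ae_lt_top' hm hfin.ne, ae_restrict_mem hΩ] with y hy hyΩ
    simp_rw [majorant_extendFamily (h.subset hyΩ)] at hy
    have := (hC y hyΩ).2 g v hgc hgv hy
    rw [hχ1, mul_one] at this
    simp_rw [← he y (h.subset hyΩ)]
    exact this
  have hgν : IntegrableOn g Ω ν :=
    (hg.smul_measure hk).mono_measure (by
      rw [← Measure.restrict_smul]; exact Measure.restrict_mono le_rfl hν)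
  rw [integral_congr_ae e2, integral_sub (integrable_const _) hgν, setIntegral_const, smul_eq_mul]

end IsKernelConstant

theorem setIntegral_signedMeasure {E : Type*} [NormedAddCommGroup E] [NormedSpace ℝ E]
    [CompleteSpace E] (hΩ : MeasurableSet Ω) (μ : SignedMeasure (Rn n)) {f : Rn n → E}
    (hf : IntegrableOn f Ω μ.totalVariation) :
    ∫ᵛ y in Ω, f y ∂<•μ = ∫ y in Ω, f y ∂μ.toJordanDecomposition.posPart -
      ∫ y in Ω, f y ∂μ.toJordanDecomposition.negPart := by
  set j := μ.toJordanDecomposition with hj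
  have e : μ.restrict Ω = (j.posPart.restrict Ω).toSignedMeasure -
      (j.negPart.restrict Ω).toSignedMeasure := by
    rw [← VectorMeasure.restrict_toSignedMeasure hΩ,
      ← VectorMeasure.restrict_toSignedMeasure hΩ, ← VectorMeasure.restrict_sub]
    conv_lhs => rw [← μ.toSignedMeasure_toJordanDecomposition]
    rfl
  have hp : IntegrableOn f Ω j.posPart := IntegrableOn.mono_measure hf (Measure.le_add_right le_rfl)
  have hq : IntegrableOn f Ω j.negPart := IntegrableOn.mono_measure hf (Measure.le_add_left le_rfl)
  rw [e, VectorMeasure.integral_sub_vectorMeasure, VectorMeasure.integral_toSignedMeasure,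
    VectorMeasure.integral_toSignedMeasure]
  · simp only [VectorMeasure.Integrable, Measure.variation_toSignedMeasure]
    exact hp
  · simp only [VectorMeasure.Integrable, Measure.variation_toSignedMeasure]
    exact hq

end Solution

/-! ### Locally Lipschitz functions and their weak gradients -/

section LipschitzGradient

variable {n : ℕ} {U : Set (Rn n)} {g : Rn n → ℝ} {L : ℝ≥0}

theorem norm_gradient_eq (g : Rn n → ℝ) (x : Rn n) : ‖∇ g x‖ = ‖fderiv ℝ g x‖ := by
  rw [← toDual_gradient, LinearIsometryEquiv.norm_map]

theorem norm_gradient_le_of_lipschitzOn {V : Set (Rn n)} {x : Rn n} (hV : V ∈ 𝓝 x)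
    (h : LipschitzOnWith L g V) : ‖∇ g x‖ ≤ L := by
  rw [norm_gradient_eq]
  exact norm_fderiv_le_of_lipschitzOn ℝ hV h

theorem measurable_gradient (g : Rn n → ℝ) : Measurable (∇ g) :=
  (LinearIsometryEquiv.continuous _).measurable.comp (measurable_fderiv ℝ g)

theorem LipschitzWith.integral_mul_inner_gradient {G φ : Rn n → ℝ} {M : ℝ≥0}
    (hG : LipschitzWith M G) (hφ : ContDiff ℝ ∞ φ) (hc : HasCompactSupport φ) (w : Rn n) :
    ∫ x, G x * inner ℝ w (∇ φ x) = -∫ x, φ x * inner ℝ w (∇ G x) := by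
  obtain ⟨D, hD⟩ := ContDiff.lipschitzWith_of_hasCompactSupport hc hφ (by simp)
  have h1 := LipschitzWith.integral_lineDeriv_mul_eq (μ := volume) hG hD hc w
  have h2 : ∀ x, lineDeriv ℝ φ x (-w) * G x = -(G x * inner ℝ w (∇ φ x)) := fun x => by
    rw [((hφ.differentiable (by simp)) x).lineDeriv_eq_fderiv, map_neg, real_inner_comm,
      inner_gradient_left]
    ring
  have h3 : ∀ᵐ x, lineDeriv ℝ G x w * φ x = φ x * inner ℝ w (∇ G x) := by
    filter_upwards [hG.ae_differentiableAt] with x hx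
    rw [hx.lineDeriv_eq_fderiv, real_inner_comm, inner_gradient_left, mul_comm]
  rw [integral_congr_ae h3] at h1
  simp_rw [h2] at h1
  rw [integral_neg] at h1
  linarith

theorem continuousOn_of_locally_lipschitz (h : ∀ x ∈ U, ∃ V ∈ 𝓝 x, LipschitzOnWith L g V) :
    ContinuousOn g U := fun x hx => by
  obtain ⟨V, hV, hL⟩ := h x hx
  exact (hL.continuousOn.continuousAt hV).continuousWithinAt

/-- Near the support of the test function g is Lipschitz on a compact set, with a constant obtained
by compactness that may exceed L. It is extended to a globally Lipschitz function G agreeing with g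
near the support, and G can be integrated by parts along each direction. -/
theorem isWeakGradient_gradient (hU : IsOpen U)
    (h : ∀ x ∈ U, ∃ V ∈ 𝓝 x, LipschitzOnWith L g V) : IsWeakGradient U g (∇ g) := by
  have hgc := continuousOn_of_locally_lipschitz h
  have hgl := hgc.locallyIntegrableOn (μ := volume) hU.measurableSet
  have hvl : LocallyIntegrableOn (∇ g) U := by
    rw [locallyIntegrableOn_iff hU.isLocallyClosed]
    intro K hKU hK
    refine Measure.integrableOn_of_bounded (M := L) hK.measure_lt_top.ne
      (measurable_gradient g).aestronglyMeasurable ?_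
    refine (ae_restrict_iff' hK.measurableSet).2 (Filter.Eventually.of_forall fun x hx => ?_)
    obtain ⟨V, hV, hL⟩ := h x (hKU hx)
    exact norm_gradient_le_of_lipschitzOn hV hL
  refine ⟨hgl, hvl, fun φ hφ hc hs => ?_⟩
  obtain ⟨δ, hδ, hδU⟩ := hc.isCompact.exists_cthickening_subset_open hU hs
  have hK : IsCompact (Metric.cthickening δ (tsupport φ)) := hc.isCompact.cthickening
  obtain ⟨M, hM⟩ := LocallyLipschitzOn.exists_lipschitzOnWith_of_compact hK (f := g)
    (fun x hx => by
      obtain ⟨V, hV, hL⟩ := h x (hδU hx)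
      exact ⟨L, V, mem_nhdsWithin_of_mem_nhds hV, hL⟩)
  obtain ⟨G, hG, hGe⟩ := hM.extend_real
  have hnb : ∀ x ∈ tsupport φ, G =ᶠ[𝓝 x] g := fun x hx => by
    filter_upwards [Metric.isOpen_thickening.mem_nhds
      (Metric.self_subset_thickening hδ _ hx)] with z hz
    exact (hGe (Metric.thickening_subset_cthickening _ _ hz)).symm
  have hφc := hφ.continuous
  have hφg : Continuous (∇ φ) :=
    (LinearIsometryEquiv.continuous _).comp (hφ.continuous_fderiv (by simp))
  have hgs : ∀ x, x ∉ tsupport φ → ∇ φ x = 0 := fun x hx => by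
    have : φ =ᶠ[𝓝 x] fun _ => 0 := by
      filter_upwards [(isClosed_tsupport φ).isOpen_compl.mem_nhds hx] with z hz
      exact image_eq_zero_of_notMem_tsupport hz
    rw [this.gradient_eq, gradient_fun_const]
  have hsupp : Function.support (∇ φ) ⊆ tsupport φ := fun x hx => by
    by_contra hx'
    exact hx (hgs x hx')
  have hint1 : IntegrableOn (fun x => g x • ∇ φ x) U := by
    have h1 : IntegrableOn (fun x => g x • ∇ φ x) (tsupport φ) :=
      ((hgc.mono hs).smul hφg.continuousOn).integrableOn_compact hc.isCompact
    refine (h1.integrable_of_forall_notMem_eq_zero fun x hx => ?_).integrableOn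
    rw [hgs x hx, smul_zero]
  have hint2 : IntegrableOn (fun x => φ x • ∇ g x) U :=
    integrableOn_smul_of_tsupport_subset hU.measurableSet hvl hφc hc hs
  refine ext_inner_left ℝ fun w => ?_
  rw [inner_neg_right, ← integral_inner hint1, ← integral_inner hint2]
  simp_rw [inner_smul_right]
  have e1 : ∫ x in U, g x * inner ℝ w (∇ φ x) = ∫ x, G x * inner ℝ w (∇ φ x) := by
    rw [setIntegral_eq_integral_of_forall_compl_eq_zero]
    · refine integral_congr_ae (Filter.Eventually.of_forall fun x => ?_)
      by_cases hx : x ∈ tsupport φ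
      · simp only [(hnb x hx).eq_of_nhds]
      · simp [hgs x hx]
    · intro x hx
      rw [hgs x fun h => hx (hs h), inner_zero_right, mul_zero]
  have e2 : ∫ x in U, φ x * inner ℝ w (∇ g x) = ∫ x, φ x * inner ℝ w (∇ G x) := by
    rw [setIntegral_eq_integral_of_forall_compl_eq_zero]
    · refine integral_congr_ae (Filter.Eventually.of_forall fun x => ?_)
      by_cases hx : x ∈ tsupport φ
      · simp only [(hnb x hx).gradient_eq]
      · simp [image_eq_zero_of_notMem_tsupport hx]
    · intro x hx
      rw [image_eq_zero_of_notMem_tsupport fun h => hx (hs h), zero_mul]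
  rw [e1, e2, hG.integral_mul_inner_gradient hφ hc w]

end LipschitzGradient

/-! ### Properties of the constructed solution -/

section Solution

variable {n : ℕ} {Ω U : Set (Rn n)} {x₀ : Rn n} {γ : ℝ → Rn n → Rn n} {χ : Rn n → ℝ} {s : ℝ}
  {C : ℝ≥0}

namespace IsKernelConstant

theorem ae_bogSolution_eq (hC : IsKernelConstant Ω U x₀ γ χ s C)
    (h : IsRegularPathSystem Ω U x₀ γ) (hn : 1 ≤ n) (hχ : Measurable χ) {μ₀ : Measure (Rn n)}
    [IsFiniteMeasure μ₀] {μ : SignedMeasure (Rn n)} {k : ℝ≥0∞} (hk : k ≠ ⊤)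
    (hμ : μ.totalVariation ≤ k • μ₀) (hw : ∫⁻ x in Ω, weight Ω U γ μ₀ x < ⊤) :
    ∀ᵐ x ∂volume.restrict Ω, bogSolution Ω U x₀ γ χ μ x =
      ∫ y in Ω, kernel U x₀ γ χ x y ∂μ.toJordanDecomposition.posPart -
        ∫ y in Ω, kernel U x₀ γ χ x y ∂μ.toJordanDecomposition.negPart := by
  have : IsFiniteMeasure μ.totalVariation := by rw [SignedMeasure.totalVariation]; infer_instance
  filter_upwards [hC.ae_integrableOn h hn hχ hk hμ hw] with x hx
  exact setIntegral_signedMeasure h.isOpen_left.measurableSet μ hx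

theorem aestronglyMeasurable_bogSolution (hC : IsKernelConstant Ω U x₀ γ χ s C)
    (h : IsRegularPathSystem Ω U x₀ γ) (hn : 1 ≤ n) (hχ : Measurable χ) {μ₀ : Measure (Rn n)}
    [IsFiniteMeasure μ₀] {μ : SignedMeasure (Rn n)} {k : ℝ≥0∞} (hk : k ≠ ⊤)
    (hμ : μ.totalVariation ≤ k • μ₀) (hw : ∫⁻ x in Ω, weight Ω U γ μ₀ x < ⊤) :
    AEStronglyMeasurable (bogSolution Ω U x₀ γ χ μ) (volume.restrict Ω) := by
  obtain ⟨H, hH, he⟩ := h.exists_measurable_kernel hχ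
  have hm : ∀ ν : Measure (Rn n), IsFiniteMeasure ν →
      StronglyMeasurable fun x => ∫ y in Ω, H (x, y) ∂ν := fun ν _ =>
    hH.stronglyMeasurable.integral_prod_right'
  refine ((hm μ.toJordanDecomposition.posPart inferInstance).sub
    (hm μ.toJordanDecomposition.negPart inferInstance)).aestronglyMeasurable.congr ?_
  filter_upwards [hC.ae_bogSolution_eq h hn hχ hk hμ hw] with x hx
  rw [hx, setIntegral_kernel_eq h he, setIntegral_kernel_eq h he]
  rfl

theorem ae_enorm_bogSolution_le (hC : IsKernelConstant Ω U x₀ γ χ s C)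
    (h : IsRegularPathSystem Ω U x₀ γ) (hn : 1 ≤ n) (hχ : Measurable χ) {μ₀ : Measure (Rn n)}
    [IsFiniteMeasure μ₀] {μ : SignedMeasure (Rn n)} {k : ℝ≥0∞} (hk : k ≠ ⊤)
    (hμ : μ.totalVariation ≤ k • μ₀) (hw : ∫⁻ x in Ω, weight Ω U γ μ₀ x < ⊤) :
    ∀ᵐ x ∂volume.restrict Ω, ‖bogSolution Ω U x₀ γ χ μ x‖ₑ ≤ C * k * weight Ω U γ μ₀ x := by
  have : IsFiniteMeasure μ.totalVariation := by rw [SignedMeasure.totalVariation]; infer_instance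
  filter_upwards [hC.ae_bogSolution_eq h hn hχ hk hμ hw, hC.ae_lintegral_le h hn hμ] with x hx hle
  rw [hx]
  refine (enorm_sub_le).trans (le_trans ?_ hle)
  rw [SignedMeasure.totalVariation, Measure.restrict_add, lintegral_add_measure]
  exact add_le_add (enorm_integral_le_lintegral_enorm _) (enorm_integral_le_lintegral_enorm _)

theorem integral_inner_bogSolution (hC : IsKernelConstant Ω U x₀ γ χ s C)
    (h : IsRegularPathSystem Ω U x₀ γ) (hn : 1 ≤ n) (hχ : Measurable χ) (hχ1 : ∫ x, χ x = 1)
    {μ₀ : Measure (Rn n)} [IsFiniteMeasure μ₀] {μ : SignedMeasure (Rn n)} {k : ℝ≥0∞} (hk : k ≠ ⊤)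
    (hμ : μ.totalVariation ≤ k • μ₀) (hμΩ : μ Ω = 0) (hw : ∫⁻ x in Ω, weight Ω U γ μ₀ x < ⊤)
    {g : Rn n → ℝ} {v : Rn n → Rn n} (hgc : ContinuousOn g U) (hgv : IsWeakGradient U g v)
    (hg : IntegrableOn g Ω μ₀) (hv : ∫⁻ x in Ω, ‖v x‖ₑ * weight Ω U γ μ₀ x < ⊤) :
    IntegrableOn (fun x => inner ℝ (bogSolution Ω U x₀ γ χ μ x) (v x)) Ω ∧
      ∫ x in Ω, inner ℝ (bogSolution Ω U x₀ γ χ μ x) (v x) = -∫ᵛ x in Ω, g x ∂<•μ := by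
  have hΩ := h.isOpen_left.measurableSet
  set j := μ.toJordanDecomposition with hj
  have hp : j.posPart ≤ k • μ₀ := (Measure.le_add_right le_rfl).trans hμ
  have hq : j.negPart ≤ k • μ₀ := (Measure.le_add_left le_rfl).trans hμ
  obtain ⟨ip, ep⟩ := hC.integral_inner_setIntegral h hn hχ hχ1 hk hp hw hgc hgv hg hv
  obtain ⟨iq, eq⟩ := hC.integral_inner_setIntegral h hn hχ hχ1 hk hq hw hgc hgv hg hv
  have e : ∀ᵐ x ∂volume.restrict Ω, inner ℝ (bogSolution Ω U x₀ γ χ μ x) (v x) =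
      inner ℝ (∫ y in Ω, kernel U x₀ γ χ x y ∂j.posPart) (v x) -
        inner ℝ (∫ y in Ω, kernel U x₀ γ χ x y ∂j.negPart) (v x) := by
    filter_upwards [hC.ae_bogSolution_eq h hn hχ hk hμ hw] with x hx
    rw [hx, inner_sub_left]
  have hgμ : IntegrableOn g Ω μ.totalVariation :=
    (hg.smul_measure hk).mono_measure (by
      rw [← Measure.restrict_smul]; exact Measure.restrict_mono le_rfl hμ)
  refine ⟨(ip.sub iq).congr (e.mono fun x hx => hx.symm), ?_⟩
  rw [integral_congr_ae e, integral_sub ip iq, ep, eq, setIntegral_signedMeasure hΩ μ hgμ]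
  rw [μ.apply_eq_posPart_real_sub_negPart_real hΩ] at hμΩ
  -- The constant ∫ g χ appears with the coefficient μ(Ω) = 0.
  linear_combination (tubeMean χ x₀ s g x₀ 1) * hμΩ

theorem integral_inner_bogSolution_gradient (hC : IsKernelConstant Ω U x₀ γ χ s C)
    (h : IsRegularPathSystem Ω U x₀ γ) (hn : 1 ≤ n) (hχ : Measurable χ) (hχ1 : ∫ x, χ x = 1)
    {μ₀ : Measure (Rn n)} [IsFiniteMeasure μ₀] {μ : SignedMeasure (Rn n)} {k : ℝ≥0∞} (hk : k ≠ ⊤)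
    (hμ : μ.totalVariation ≤ k • μ₀) (hμΩ : μ Ω = 0) (hw : ∫⁻ x in Ω, weight Ω U γ μ₀ x < ⊤)
    {g : Rn n → ℝ} {L : ℝ≥0} (hL : ∀ x ∈ U, ∃ V ∈ 𝓝 x, LipschitzOnWith L g V)
    (hg : IntegrableOn g Ω μ₀) :
    IntegrableOn (fun x => inner ℝ (bogSolution Ω U x₀ γ χ μ x) (∇ g x)) Ω ∧
      ∫ x in Ω, inner ℝ (bogSolution Ω U x₀ γ χ μ x) (∇ g x) = -∫ᵛ x in Ω, g x ∂<•μ := by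
  refine hC.integral_inner_bogSolution h hn hχ hχ1 hk hμ hμΩ hw
    (continuousOn_of_locally_lipschitz hL) (isWeakGradient_gradient h.isOpen hL) hg ?_
  calc ∫⁻ x in Ω, ‖∇ g x‖ₑ * weight Ω U γ μ₀ x ≤ ∫⁻ x in Ω, L * weight Ω U γ μ₀ x := by
        refine setLIntegral_mono' h.isOpen_left.measurableSet fun x hx => mul_le_mul_left ?_ _
        obtain ⟨V, hV, hLV⟩ := hL x (h.subset hx)
        rw [enorm_eq_nnnorm]
        exact_mod_cast norm_gradient_le_of_lipschitzOn hV hLV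
    _ = L * ∫⁻ x in Ω, weight Ω U γ μ₀ x := lintegral_const_mul' _ _ ENNReal.coe_ne_top
    _ < ⊤ := ENNReal.mul_lt_top ENNReal.coe_lt_top hw

end IsKernelConstant

theorem LipschitzWith.integrableOn_of_isBounded {g : Rn n → ℝ} {L : ℝ≥0} (hg : LipschitzWith L g)
    (hΩ : Bornology.IsBounded Ω) (hΩm : MeasurableSet Ω) (μ₀ : Measure (Rn n))
    [IsFiniteMeasure μ₀] : IntegrableOn g Ω μ₀ := by
  obtain ⟨R, hR⟩ := (hg.isBounded_image hΩ).exists_norm_le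
  refine Measure.integrableOn_of_bounded (M := R) (measure_ne_top _ _)
    hg.continuous.aestronglyMeasurable ?_
  exact (ae_restrict_iff' hΩm).2 (Filter.Eventually.of_forall fun x hx =>
    hR _ (mem_image_of_mem g hx))

end Solution

/-! ### Joining curves and polygons -/

section Polygon

variable {n : ℕ}

/-- The time that the curve `c : [0,1] → ℝⁿ` spends in `B`. -/
def timeIn (c : ℝ → Rn n) (B : Set (Rn n)) : ℝ≥0∞ :=
  volume {t : ℝ | t ∈ Icc (0 : ℝ) 1 ∧ c t ∈ B}

/-- Length in a ball is handled through Lipschitz constant times time, a quantity that is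
subadditive under `joinPaths` and involves no derivatives. -/
theorem lengthIn_le_mul_timeIn {c : ℝ → Rn n} {L : ℝ≥0} (hc : LipschitzOnWith L c (Icc 0 1))
    (B : Set (Rn n)) : lengthIn c B ≤ L * timeIn c B := by
  rw [lengthIn, timeIn, ← setLIntegral_const]
  refine lintegral_mono_ae ?_
  have hsub : {t : ℝ | t ∈ Icc (0 : ℝ) 1 ∧ c t ∈ B} ⊆ Icc 0 1 := fun t ht => ht.1
  refine ae_restrict_of_ae_restrict_of_subset hsub ?_
  rw [restrict_Ioo_eq_restrict_Icc.symm, ae_restrict_iff' measurableSet_Ioo]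
  refine Filter.Eventually.of_forall fun t ht => ?_
  rw [enorm_eq_nnnorm]
  exact_mod_cast norm_deriv_le_of_lipschitzOn (Icc_mem_nhds ht.1 ht.2) hc

theorem lipschitzWith_lineMap_sub (a b : Rn n) :
    LipschitzWith ‖b - a‖₊ (fun t : ℝ => AffineMap.lineMap a b t) := by
  refine LipschitzWith.of_dist_le_mul fun s t => ?_
  rw [dist_lineMap_lineMap, dist_comm a b, dist_eq_norm b a, mul_comm]
  rfl

theorem mul_timeIn_lineMap_le (a b x : Rn n) (r : ℝ) :
    ‖b - a‖₊ * timeIn (fun t : ℝ => AffineMap.lineMap a b t) (Metric.ball x r) ≤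
      2 * ENNReal.ofReal r := by
  by_cases h0 : ‖b - a‖₊ = 0
  · simp [h0]
  have h0' : 0 < ‖b - a‖ := lt_of_le_of_ne (norm_nonneg _) fun h => h0 (by ext; exact h.symm)
  have h1 : timeIn (fun t : ℝ => AffineMap.lineMap a b t) (Metric.ball x r) ≤
      ENNReal.ofReal (2 * r / ‖b - a‖) := by
    refine (Real.volume_le_diam _).trans (Metric.ediam_le fun s hs t ht => ?_)
    rw [edist_dist]
    refine ENNReal.ofReal_le_ofReal ?_
    rw [le_div_iff₀ h0', ← dist_eq_norm, dist_comm b a, ← dist_lineMap_lineMap]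
    have h2 := Metric.mem_ball.1 hs.2
    have h3 := Metric.mem_ball'.1 ht.2
    exact (dist_triangle _ x _).trans (by linarith)
  refine (mul_le_mul_right h1 _).trans (le_of_eq ?_)
  rw [← ENNReal.ofReal_coe_nnreal, coe_nnnorm, ← ENNReal.ofReal_mul (norm_nonneg _),
    mul_div_cancel₀ _ h0'.ne', ENNReal.ofReal_mul (by norm_num), ENNReal.ofReal_ofNat]

/-- The curve that runs through `c₁` and then through `c₂`, the times being proportional to the
Lipschitz constants `a` and `b` of these curves. -/
def joinPaths (a b : ℝ≥0) (c₁ c₂ : ℝ → Rn n) (t : ℝ) : Rn n :=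
  if t * (a + b) ≤ a then c₁ (t * (a + b) / a) else c₂ ((t * (a + b) - a) / b)

theorem joinPaths_zero (a b : ℝ≥0) (c₁ c₂ : ℝ → Rn n) : joinPaths a b c₁ c₂ 0 = c₁ 0 := by
  simp [joinPaths]

section

variable {a b : ℝ≥0} {c₁ c₂ : ℝ → Rn n}

theorem joinPaths_mem {S : Set (Rn n)} (h₁ : ∀ t ∈ Icc (0 : ℝ) 1, c₁ t ∈ S)
    (h₂ : ∀ t ∈ Icc (0 : ℝ) 1, c₂ t ∈ S) {t : ℝ} (ht : t ∈ Icc (0 : ℝ) 1) :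
    joinPaths a b c₁ c₂ t ∈ S := by
  have ha := a.2
  have hb := b.2
  rw [joinPaths]
  split_ifs with h
  · exact h₁ _ ⟨div_nonneg (mul_nonneg ht.1 (by positivity)) a.2, div_le_one_of_le₀ h a.2⟩
  · push Not at h
    refine h₂ _ ⟨div_nonneg (by linarith) b.2, div_le_one_of_le₀ ?_ b.2⟩
    nlinarith [ht.2, a.coe_nonneg, b.coe_nonneg]

theorem joinPaths_one (h₁ : LipschitzOnWith a c₁ (Icc 0 1)) (h₂ : LipschitzOnWith b c₂ (Icc 0 1))
    (hc : c₁ 1 = c₂ 0) : joinPaths a b c₁ c₂ 1 = c₂ 1 := by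
  rw [joinPaths, one_mul]
  split_ifs with h
  · have hb : b = 0 := by
      ext
      have := b.coe_nonneg
      push_cast
      linarith
    have e2 : c₂ 0 = c₂ 1 := by
      have := h₂.dist_le_mul 0 (by simp) 1 (by simp)
      rw [hb, NNReal.coe_zero, zero_mul] at this
      exact dist_le_zero.1 this
    by_cases ha : a = 0
    · have e1 : c₁ 0 = c₁ 1 := by
        have := h₁.dist_le_mul 0 (by simp) 1 (by simp)
        rw [ha, NNReal.coe_zero, zero_mul] at this
        exact dist_le_zero.1 this
      simp [ha, e1, hc, e2]
    · have : (a : ℝ) ≠ 0 := by exact_mod_cast ha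
      rw [hb, NNReal.coe_zero, add_zero, div_self this, hc, e2]
  · have : (b : ℝ) ≠ 0 := fun hb => h (by rw [hb, add_zero])
    rw [add_sub_cancel_left, div_self this]

theorem mul_div_le_self_of_nonneg {a x : ℝ} (hx : 0 ≤ x) : a * (x / a) ≤ x := by
  by_cases ha : a = 0
  · simpa [ha] using hx
  · rw [mul_div_cancel₀ _ ha]

theorem lipschitzOnWith_joinPaths (h₁ : LipschitzOnWith a c₁ (Icc 0 1))
    (h₂ : LipschitzOnWith b c₂ (Icc 0 1)) (hc : c₁ 1 = c₂ 0) :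
    LipschitzOnWith (a + b) (joinPaths a b c₁ c₂) (Icc 0 1) := by
  have ha := a.coe_nonneg
  have hb := b.coe_nonneg
  have hu : ∀ t ∈ Icc (0 : ℝ) 1, t * (a + b) ≤ a → t * (a + b) / a ∈ Icc (0 : ℝ) 1 :=
    fun t ht h => ⟨div_nonneg (mul_nonneg ht.1 (by positivity)) ha, div_le_one_of_le₀ h ha⟩
  have hv : ∀ t ∈ Icc (0 : ℝ) 1, a < t * (a + b) → (t * (a + b) - a) / b ∈ Icc (0 : ℝ) 1 :=
    fun t ht h => ⟨div_nonneg (by linarith) hb, div_le_one_of_le₀ (by nlinarith [ht.2]) hb⟩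
  have key : ∀ s ∈ Icc (0 : ℝ) 1, ∀ t ∈ Icc (0 : ℝ) 1, s ≤ t →
      dist (joinPaths a b c₁ c₂ s) (joinPaths a b c₁ c₂ t) ≤ (a + b) * (t - s) := by
    intro s hs t ht hst
    have hst' : s * (a + b) ≤ t * (a + b) := mul_le_mul_of_nonneg_right hst (by positivity)
    by_cases h2 : t * (a + b) ≤ a
    · have h1 := hst'.trans h2
      rw [joinPaths, joinPaths, if_pos h1, if_pos h2]
      refine (h₁.dist_le_mul _ (hu s hs h1) _ (hu t ht h2)).trans ?_
      rw [Real.dist_eq, ← sub_div, abs_div, abs_of_nonneg ha, abs_sub_comm,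
        abs_of_nonneg (by linarith)]
      refine (mul_div_le_self_of_nonneg (by linarith)).trans (le_of_eq (by ring))
    by_cases h1 : s * (a + b) ≤ a
    · rw [joinPaths, joinPaths, if_pos h1, if_neg h2]
      push Not at h2
      have d1 := h₁.dist_le_mul _ (hu s hs h1) 1 (by simp)
      have d2 := h₂.dist_le_mul 0 (by simp) _ (hv t ht h2)
      rw [hc] at d1
      refine (dist_triangle _ _ _).trans ((add_le_add d1 d2).trans ?_)
      rw [Real.dist_eq, Real.dist_eq, abs_sub_comm, abs_of_nonneg (by linarith [(hu s hs h1).2]),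
        zero_sub, abs_neg, abs_of_nonneg (hv t ht h2).1]
      have e2 := mul_div_le_self_of_nonneg (a := b) (x := t * (a + b) - a) (by linarith)
      have e1 : a * (1 - s * (a + b) / a) ≤ a - s * (a + b) := by
        by_cases ha0 : (a : ℝ) = 0
        · rw [ha0] at h1 ⊢
          linarith
        · rw [mul_sub, mul_div_cancel₀ _ ha0, mul_one]
      linarith
    · rw [joinPaths, joinPaths, if_neg h1, if_neg h2]
      push Not at h1 h2
      refine (h₂.dist_le_mul _ (hv s hs h1) _ (hv t ht h2)).trans ?_
      rw [Real.dist_eq, ← sub_div, abs_div, abs_of_nonneg hb, abs_sub_comm,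
        abs_of_nonneg (by linarith)]
      refine (mul_div_le_self_of_nonneg (by linarith)).trans (le_of_eq (by ring))
  refine LipschitzOnWith.of_dist_le_mul fun s hs t ht => ?_
  push_cast
  rcases le_total s t with h | h
  · rw [Real.dist_eq, abs_sub_comm, abs_of_nonneg (sub_nonneg.2 h)]
    exact key s hs t ht h
  · rw [dist_comm, Real.dist_eq, abs_of_nonneg (sub_nonneg.2 h)]
    exact key t ht s hs h

/-- When a and b are positive, the first curve is run through in time a/(a + b), so the time it
spends in B is scaled by this factor, and multiplication by a + b restores a. The second curve is
treated alike, and degenerate constants separately. -/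
theorem mul_timeIn_joinPaths_le (a b : ℝ≥0) (c₁ c₂ : ℝ → Rn n) (B : Set (Rn n)) :
    (a + b : ℝ≥0) * timeIn (joinPaths a b c₁ c₂) B ≤ a * timeIn c₁ B + b * timeIn c₂ B := by
  have ha := a.coe_nonneg
  have hb := b.coe_nonneg
  set S₁ := {t : ℝ | t ∈ Icc (0 : ℝ) 1 ∧ t * (a + b) ≤ a ∧ c₁ (t * (a + b) / a) ∈ B}
  set S₂ := {t : ℝ | t ∈ Icc (0 : ℝ) 1 ∧ a < t * (a + b) ∧ c₂ ((t * (a + b) - a) / b) ∈ B}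
  have hsub : {t : ℝ | t ∈ Icc (0 : ℝ) 1 ∧ joinPaths a b c₁ c₂ t ∈ B} ⊆ S₁ ∪ S₂ := by
    rintro t ⟨ht, hB⟩
    rw [joinPaths] at hB
    split_ifs at hB with h
    · exact Or.inl ⟨ht, h, hB⟩
    · exact Or.inr ⟨ht, not_le.1 h, hB⟩
  have h1 : (a + b : ℝ≥0) * volume S₁ ≤ a * timeIn c₁ B := by
    by_cases hab : a + b = 0
    · simp [hab]
    have hab' : 0 < (a : ℝ) + b := by
      have : 0 < a + b := pos_iff_ne_zero.2 hab
      exact_mod_cast this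
    by_cases ha0 : a = 0
    · have : S₁ ⊆ {0} := by
        rintro t ⟨ht, h, -⟩
        rw [ha0] at h hab'
        simp only [NNReal.coe_zero, zero_add] at h hab'
        have : t ≤ 0 := nonpos_of_mul_nonpos_left h hab'
        exact le_antisymm this ht.1
      rw [measure_mono_null this (by simp), mul_zero]
      exact zero_le
    · have ha0' : 0 < (a : ℝ) := lt_of_le_of_ne ha (by exact_mod_cast Ne.symm ha0)
      have hs : S₁ ⊆ (fun t => t * ((a + b) / a)) ⁻¹' {t | t ∈ Icc (0 : ℝ) 1 ∧ c₁ t ∈ B} := by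
        rintro t ⟨ht, h, hB⟩
        simp only [mem_preimage, mem_ofPred_eq, ← mul_div_assoc]
        exact ⟨⟨div_nonneg (mul_nonneg ht.1 hab'.le) ha, div_le_one_of_le₀ h ha⟩, hB⟩
      refine (mul_le_mul_right (measure_mono hs) _).trans (le_of_eq ?_)
      rw [Real.volume_preimage_mul_right (by positivity), ← mul_assoc, timeIn]
      congr 1
      rw [← ENNReal.ofReal_coe_nnreal, ← ENNReal.ofReal_mul (by positivity),
        abs_of_nonneg (by positivity), ← ENNReal.ofReal_coe_nnreal]
      congr 1
      push_cast
      field_simp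
  have h2 : (a + b : ℝ≥0) * volume S₂ ≤ b * timeIn c₂ B := by
    by_cases hb0 : b = 0
    · have : S₂ ⊆ ∅ := by
        rintro t ⟨ht, h, -⟩
        rw [hb0] at h
        simp only [NNReal.coe_zero, add_zero] at h
        nlinarith [ht.2]
      rw [measure_mono_null this measure_empty, mul_zero]
      exact zero_le
    · have hb0' : 0 < (b : ℝ) := lt_of_le_of_ne hb (by exact_mod_cast Ne.symm hb0)
      have hs : S₂ ⊆ (fun t => t - a / (a + b)) ⁻¹' ((fun t => t * ((a + b) / b)) ⁻¹'
          {t | t ∈ Icc (0 : ℝ) 1 ∧ c₂ t ∈ B}) := by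
        rintro t ⟨ht, h, hB⟩
        have e : (t - a / (a + b)) * ((a + b) / b) = (t * (a + b) - a) / b := by
          field_simp
        simp only [mem_preimage, mem_ofPred_eq, e]
        exact ⟨⟨div_nonneg (by linarith) hb, div_le_one_of_le₀ (by nlinarith [ht.2]) hb⟩, hB⟩
      refine (mul_le_mul_right (measure_mono hs) _).trans (le_of_eq ?_)
      simp_rw [sub_eq_add_neg _ ((a : ℝ) / (a + b))]
      rw [measure_preimage_add_right, Real.volume_preimage_mul_right (by positivity), ← mul_assoc,
        timeIn]
      congr 1
      rw [← ENNReal.ofReal_coe_nnreal, ← ENNReal.ofReal_mul (by positivity),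
        abs_of_nonneg (by positivity), ← ENNReal.ofReal_coe_nnreal]
      congr 1
      push_cast
      field_simp
  calc (a + b : ℝ≥0) * timeIn (joinPaths a b c₁ c₂) B
      ≤ (a + b : ℝ≥0) * (volume S₁ + volume S₂) :=
        mul_le_mul_right ((measure_mono hsub).trans (measure_union_le _ _)) _
    _ ≤ _ := by rw [mul_add]; exact add_le_add h1 h2

end

/-- The length of the polygon with vertices `p 0, …, p m`. -/
def polygonLength (p : ℕ → Rn n) (m : ℕ) : ℝ≥0 :=
  ∑ k ∈ Finset.range m, ‖p (k + 1) - p k‖₊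

theorem exists_polygon (p : ℕ → Rn n) (m : ℕ) : ∃ c : ℝ → Rn n,
    LipschitzOnWith (polygonLength p m) c (Icc 0 1) ∧ c 0 = p 0 ∧ c 1 = p m ∧
    (∀ S : Set (Rn n), p 0 ∈ S → (∀ k < m, segment ℝ (p k) (p (k + 1)) ⊆ S) →
      ∀ t ∈ Icc (0 : ℝ) 1, c t ∈ S) ∧
    ∀ B : Set (Rn n), polygonLength p m * timeIn c B ≤ ∑ k ∈ Finset.range m,
      ‖p (k + 1) - p k‖₊ * timeIn (fun t : ℝ => AffineMap.lineMap (p k) (p (k + 1)) t) B := by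
  induction m with
  | zero =>
    exact ⟨fun _ => p 0, LipschitzOnWith.of_dist_le_mul fun s _ t _ => by simp [polygonLength],
      rfl, rfl, fun S h _ t _ => h, fun B => by simp [polygonLength]⟩
  | succ m ih =>
    obtain ⟨c, hL, h0, h1, hS, hB⟩ := ih
    have hl : LipschitzOnWith ‖p (m + 1) - p m‖₊
        (fun t : ℝ => AffineMap.lineMap (p m) (p (m + 1)) t) (Icc 0 1) :=
      (lipschitzWith_lineMap_sub _ _).lipschitzOnWith
    have hc : c 1 = (fun t : ℝ => AffineMap.lineMap (p m) (p (m + 1)) t) 0 := by simp [h1]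
    have e : polygonLength p (m + 1) = polygonLength p m + ‖p (m + 1) - p m‖₊ :=
      Finset.sum_range_succ _ _
    refine ⟨joinPaths (polygonLength p m) ‖p (m + 1) - p m‖₊ c
      (fun t : ℝ => AffineMap.lineMap (p m) (p (m + 1)) t), ?_, ?_, ?_, ?_, fun B => ?_⟩
    · rw [e]
      exact lipschitzOnWith_joinPaths hL hl hc
    · rw [joinPaths_zero, h0]
    · rw [joinPaths_one hL hl hc]
      simp
    · intro S hp hseg t ht
      refine joinPaths_mem (hS S hp fun k hk => hseg k (by omega)) (fun u hu => ?_) ht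
      refine hseg m (by omega) ?_
      rw [segment_eq_image_lineMap]
      exact ⟨u, hu, rfl⟩
    · rw [e, Finset.sum_range_succ]
      exact (mul_timeIn_joinPaths_le _ _ _ _ _).trans (add_le_add (hB B) le_rfl)

end Polygon

/-! ### Step chains, shortcuts and the bounded number of edges near a ball -/

section Chains

variable {n : ℕ} {U : Set (Rn n)} {x₀ : Rn n}

/-- A chain of points of `U` from `z` to `x₀` whose steps are short compared with the distance to
the complement of `U`. -/
structure IsStepChain (U : Set (Rn n)) (x₀ z : Rn n) (p : ℕ → Rn n) (m : ℕ) : Prop where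
  zero : p 0 = z
  last : p m = x₀
  mem : ∀ k ≤ m, p k ∈ U
  step : ∀ k < m, ‖p (k + 1) - p k‖ ≤ bdist U (p k) / 8

namespace IsStepChain

variable {z : Rn n} {p : ℕ → Rn n} {m : ℕ}

theorem norm_sub_le (h : IsStepChain U x₀ z p m) {k : ℕ} (hk : k < m) {q : Rn n}
    (hq : q ∈ segment ℝ (p k) (p (k + 1))) : ‖q - p k‖ ≤ bdist U (p k) / 8 :=
  (norm_sub_le_of_mem_segment hq).trans (h.step k hk)

theorem segment_subset (h : IsStepChain U x₀ z p m) (hU : IsOpen U) (hUn : Uᶜ.Nonempty) {k : ℕ}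
    (hk : k < m) : segment ℝ (p k) (p (k + 1)) ⊆ U := fun q hq => by
  have h1 := h.norm_sub_le hk hq
  have h2 := bdist_pos hU hUn (h.mem k hk.le)
  exact mem_of_norm_sub_lt_bdist (x := p k) (by linarith)

theorem prepend (h : IsStepChain U x₀ z p m) {y : Rn n} (hy : y ∈ U)
    (hyz : ‖z - y‖ ≤ bdist U y / 8) : ∃ q : ℕ → Rn n, IsStepChain U x₀ y q (m + 1) ∧
      polygonLength q (m + 1) = polygonLength p m + ‖z - y‖₊ := by
  refine ⟨fun k => Nat.casesOn k y p, ⟨rfl, h.last, ?_, ?_⟩, ?_⟩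
  · rintro (_ | k) hk
    · exact hy
    · exact h.mem k (by omega)
  · rintro (_ | k) hk
    · simpa [h.zero] using hyz
    · exact h.step k (by omega)
  · rw [polygonLength, Finset.sum_range_succ', polygonLength]
    simp [h.zero]

/-- A chord from vertex i to vertex j that is itself an admissible step replaces all steps in
between. By the triangle inequality the length does not grow, and at least one vertex disappears. -/
theorem shortcut (h : IsStepChain U x₀ z p m) {i j : ℕ} (hij : i + 1 < j) (hj : j ≤ m)
    (hd : ‖p j - p i‖ ≤ bdist U (p i) / 8) : ∃ q : ℕ → Rn n, ∃ l < m, IsStepChain U x₀ z q l ∧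
      polygonLength q l ≤ polygonLength p m := by
  obtain ⟨e, rfl⟩ : ∃ e, j = i + 1 + e := ⟨j - (i + 1), by omega⟩
  obtain ⟨f, rfl⟩ : ∃ f, m = i + 1 + e + f := ⟨m - (i + 1 + e), by omega⟩
  set q : ℕ → Rn n := fun k => if k ≤ i then p k else p (k + e) with hq
  have hq1 : ∀ k ≤ i, q k = p k := fun k hk => if_pos hk
  have hq2 : ∀ k, i < k → q k = p (k + e) := fun k hk => if_neg (not_le.2 hk)
  refine ⟨q, i + 1 + f, by omega, ⟨?_, ?_, ?_, ?_⟩, ?_⟩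
  · rw [hq1 0 (Nat.zero_le _), h.zero]
  · rw [hq2 _ (by omega), ← h.last]
    congr 1; omega
  · intro k hk
    rcases le_or_gt k i with hki | hki
    · rw [hq1 k hki]; exact h.mem k (by omega)
    · rw [hq2 k hki]; exact h.mem _ (by omega)
  · intro k hk
    rcases lt_trichotomy k i with hki | rfl | hki
    · rw [hq1 k hki.le, hq1 _ hki]; exact h.step k (by omega)
    · rw [hq1 k le_rfl, hq2 _ (by omega)]; exact hd
    · rw [hq2 k hki, hq2 _ (by omega), show k + 1 + e = k + e + 1 by ring]
      exact h.step _ (by omega)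
  · have e1 : polygonLength q (i + 1 + f) = ∑ k ∈ Finset.range i, ‖p (k + 1) - p k‖₊ +
        ‖p (i + 1 + e) - p i‖₊ + ∑ k ∈ Finset.range f, ‖p (i + 1 + e + k + 1) - p (i + 1 + e + k)‖₊ := by
      rw [polygonLength, Finset.sum_range_add, Finset.sum_range_succ]
      congr 1
      · congr 1
        · refine Finset.sum_congr rfl fun k hk => ?_
          have := Finset.mem_range.1 hk
          rw [hq1 k this.le, hq1 _ this]
        · rw [hq1 i le_rfl, hq2 _ (by omega)]
      · refine Finset.sum_congr rfl fun k hk => ?_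
        rw [hq2 _ (by omega), hq2 _ (by omega), show i + 1 + k + 1 + e = i + 1 + e + k + 1 by ring,
          show i + 1 + k + e = i + 1 + e + k by ring]
    have e2 : polygonLength p (i + 1 + e + f) = ∑ k ∈ Finset.range i, ‖p (k + 1) - p k‖₊ +
        ∑ k ∈ Finset.range (1 + e), ‖p (i + k + 1) - p (i + k)‖₊ +
        ∑ k ∈ Finset.range f, ‖p (i + 1 + e + k + 1) - p (i + 1 + e + k)‖₊ := by
      rw [polygonLength, Finset.sum_range_add, add_assoc i 1 e, Finset.sum_range_add]
    rw [e1, e2]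
    gcongr
    have h1 : p (i + 1 + e) - p i = ∑ k ∈ Finset.range (1 + e), (p (i + k + 1) - p (i + k)) := by
      rw [add_assoc i 1 e]
      exact (Finset.sum_range_sub (fun k => p (i + k)) (1 + e)).symm
    rw [h1]
    exact nnnorm_sum_le _ _

end IsStepChain

/-- Sample the curve finely enough that steps are shorter than an eighth of its least distance to
the complement. The length of the sampled polygon is one of the sums defining the variation. -/
theorem exists_isStepChain_of_curve (hU : IsOpen U) (hUn : Uᶜ.Nonempty) {z : Rn n} {c : ℝ → Rn n}
    (hc : ContinuousOn c (Icc 0 1)) (hm : MapsTo c (Icc 0 1) U) (h0 : c 0 = z) (h1 : c 1 = x₀) :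
    ∃ p m, IsStepChain U x₀ z p m ∧ (polygonLength p m : ℝ≥0∞) ≤ eVariationOn c (Icc 0 1) := by
  obtain ⟨t₀, ht₀, hmin⟩ := isCompact_Icc.exists_isMinOn (nonempty_Icc.2 zero_le_one)
    ((continuous_bdist U).comp_continuousOn hc)
  have hδ := bdist_pos hU hUn (hm ht₀)
  set δ := bdist U (c t₀)
  have huc := isCompact_Icc.uniformContinuousOn_of_continuous hc
  obtain ⟨η, hη, hlt⟩ := Metric.uniformContinuousOn_iff.1 huc (δ / 8) (by positivity)
  obtain ⟨N, hN⟩ := exists_nat_one_div_lt hη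
  have hN0 : (0 : ℝ) < N + 1 := by positivity
  -- Capping at 1 makes the sampling times monotone and contained in [0, 1] for every index.
  set u : ℕ → ℝ := fun k => min (k / ((N : ℝ) + 1)) 1 with hu
  have huI : ∀ k, u k ∈ Icc (0 : ℝ) 1 := fun k => ⟨le_min (by positivity) zero_le_one, min_le_right _ _⟩
  have humono : Monotone u := fun a b hab => by
    simp only [hu]
    gcongr
  refine ⟨fun k => c (u k), N + 1, ⟨?_, ?_, fun k _ => hm (huI k), fun k hk => ?_⟩, ?_⟩
  · simp [hu, h0]
  · have : u (N + 1) = 1 := by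
      simp only [hu]; push_cast; rw [div_self hN0.ne', min_self]
    rw [this, h1]
  · have hd : dist (u (k + 1)) (u k) < η := by
      have hk1 : ((k : ℝ) + 1) / (N + 1) ≤ 1 := by
        rw [div_le_one hN0]
        exact_mod_cast hk
      have hk2 : (k : ℝ) / (N + 1) ≤ 1 := le_trans (by gcongr; linarith) hk1
      simp only [hu]
      push_cast
      rw [min_eq_left hk1, min_eq_left hk2, Real.dist_eq, ← sub_div, add_sub_cancel_left,
        abs_of_pos (by positivity)]
      exact hN
    have h2 := hlt _ (huI (k + 1)) _ (huI k) hd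
    have h3 : δ ≤ bdist U (c (u k)) := hmin (huI k)
    rw [dist_eq_norm] at h2
    linarith
  · have := eVariationOn.sum_le (f := c) (s := Icc 0 1) (n := N + 1) humono huI
    refine le_trans (le_of_eq ?_) this
    rw [polygonLength]
    push_cast
    refine Finset.sum_congr rfl fun k _ => ?_
    rw [edist_eq_enorm_sub, enorm_eq_nnnorm]

theorem geodesicDist_le_polygonLength (hU : IsOpen U) (hUn : Uᶜ.Nonempty) {z : Rn n} {p : ℕ → Rn n}
    {m : ℕ} (h : IsStepChain U x₀ z p m) : geodesicDist U x₀ z ≤ polygonLength p m := by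
  obtain ⟨c, hL, h0, h1, hS, -⟩ := exists_polygon p m
  refine (iInf₂_le c ⟨hL.continuousOn, ?_, h0.trans h.zero, h1.trans h.last⟩).trans
    (eVariationOn_Icc_le_of_lipschitzOnWith hL)
  exact fun t ht => hS U (h.mem 0 (Nat.zero_le _)) (fun k hk => h.segment_subset hU hUn hk) t ht

theorem exists_isStepChain (hU : IsOpen U) (hUn : Uᶜ.Nonempty) (hUc : IsPreconnected U)
    (hx₀ : x₀ ∈ U) {y : Rn n} (hy : y ∈ U) : ∃ p m, IsStepChain U x₀ y p m := by
  set A := {y | y ∈ U ∧ ∃ p m, IsStepChain U x₀ y p m}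
  have hball : ∀ y ∈ U, ∀ᶠ z in 𝓝 y, ‖y - z‖ ≤ bdist U z / 8 ∧ ‖z - y‖ ≤ bdist U y / 8 ∧ z ∈ U :=
    fun y hy => by
    have hpos := bdist_pos hU hUn hy
    -- For |z - y| < d/9, with d the boundary distance of y, that of z exceeds 8d/9. A ninth of the
    -- former is thus at most an eighth of the latter, and steps are allowed in both directions.
    filter_upwards [Metric.ball_mem_nhds y (show 0 < bdist U y / 9 by positivity)] with z hz
    rw [mem_ball_iff_norm] at hz
    have h1 := bdist_le_add U y z
    rw [norm_sub_rev] at h1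
    refine ⟨by rw [norm_sub_rev]; linarith, by linarith, mem_of_norm_sub_lt_bdist (x := y) (by linarith)⟩
  have hAo : IsOpen A := isOpen_iff_mem_nhds.2 fun y hy => by
    obtain ⟨hyU, p, m, hp⟩ := hy
    filter_upwards [hball y hyU] with z hz
    obtain ⟨q, hq, -⟩ := hp.prepend hz.2.2 hz.1
    exact ⟨hz.2.2, q, _, hq⟩
  have hBo : IsOpen (U \ A) := isOpen_iff_mem_nhds.2 fun y hy => by
    filter_upwards [hball y hy.1] with z hz
    refine ⟨hz.2.2, fun hzA => hy.2 ⟨hy.1, ?_⟩⟩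
    obtain ⟨-, p, m, hp⟩ := hzA
    obtain ⟨q, hq, -⟩ := hp.prepend hy.1 hz.2.1
    exact ⟨q, _, hq⟩
  have hx₀A : x₀ ∈ A := ⟨hx₀, fun _ => x₀, 0, rfl, rfl, fun _ _ => hx₀, fun k hk => by omega⟩
  have hsub : U ⊆ A := hUc.subset_left_of_subset_union hAo hBo disjoint_sdiff_right
    (by rw [union_sdiff_self]; exact subset_union_right) ⟨x₀, hx₀, hx₀A⟩
  exact (hsub hy).2

theorem geodesicDist_lt_top (hU : IsOpen U) (hUn : Uᶜ.Nonempty) (hUc : IsPreconnected U)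
    (hx₀ : x₀ ∈ U) {y : Rn n} (hy : y ∈ U) : geodesicDist U x₀ y < ⊤ := by
  obtain ⟨p, m, h⟩ := exists_isStepChain hU hUn hUc hx₀ hy
  exact (geodesicDist_le_polygonLength hU hUn h).trans_lt ENNReal.coe_lt_top

theorem enorm_sub_le_geodesicDist (U : Set (Rn n)) (x₀ y : Rn n) :
    ‖y - x₀‖ₑ ≤ geodesicDist U x₀ y := by
  refine le_iInf₂ fun c hc => ?_
  rw [← hc.2.2.1, ← hc.2.2.2, ← edist_eq_enorm_sub]
  exact eVariationOn.edist_le _ (left_mem_Icc.2 zero_le_one) (right_mem_Icc.2 zero_le_one)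

theorem exists_isStepChain_le_two_mul (hU : IsOpen U) (hUn : Uᶜ.Nonempty) (hx₀ : x₀ ∈ U) {y : Rn n}
    (hlt : geodesicDist U x₀ y < ⊤) : ∃ p m, IsStepChain U x₀ y p m ∧
      (polygonLength p m : ℝ≥0∞) ≤ 2 * geodesicDist U x₀ y := by
  by_cases hyx : y = x₀
  · subst hyx
    exact ⟨fun _ => y, 0, ⟨rfl, rfl, fun _ _ => hx₀, fun k hk => by omega⟩, by simp [polygonLength]⟩
  · have hpos : 0 < geodesicDist U x₀ y :=
      lt_of_lt_of_le (by simpa [sub_eq_zero] using hyx) (enorm_sub_le_geodesicDist U x₀ y)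
    have h2 : geodesicDist U x₀ y < 2 * geodesicDist U x₀ y := by
      rw [two_mul]
      exact ENNReal.lt_add_right hlt.ne hpos.ne'
    obtain ⟨c, hc⟩ := iInf_lt_iff.1 h2
    obtain ⟨⟨h1, h2, h3, h4⟩, hlt'⟩ := iInf_lt_iff.1 hc
    obtain ⟨p, m, hp, hle⟩ := exists_isStepChain_of_curve hU hUn h1 h2 h3 h4
    exact ⟨p, m, hp, hle.trans hlt'.le⟩

theorem exists_isStepChain_separated (hU : IsOpen U) (hUn : Uᶜ.Nonempty) (hx₀ : x₀ ∈ U) {y : Rn n}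
    (hlt : geodesicDist U x₀ y < ⊤) : ∃ p m, IsStepChain U x₀ y p m ∧
      (polygonLength p m : ℝ≥0∞) ≤ 2 * geodesicDist U x₀ y ∧
      ∀ i j, i + 1 < j → j ≤ m → bdist U (p i) / 8 < ‖p j - p i‖ := by
  classical
  have hex : ∃ m, ∃ p, IsStepChain U x₀ y p m ∧
      (polygonLength p m : ℝ≥0∞) ≤ 2 * geodesicDist U x₀ y := by
    obtain ⟨p, m, h⟩ := exists_isStepChain_le_two_mul hU hUn hx₀ hlt
    exact ⟨m, p, h⟩
  obtain ⟨p, hp, hle⟩ := Nat.find_spec hex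
  refine ⟨p, Nat.find hex, hp, hle, fun i j hij hj => ?_⟩
  by_contra hd
  obtain ⟨q, l, hl, hq, hql⟩ := hp.shortcut hij hj (not_lt.1 hd)
  exact Nat.find_min hex hl ⟨q, hq, le_trans (by exact_mod_cast hql) hle⟩

theorem card_le_two_of_forall_le_add_one {s : Finset ℕ} (h : ∀ i ∈ s, ∀ j ∈ s, j ≤ i + 1) :
    s.card ≤ 2 := by
  rcases s.eq_empty_or_nonempty with rfl | hs
  · simp
  · have : s ⊆ {s.min' hs, s.min' hs + 1} := fun j hj => by
      have h1 := h _ (s.min'_mem hs) j hj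
      have h2 := s.min'_le j hj
      simp only [Finset.mem_insert, Finset.mem_singleton]
      omega
    exact (Finset.card_le_card this).trans Finset.card_le_two

/-- Cover the unit ball by balls of radius 1/40. Points in the same small ball are less than 1/20 <
1/18 apart, so their indices are adjacent and each small ball receives at most two. -/
theorem exists_card_le_of_separated (n : ℕ) : ∃ N : ℕ, ∀ (s : Finset ℕ) (q : ℕ → Rn n),
    (∀ i ∈ s, ‖q i‖ ≤ 1) → (∀ i ∈ s, ∀ j ∈ s, i + 1 < j → 1 / 18 < ‖q j - q i‖) → s.card ≤ N := by
  classical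
  obtain ⟨t, -, ht, hcov⟩ := (isCompact_closedBall (0 : Rn n) 1).finite_cover_balls
    (show (0 : ℝ) < 1 / 40 by norm_num)
  refine ⟨2 * ht.toFinset.card, fun s q h1 h2 => ?_⟩
  have hex : ∀ i ∈ s, ∃ a ∈ t, ‖q i - a‖ < 1 / 40 := fun i hi => by
    have := hcov (show q i ∈ Metric.closedBall 0 1 by simpa using h1 i hi)
    simpa [dist_eq_norm] using this
  choose! f hft hf using hex
  have hmaps : s.image f ⊆ ht.toFinset := fun a ha => by
    obtain ⟨i, hi, rfl⟩ := Finset.mem_image.1 ha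
    exact ht.mem_toFinset.2 (hft i hi)
  refine (Finset.card_le_mul_card_image s 2 fun a _ => ?_).trans
    (Nat.mul_le_mul_left _ (Finset.card_le_card hmaps))
  refine card_le_two_of_forall_le_add_one fun i hi j hj => ?_
  rw [Finset.mem_filter] at hi hj
  by_contra hlt
  have h3 := h2 i hi.1 j hj.1 (not_le.1 hlt)
  have h4 := hf i hi.1
  have h5 := hf j hj.1
  rw [hi.2] at h4
  rw [hj.2] at h5
  have h6 := norm_sub_le_norm_sub_add_norm_sub (q j) a (q i)
  rw [norm_sub_rev a] at h6
  linarith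

/-- An edge meeting B(x, r), with r ≤ d/2 and d = d̂(x), starts at a vertex within d of x whose
boundary distance is at least 4d/9. Separation by an eighth of that is d/18, so after rescaling by d
the number of such edges is bounded, and each contributes at most 2r. -/
theorem exists_sum_timeIn_le (n : ℕ) : ∃ N : ℕ, ∀ {U : Set (Rn n)} {x₀ z : Rn n} {p : ℕ → Rn n}
    {m : ℕ}, IsOpen U → Uᶜ.Nonempty → IsStepChain U x₀ z p m →
    (∀ i j, i + 1 < j → j ≤ m → bdist U (p i) / 8 < ‖p j - p i‖) →
    ∀ x ∈ U, ∀ r : ℝ, 0 < r → r ≤ bdist U x / 2 → ∑ k ∈ Finset.range m, ‖p (k + 1) - p k‖₊ *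
      timeIn (fun t : ℝ => AffineMap.lineMap (p k) (p (k + 1)) t) (Metric.ball x r) ≤
        N * (2 * ENNReal.ofReal r) := by
  classical
  obtain ⟨N, hN⟩ := exists_card_le_of_separated n
  refine ⟨N, fun {U x₀ z p m} hU hUn hp hsep x hx r hr hrx => ?_⟩
  have hd := bdist_pos hU hUn hx
  set d := bdist U x
  set s := (Finset.range m).filter fun k => (segment ℝ (p k) (p (k + 1)) ∩ Metric.ball x r).Nonempty
  have hs : ∀ k ∈ s, 4 / 9 * d ≤ bdist U (p k) ∧ ‖p k - x‖ ≤ d := fun k hk => by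
    obtain ⟨hk, q, hq, hqx⟩ := Finset.mem_filter.1 hk
    have h1 := hp.norm_sub_le (Finset.mem_range.1 hk) hq
    rw [mem_ball_iff_norm] at hqx
    have h2 := bdist_le_add U x q
    have h3 := bdist_le_add U q (p k)
    have h4 := bdist_le_add U (p k) q
    have h5 := bdist_le_add U q x
    have h6 := norm_sub_le_norm_sub_add_norm_sub (p k) q x
    rw [norm_sub_rev x q] at h2
    rw [norm_sub_rev (p k) q] at h4 h6
    constructor <;> linarith
  have hcard : s.card ≤ N := by
    refine hN s (fun k => d⁻¹ • (p k - x)) (fun k hk => ?_) fun i hi j hj hij => ?_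
    · rw [norm_smul, norm_inv, Real.norm_of_nonneg hd.le, inv_mul_le_one₀ hd]
      exact (hs k hk).2
    · have h1 := hsep i j hij (Finset.mem_range.1 (Finset.mem_filter.1 hj).1).le
      have h2 := (hs i hi).1
      rw [← smul_sub, sub_sub_sub_cancel_right, norm_smul, norm_inv, Real.norm_of_nonneg hd.le,
        lt_inv_mul_iff₀ hd]
      linarith
  calc ∑ k ∈ Finset.range m, ‖p (k + 1) - p k‖₊ *
        timeIn (fun t : ℝ => AffineMap.lineMap (p k) (p (k + 1)) t) (Metric.ball x r)
      = ∑ k ∈ s, ‖p (k + 1) - p k‖₊ *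
        timeIn (fun t : ℝ => AffineMap.lineMap (p k) (p (k + 1)) t) (Metric.ball x r) := by
        refine (Finset.sum_subset (Finset.filter_subset _ _) fun k hk hks => ?_).symm
        have : {t : ℝ | t ∈ Icc (0 : ℝ) 1 ∧
            AffineMap.lineMap (p k) (p (k + 1)) t ∈ Metric.ball x r} = ∅ := by
          refine eq_empty_of_forall_notMem fun t ht => hks (Finset.mem_filter.2 ⟨hk, _, ?_, ht.2⟩)
          rw [segment_eq_image_lineMap]
          exact ⟨t, ht.1, rfl⟩
        rw [timeIn, this, measure_empty, mul_zero]
    _ ≤ ∑ k ∈ s, 2 * ENNReal.ofReal r := Finset.sum_le_sum fun k _ => mul_timeIn_lineMap_le _ _ x r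
    _ = s.card * (2 * ENNReal.ofReal r) := by rw [Finset.sum_const, nsmul_eq_mul]
    _ ≤ N * (2 * ENNReal.ofReal r) := by gcongr

end Chains

/-! ### Construction of path systems -/

section Existence

variable {n : ℕ} {U : Set (Rn n)} {x₀ : Rn n}

/-- A curve from `z` to `x₀` in `U` with Lipschitz constant `L ≤ 2 d_U(z)` that spends a time
`≤ N r / L` in each ball of radius `r` that lies well inside `U`. -/
structure IsRegularCurve (U : Set (Rn n)) (x₀ z : Rn n) (N : ℕ) (c : ℝ → Rn n) (L : ℝ≥0) :
    Prop where
  continuous : Continuous c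
  lipschitz : LipschitzOnWith L c (Icc 0 1)
  start : c 0 = z
  finish : c 1 = x₀
  mem : ∀ t ∈ Icc (0 : ℝ) 1, c t ∈ U
  le : (L : ℝ≥0∞) ≤ 2 * geodesicDist U x₀ z
  timeIn_le : ∀ x ∈ U, ∀ r : ℝ, 0 < r → r ≤ bdist U x / 2 →
    L * timeIn c (Metric.ball x r) ≤ N * (2 * ENNReal.ofReal r)

theorem exists_isRegularCurve (n : ℕ) : ∃ N : ℕ, ∀ {U : Set (Rn n)} {x₀ z : Rn n}, IsOpen U →
    Uᶜ.Nonempty → x₀ ∈ U → geodesicDist U x₀ z < ⊤ → ∃ c L, IsRegularCurve U x₀ z N c L := by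
  obtain ⟨N, hN⟩ := exists_sum_timeIn_le n
  refine ⟨N, fun {U x₀ z} hU hUn hx₀ hlt => ?_⟩
  obtain ⟨p, m, hp, hle, hsep⟩ := exists_isStepChain_separated hU hUn hx₀ hlt
  obtain ⟨c, hL, h0, h1, hS, hT⟩ := exists_polygon p m
  have he : ∀ t ∈ Icc (0 : ℝ) 1, IccExtend zero_le_one ((Icc (0 : ℝ) 1).domRestrict c) t = c t :=
    fun t ht => IccExtend_of_mem _ _ ht
  refine ⟨IccExtend zero_le_one ((Icc (0 : ℝ) 1).domRestrict c), polygonLength p m,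
    hL.continuousOn.domRestrict.Icc_extend', fun s hs t ht => ?_, ?_, ?_, fun t ht => ?_, hle,
    fun x hx r hr hrx => ?_⟩
  · rw [he s hs, he t ht]; exact hL hs ht
  · rw [he 0 (by simp), h0, hp.zero]
  · rw [he 1 (by simp), h1, hp.last]
  · rw [he t ht]
    exact hS U (hp.mem 0 (Nat.zero_le _)) (fun k hk => hp.segment_subset hU hUn hk) t ht
  · have : timeIn (IccExtend zero_le_one ((Icc (0 : ℝ) 1).domRestrict c)) (Metric.ball x r) =
        timeIn c (Metric.ball x r) := by
      unfold timeIn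
      congr 1
      ext t
      exact and_congr_right fun ht => by rw [he t ht]
    rw [this]
    exact (hT _).trans (hN hU hUn hp hsep x hx r hr hrx)

/-- The point `y` is close to the node `z`, compared with the distances of `y` and `x₀` to the
complement of `U`. -/
def IsNear (U : Set (Rn n)) (x₀ z y : Rn n) : Prop :=
  ‖z - y‖ < min (bdist U y) (bdist U x₀) / 9

theorem isOpen_isNear (U : Set (Rn n)) (x₀ z : Rn n) : IsOpen {y | IsNear U x₀ z y} :=
  isOpen_lt (by fun_prop) (((continuous_bdist U).min continuous_const).div_const 9)

theorem IsNear.norm_lt {z y : Rn n} (h : IsNear U x₀ z y) : ‖z - y‖ < bdist U y / 9 :=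
  h.trans_le (by gcongr; exact min_le_left _ _)

theorem IsNear.lineMap_mem {z y : Rn n} (h : IsNear U x₀ z y) {t : ℝ} (ht : t ∈ Icc (0 : ℝ) 1) :
    AffineMap.lineMap y z t ∈ U ∧ 7 / 8 * bdist U y ≤ bdist U (AffineMap.lineMap y z t) := by
  have h1 := h.norm_lt
  have h2 : ‖(AffineMap.lineMap y z t : Rn n) - y‖ ≤ ‖z - y‖ := by
    rw [← dist_eq_norm, dist_lineMap_left, Real.norm_of_nonneg ht.1, dist_eq_norm, norm_sub_rev]
    exact mul_le_of_le_one_left (norm_nonneg _) ht.2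
  have h3 := bdist_le_add U y (AffineMap.lineMap y z t)
  rw [norm_sub_rev] at h3
  have h4 := norm_nonneg (z - y)
  exact ⟨mem_of_norm_sub_lt_bdist (x := y) (by linarith), by linarith⟩

theorem exists_nodes (hU : IsOpen U) (hUn : Uᶜ.Nonempty) (hx₀ : x₀ ∈ U) : ∃ z : ℕ → Rn n,
    z 0 = x₀ ∧ (∀ i, z i ∈ U) ∧ ∀ y ∈ U, ∃ i, IsNear U x₀ (z i) y := by
  have : Nonempty U := ⟨⟨x₀, hx₀⟩⟩
  refine ⟨fun i => Nat.casesOn i x₀ fun i => (TopologicalSpace.denseSeq U i : Rn n), rfl, ?_,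
    fun y hy => ?_⟩
  · rintro (_ | i)
    · exact hx₀
    · exact (TopologicalSpace.denseSeq U i).2
  · have hpos : 0 < min (bdist U y) (bdist U x₀) / 9 := by
      have := lt_min (bdist_pos hU hUn hy) (bdist_pos hU hUn hx₀)
      positivity
    obtain ⟨i, hi⟩ := (TopologicalSpace.denseRange_denseSeq U).exists_dist_lt ⟨y, hy⟩ hpos
    refine ⟨i + 1, ?_⟩
    rwa [dist_comm, Subtype.dist_eq, dist_eq_norm] at hi

/-- The curve that runs straight from `y` to a node and then along the curve of that node. -/
def spokePath (z : Rn n) (L : ℝ≥0) (c : ℝ → Rn n) (t : ℝ) (y : Rn n) : Rn n :=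
  joinPaths ‖z - y‖₊ L (fun u : ℝ => AffineMap.lineMap y z u) c t

theorem measurable_spokePath (z : Rn n) (L : ℝ≥0) {c : ℝ → Rn n} (hc : Continuous c) :
    Measurable fun p : ℝ × Rn n => spokePath z L c p.1 p.2 := by
  have ha : Measurable fun p : ℝ × Rn n => ((‖z - p.2‖₊ : ℝ≥0) : ℝ) :=
    (measurable_snd.const_sub z).norm
  have hs : Measurable fun p : ℝ × Rn n => p.1 * ((‖z - p.2‖₊ : ℝ≥0) + (L : ℝ)) :=
    measurable_fst.mul (ha.add_const _)
  refine Measurable.ite (measurableSet_le hs ha) ?_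
    (hc.measurable.comp ((hs.sub ha).div_const _))
  simp only [AffineMap.lineMap_apply_module]
  exact (((hs.div ha).const_sub 1).smul measurable_snd).add ((hs.div ha).smul measurable_const)

namespace IsRegularCurve

variable {z y : Rn n} {N : ℕ} {c : ℝ → Rn n} {L : ℝ≥0}

theorem spokePath_zero (z : Rn n) (L : ℝ≥0) (c : ℝ → Rn n) (y : Rn n) :
    spokePath z L c 0 y = y := by
  rw [spokePath, joinPaths_zero, AffineMap.lineMap_apply_zero]

theorem spokePath_one (h : IsRegularCurve U x₀ z N c L) (y : Rn n) :
    spokePath z L c 1 y = x₀ := by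
  rw [spokePath, joinPaths_one (lipschitzWith_lineMap_sub y z).lipschitzOnWith h.lipschitz, h.finish]
  rw [AffineMap.lineMap_apply_one, h.start]

theorem lipschitzOnWith_spokePath (h : IsRegularCurve U x₀ z N c L) (y : Rn n) :
    LipschitzOnWith (‖z - y‖₊ + L) (fun t => spokePath z L c t y) (Icc 0 1) :=
  lipschitzOnWith_joinPaths (lipschitzWith_lineMap_sub y z).lipschitzOnWith h.lipschitz (by
    rw [AffineMap.lineMap_apply_one, h.start])

theorem lengthIn_spokePath_le (h : IsRegularCurve U x₀ z N c L) (y : Rn n) {x : Rn n} (hx : x ∈ U)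
    {r : ℝ} (hr : 0 < r) (hrx : r ≤ bdist U x / 2) :
    lengthIn (fun t => spokePath z L c t y) (Metric.ball x r) ≤
      (2 + 2 * N : ℝ≥0) * ENNReal.ofReal r := by
  refine (lengthIn_le_mul_timeIn (h.lipschitzOnWith_spokePath y) _).trans
    ((mul_timeIn_joinPaths_le _ _ _ _ _).trans ?_)
  refine (add_le_add (mul_timeIn_lineMap_le y z x r) (h.timeIn_le x hx r hr hrx)).trans
    (le_of_eq ?_)
  push_cast
  ring

/-- If the node is x₀, its curve is constant and only the straight piece counts. Otherwise y is not
near x₀, so the straight piece is no longer than |y - x₀|, hence than the geodesic distance D of y.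
The node then has geodesic distance at most 3D and a curve of constant at most 6D, which gives 7D in
all. -/
theorem add_le_mul_geodesicDist (h : IsRegularCurve U x₀ z N c L) (hU : IsOpen U)
    (hUn : Uᶜ.Nonempty) (hx₀ : x₀ ∈ U) (hz : z ∈ U) (hzy : IsNear U x₀ z y)
    (hlt : geodesicDist U x₀ y < ⊤) (hor : z = x₀ ∨ ¬IsNear U x₀ x₀ y) :
    ((‖z - y‖₊ + L : ℝ≥0) : ℝ≥0∞) ≤ 7 * geodesicDist U x₀ y := by
  have hge := enorm_sub_le_geodesicDist U x₀ y
  push_cast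
  rcases hor with rfl | hfar
  · have h0 : geodesicDist U z z = 0 := by
      refine le_antisymm ((geodesicDist_le_of_segment_subset ?_).trans (by simp)) zero_le
      simpa using hz
    have hL : (L : ℝ≥0∞) = 0 := le_antisymm (h.le.trans (by rw [h0, mul_zero])) zero_le
    rw [hL, add_zero, ← enorm_eq_nnnorm, ← enorm_neg, neg_sub]
    refine hge.trans ?_
    conv_lhs => rw [← one_mul (geodesicDist U z y)]
    gcongr
    norm_num
  · have h2 : (‖z - y‖₊ : ℝ≥0∞) ≤ geodesicDist U x₀ y := by
      refine le_trans ?_ hge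
      rw [IsNear, not_lt, norm_sub_rev] at hfar
      rw [← enorm_eq_nnnorm, ← ofReal_norm, ← ofReal_norm]
      exact ENNReal.ofReal_le_ofReal (hzy.le.trans hfar)
    have h3 : geodesicDist U x₀ z ≤ 2 * geodesicDist U x₀ y + ‖z - y‖₊ := by
      obtain ⟨p, m, hp, hle⟩ := exists_isStepChain_le_two_mul hU hUn hx₀ hlt
      have hlt' := hzy.norm_lt
      have hbz := bdist_le_add U y z
      rw [norm_sub_rev] at hbz
      obtain ⟨q, hq, hql⟩ := hp.prepend hz (by rw [norm_sub_rev]; linarith)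
      refine (geodesicDist_le_polygonLength hU hUn hq).trans ?_
      rw [hql, ← nnnorm_neg (y - z), neg_sub]
      push_cast
      gcongr
    calc (‖z - y‖₊ : ℝ≥0∞) + L
        ≤ geodesicDist U x₀ y + 2 * (2 * geodesicDist U x₀ y + geodesicDist U x₀ y) :=
          add_le_add h2 (h.le.trans (mul_le_mul_right (h3.trans (by gcongr)) _))
      _ = 7 * geodesicDist U x₀ y := by ring

end IsRegularCurve

/-- Taking the first near node makes the choice measurable and gives preference to node 0, which
will be x₀; the length bound relies on that preference. -/
theorem exists_index (hU : IsOpen U) {z : ℕ → Rn n} (hz : ∀ y ∈ U, ∃ i, IsNear U x₀ (z i) y) :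
    ∃ ι : Rn n → ℕ, Measurable ι ∧ (∀ y ∈ U, IsNear U x₀ (z (ι y)) y) ∧
      (∀ y, ι y = 0 ∨ ¬IsNear U x₀ (z 0) y) ∧ ∀ y i, IsNear U x₀ (z i) y → ι y ≤ i := by
  classical
  have hex : ∀ y, ∃ i, IsNear U x₀ (z i) y ∨ y ∉ U := fun y => by
    by_cases hy : y ∈ U
    · obtain ⟨i, hi⟩ := hz y hy
      exact ⟨i, Or.inl hi⟩
    · exact ⟨0, Or.inr hy⟩
  refine ⟨fun y => Nat.find (hex y), measurable_find hex fun k =>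
    (isOpen_isNear U x₀ (z k)).measurableSet.union hU.measurableSet.compl,
    fun y hy => (Nat.find_spec (hex y)).resolve_right (not_not.2 hy), fun y => ?_,
    fun y i hi => Nat.find_le (Or.inl hi)⟩
  by_cases h0 : Nat.find (hex y) = 0
  · exact Or.inl h0
  · exact Or.inr fun h => Nat.find_min (hex y) (Nat.pos_of_ne_zero h0) (Or.inl h)

theorem measurable_comp_index {ι : Rn n → ℕ} (hι : Measurable ι) {f : ℕ → ℝ → Rn n → Rn n}
    (hf : ∀ i, Measurable fun p : ℝ × Rn n => f i p.1 p.2) :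
    Measurable fun p : ℝ × Rn n => f (ι p.2) p.1 p.2 := by
  have h : Measurable fun q : ℕ × (ℝ × Rn n) => f q.1 q.2.1 q.2.2 :=
    measurable_from_prod_countable_right hf
  exact h.comp ((hι.comp measurable_snd).prodMk measurable_id)

/-- The closure of the inner set is a compact subset of U, so finitely many of the open nearness
regions cover it and the first index is bounded there. Only finitely many node curves occur, each at
positive distance from the complement, and the straight pieces keep 7/8 of the boundary distance of
y. -/
theorem inner_spokePath (hU : IsOpen U) (hUb : Bornology.IsBounded U) (hUn : Uᶜ.Nonempty)
    {z : ℕ → Rn n} {N : ℕ} {c : ℕ → ℝ → Rn n} {L : ℕ → ℝ≥0}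
    (hc : ∀ i, IsRegularCurve U x₀ (z i) N (c i) (L i))
    (hz : ∀ y ∈ U, ∃ i, IsNear U x₀ (z i) y) {ι : Rn n → ℕ}
    (hιn : ∀ y ∈ U, IsNear U x₀ (z (ι y)) y) (hιle : ∀ y i, IsNear U x₀ (z i) y → ι y ≤ i) :
    ∀ ε > 0, ∃ δ > 0, ∀ y ∈ innerSet U ε, ∀ t ∈ Icc (0 : ℝ) 1,
      spokePath (z (ι y)) (L (ι y)) (c (ι y)) t y ∈ innerSet U δ := by
  intro ε hε
  set F := closure (innerSet U ε)
  have hFb : ∀ y ∈ F, ε ≤ bdist U y := fun y hy => by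
    have hcl : IsClosed {y | ε ≤ bdist U y} := isClosed_le continuous_const (continuous_bdist U)
    exact closure_minimal (fun y hy => le_of_lt hy.2) hcl hy
  have hFU : F ⊆ U := fun y hy => by
    refine mem_of_norm_sub_lt_bdist (x := y) ?_
    rw [sub_self, norm_zero]
    exact hε.trans_le (hFb y hy)
  have hFc : IsCompact F := (hUb.subset fun y hy => hy.1).isCompact_closure
  obtain ⟨I, hI⟩ := hFc.elim_finite_subcover (fun i => {y | IsNear U x₀ (z i) y})
    (fun i => isOpen_isNear U x₀ (z i)) fun y hy => by
      obtain ⟨i, hi⟩ := hz y (hFU hy)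
      exact mem_iUnion.2 ⟨i, hi⟩
  have hιI : ∀ y ∈ F, ι y ∈ Finset.range (I.sup id + 1) := fun y hy => by
    obtain ⟨i, hi, hn⟩ := mem_iUnion₂.1 (hI hy)
    have h1 : ι y ≤ i := hιle y i hn
    have h2 : i ≤ I.sup id := Finset.le_sup (f := id) hi
    rw [Finset.mem_range]
    omega
  have hcurve : ∀ i, ∀ᶠ δ in 𝓝[>] (0 : ℝ), ∀ t ∈ Icc (0 : ℝ) 1, δ < bdist U (c i t) := fun i => by
    obtain ⟨t₀, ht₀, hmin⟩ := isCompact_Icc.exists_isMinOn (nonempty_Icc.2 zero_le_one)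
      ((continuous_bdist U).comp (hc i).continuous).continuousOn
    filter_upwards [mem_nhdsWithin_of_mem_nhds
      (Iio_mem_nhds (bdist_pos hU hUn ((hc i).mem t₀ ht₀)))] with δ hδ t ht
    exact lt_of_lt_of_le hδ (hmin ht)
  have hall : ∀ᶠ δ in 𝓝[>] (0 : ℝ), ∀ i ∈ Finset.range (I.sup id + 1),
      ∀ t ∈ Icc (0 : ℝ) 1, δ < bdist U (c i t) :=
    (Filter.eventually_all_finset _).2 fun i _ => hcurve i
  obtain ⟨δ, ⟨hδ, hδε⟩, hδ0⟩ := ((hall.and (mem_nhdsWithin_of_mem_nhds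
    (Iio_mem_nhds (show 0 < 7 / 8 * ε by positivity)))).and self_mem_nhdsWithin).exists
  refine ⟨δ, hδ0, fun y hy t ht => ?_⟩
  have hyF : y ∈ F := subset_closure hy
  refine joinPaths_mem (S := innerSet U δ) (fun u hu => ?_)
    (fun u hu => ⟨(hc _).mem u hu, hδ _ (hιI y hyF) u hu⟩) ht
  obtain ⟨h1, h2⟩ := (hιn y hy.1).lineMap_mem hu
  have h3 : δ < 7 / 8 * ε := hδε
  have h4 := hFb y hyF
  exact ⟨h1, by linarith⟩

theorem exists_isPathSystem {Ω : Set (Rn n)} (hU : IsOpen U) (hUc : IsConnected U)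
    (hUb : Bornology.IsBounded U) (hUn : Uᶜ.Nonempty) (hΩU : Ω ⊆ U) (hx₀ : x₀ ∈ U) :
    ∃ γ : ℝ → Rn n → Rn n, IsPathSystem Ω U x₀ γ := by
  obtain ⟨N, hN⟩ := exists_isRegularCurve n
  obtain ⟨z, hz0, hzU, hz⟩ := exists_nodes hU hUn hx₀
  have hlt : ∀ y ∈ U, geodesicDist U x₀ y < ⊤ := fun y hy =>
    geodesicDist_lt_top hU hUn hUc.isPreconnected hx₀ hy
  choose c L hc using fun i => hN hU hUn hx₀ (hlt (z i) (hzU i))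
  obtain ⟨ι, hιm, hιn, hι0, hιle⟩ := exists_index hU hz
  rw [hz0] at hι0
  have hlip : ∀ y, LipschitzOnWith (‖z (ι y) - y‖₊ + L (ι y))
      (fun t => spokePath (z (ι y)) (L (ι y)) (c (ι y)) t y) (Icc 0 1) :=
    fun y => (hc (ι y)).lipschitzOnWith_spokePath y
  have hle : ∀ y ∈ U, ((‖z (ι y) - y‖₊ + L (ι y) : ℝ≥0) : ℝ≥0∞) ≤ 7 * geodesicDist U x₀ y :=
    fun y hy => (hc (ι y)).add_le_mul_geodesicDist hU hUn hx₀ (hzU _) (hιn y hy) (hlt y hy)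
      ((hι0 y).imp_left fun h => by rw [h, hz0])
  obtain ⟨γ, hγ⟩ : ∃ γ : ℝ → Rn n → Rn n,
      ∀ t y, γ t y = spokePath (z (ι y)) (L (ι y)) (c (ι y)) t y := ⟨_, fun _ _ => rfl⟩
  have hγf : ∀ y, (fun t => γ t y) = fun t => spokePath (z (ι y)) (L (ι y)) (c (ι y)) t y :=
    fun y => funext fun t => hγ t y
  have hγm : Measurable fun p : ℝ × Rn n => γ p.1 p.2 := by
    simp_rw [hγ]
    exact measurable_comp_index hιm (f := fun i t y => spokePath (z i) (L i) (c i) t y) fun i =>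
      measurable_spokePath (z i) (L i) (hc i).continuous
  have hpm : Measurable fun p : Icc (0 : ℝ) 1 × U => ((p.1 : ℝ), (p.2 : Rn n)) :=
    (measurable_subtype_coe.comp measurable_fst).prodMk
      (measurable_subtype_coe.comp measurable_snd)
  refine ⟨γ, fun y hy t ht => ?_, fun y _ => ?_, fun y _ => ?_, hγm.comp hpm, ?_, ?_, ?_⟩
  · rw [hγ]
    exact joinPaths_mem (fun u hu => ((hιn y hy).lineMap_mem hu).1) (hc _).mem ht
  · rw [hγ]
    exact IsRegularCurve.spokePath_zero _ _ _ y
  · rw [hγ]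
    exact (hc _).spokePath_one y
  · refine ⟨2 + 2 * N, fun x hx y _ r hr hrx => ?_⟩
    rw [hγf]
    exact (hc _).lengthIn_spokePath_le y (hΩU hx) hr hrx
  · refine ⟨7, fun y hy => ⟨?_, fun s hs t ht => ?_⟩⟩
    · rw [hγf]
      exact (eVariationOn_Icc_le_of_lipschitzOnWith (hlip y)).trans (hle y hy)
    · rw [hγ, hγ]
      exact (hlip y hs ht).trans (mul_le_mul_left (hle y hy) _)
  · simp_rw [hγ]
    exact inner_spokePath hU hUb hUn hc hz hιn hιle

end Existence
end
-- Assembly of the theorem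
theorem mainTheorem2 (n : ℕ) (hn : 1 ≤ n)
    -- a bounded domain, a point in it and a cover of it by a set of the same Lebesgue measure
    (Ω : Set (Rn n)) (hΩo : IsOpen Ω) (hΩc : IsConnected Ω) (hΩb : Bornology.IsBounded Ω)
    (x₀ : Rn n) (hx₀ : x₀ ∈ Ω)
    (T : Set (Rn n)) (hΩT : Ω ⊆ T) (hT : volume (T \ Ω) = 0) :
    (∃ γ : ℝ → Rn n → Rn n, IsPathSystem Ω (hatSet T) x₀ γ) ∧
    ∀ γ : ℝ → Rn n → Rn n, IsPathSystem Ω (hatSet T) x₀ γ →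
    ∀ s : ℝ, 0 < s → Metric.closedBall x₀ s ⊆ Ω → 15 * s ≤ bdist (hatSet T) x₀ →
    ∀ χ : Rn n → ℝ, ContDiff ℝ ∞ χ → tsupport χ ⊆ Metric.closedBall x₀ s → ∫ x, χ x = 1 →
    ∃ C : ℝ, 0 < C ∧
      ∀ μ₀ : Measure (Rn n), IsFiniteMeasure μ₀ → μ₀ Ωᶜ = 0 → μ₀ ≠ 0 →
        ∫⁻ x in Ω, geodesicDist (hatSet T) x₀ x ∂μ₀ < ⊤ →
        -- the weight is integrable and positive
        (AEMeasurable (weight Ω (hatSet T) γ μ₀) (volume.restrict Ω) ∧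
          ∫⁻ x in Ω, weight Ω (hatSet T) γ μ₀ x < ⊤ ∧
          ∀ᵐ x ∂volume.restrict Ω, 0 < weight Ω (hatSet T) γ μ₀ x) ∧
        ∀ κ : ℝ, 0 < κ → ∀ μ : SignedMeasure (Rn n), μ Ω = 0 →
          μ.totalVariation ≤ ENNReal.ofReal κ • μ₀ →
          -- the solution is well defined and bounded by the weight
          (∀ᵐ x ∂volume.restrict Ω,
            (∀ᵐ y ∂μ.totalVariation,
              IntervalIntegrable (kernelIntegrand (hatSet T) x₀ γ χ x y) volume 0 1) ∧
            IntegrableOn (kernel (hatSet T) x₀ γ χ x) Ω μ.totalVariation) ∧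
          AEStronglyMeasurable (bogSolution Ω (hatSet T) x₀ γ χ μ) (volume.restrict Ω) ∧
          (∀ᵐ x ∂volume.restrict Ω, ‖bogSolution Ω (hatSet T) x₀ γ χ μ x‖ₑ
            ≤ ENNReal.ofReal (C * κ) * weight Ω (hatSet T) γ μ₀ x) ∧
          -- the identity for all test functions of the class `ℰ`
          (∀ (g : Rn n → ℝ) (v : Rn n → Rn n),
            MemE Ω (hatSet T) μ₀ (weight Ω (hatSet T) γ μ₀) g v →
            IntegrableOn (fun x => inner ℝ (bogSolution Ω (hatSet T) x₀ γ χ μ x) (v x)) Ω ∧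
            ∫ x in Ω, inner ℝ (bogSolution Ω (hatSet T) x₀ γ χ μ x) (v x)
              = -∫ᵛ x in Ω, g x ∂<•μ) ∧
          -- locally Lipschitz test functions with bounded local Lipschitz constant
          (∀ g : Rn n → ℝ,
            (∃ L : ℝ≥0, ∀ x ∈ hatSet T, ∃ V ∈ 𝓝 x, LipschitzOnWith L g V) →
            IntegrableOn g Ω μ₀ →
            IntegrableOn (fun x => inner ℝ (bogSolution Ω (hatSet T) x₀ γ χ μ x) (∇ g x)) Ω ∧
            ∫ x in Ω, inner ℝ (bogSolution Ω (hatSet T) x₀ γ χ μ x) (∇ g x)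
              = -∫ᵛ x in Ω, g x ∂<•μ) ∧
          -- Lipschitz test functions on the whole space
          (∀ (g : Rn n → ℝ) (L : ℝ≥0), LipschitzWith L g →
            IntegrableOn (fun x => inner ℝ (bogSolution Ω (hatSet T) x₀ γ χ μ x) (∇ g x)) Ω ∧
            ∫ x in Ω, inner ℝ (bogSolution Ω (hatSet T) x₀ γ χ μ x) (∇ g x)
              = -∫ᵛ x in Ω, g x ∂<•μ) := by
  have hTc := compl_nonempty_of_null_diff hn hΩb hT
  have hUeq := hatSet_eq_interior hTc
  have hUo : IsOpen (hatSet T) := hUeq ▸ isOpen_interior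
  have hΩU : Ω ⊆ hatSet T := hUeq ▸ interior_maximal hΩT hΩo
  have hnull := null_hatSet_diff (Ω := Ω) hT
  have hcl : hatSet T ⊆ closure Ω := subset_closure_of_null_diff hUo hnull
  have hUb : Bornology.IsBounded (hatSet T) := hΩb.closure.subset hcl
  have hUn : (hatSet T)ᶜ.Nonempty := compl_nonempty_of_isBounded hn hUb
  have hUc : IsConnected (hatSet T) := hΩc.subset_closure hΩU hcl
  refine ⟨exists_isPathSystem hUo hUc hUb hUn hΩU (hΩU hx₀), ?_⟩
  intro γ hγ s hs _ h15 χ hχ hχs hχ1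
  have hreg : IsRegularPathSystem Ω (hatSet T) x₀ γ :=
    ⟨hγ, hUo, hUn, hΩo, hΩU, hnull, fun y hy => geodesicDist_lt_top hUo hUn hUc.isPreconnected (hΩU hx₀) hy⟩
  have hcs : HasCompactSupport χ :=
    (isCompact_closedBall x₀ s).of_isClosed_subset (isClosed_tsupport χ) hχs
  obtain ⟨B, hB⟩ := hχ.continuous.bounded_above_of_compact_support hcs
  have hmol : IsMollifier χ x₀ s B := ⟨hχ, hχs, hs, hB⟩
  have hχm : Measurable χ := hχ.continuous.measurable
  obtain ⟨C, hC⟩ := hreg.exists_isKernelConstant hn hmol h15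
  -- The kernel constant may be zero; adding 1 makes the final one positive.
  refine ⟨C + 1, by positivity, ?_⟩
  intro μ₀ _ hμ₀ hne hd
  have hw := hreg.lintegral_weight_lt_top hn hΩb (hΩU hx₀) μ₀ hd
  refine ⟨⟨(hreg.measurable_weight μ₀).aemeasurable, hw,
    Filter.Eventually.of_forall fun x => weight_pos hn μ₀ hμ₀ hne x⟩, ?_⟩
  intro κ hκ μ hμΩ hμ
  have hk : ENNReal.ofReal κ ≠ ⊤ := ENNReal.ofReal_ne_top
  have hτ : IsFiniteMeasure μ.totalVariation := by
    rw [SignedMeasure.totalVariation]; infer_instance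
  have hτΩ : ∀ᵐ y ∂μ.totalVariation, y ∈ Ω := by
    rw [ae_iff]
    refine le_antisymm ((hμ _).trans ?_) zero_le
    have : μ₀ {y | y ∉ Ω} = 0 := hμ₀
    simp [this]
  have hbound := hC.ae_enorm_bogSolution_le hreg hn hχm hk hμ hw
  have hlip : ∀ (g : Rn n → ℝ) (L : ℝ≥0),
      (∀ x ∈ hatSet T, ∃ V ∈ 𝓝 x, LipschitzOnWith L g V) → IntegrableOn g Ω μ₀ →
      IntegrableOn (fun x => inner ℝ (bogSolution Ω (hatSet T) x₀ γ χ μ x) (∇ g x)) Ω ∧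
      ∫ x in Ω, inner ℝ (bogSolution Ω (hatSet T) x₀ γ χ μ x) (∇ g x) = -∫ᵛ x in Ω, g x ∂<•μ :=
    fun g L hL hg => hC.integral_inner_bogSolution_gradient hreg hn hχm hχ1 hk hμ hμΩ hw hL hg
  refine ⟨?_, hC.aestronglyMeasurable_bogSolution hreg hn hχm hk hμ hw, ?_, ?_, ?_, ?_⟩
  · filter_upwards [hC.ae_integrableOn hreg hn hχm hk hμ hw, ae_restrict_mem hΩo.measurableSet,
      ae_restrict_of_ae (ae_ae_ne hn μ.totalVariation)] with x hx hxΩ hxy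
    refine ⟨?_, hx⟩
    filter_upwards [hxy, hτΩ] with y hne hy
    exact ((hC y hy).1 x hxΩ hne).1
  · filter_upwards [hbound] with x hx
    refine hx.trans (mul_le_mul_left ?_ _)
    rw [ENNReal.ofReal_mul (by positivity)]
    refine mul_le_mul_left ?_ _
    rw [← ENNReal.ofReal_coe_nnreal]
    exact ENNReal.ofReal_le_ofReal (by linarith)
  · rintro g v ⟨⟨hgc, hgv, -⟩, hg, hv⟩
    exact hC.integral_inner_bogSolution hreg hn hχm hχ1 hk hμ hμΩ hw hgc hgv hg hv
  · rintro g ⟨L, hL⟩ hg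
    exact hlip g L hL hg
  · intro g L hL
    exact hlip g L (fun x _ => ⟨univ, Filter.univ_mem, hL.lipschitzOnWith⟩)
      (hL.integrableOn_of_isBounded hΩb hΩo.measurableSet μ₀)
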